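/- **Setting.** Let $A\in\mathbb R^{N\times N}$ and $B\in\mathbb R^{N\times d}$ with $\operatorname{rank}B=d$ satisfy the Kalman condition $\operatorname{rank}[B,AB,\dots,A^{N-1}B]=N$, and let $n:=\min\{r:\operatorname{rank}[B,AB,\dots,A^{r-1}B]=N\}$. For $h\in\{1,\dots,n\}$ put $V_h:=\sum_{k=1}^{h}\operatorname{Im}(A^{k-1}B)$, $V_0:=\{0\}$, and let $E_h:=V_h\cap V_{h-1}^{\perp}$, so that $\mathbb R^N=\bigoplus_{h=1}^nE_h$ orthogonally. Let $(e_i)_{1\le i\le N}$ be an orthonormal basis of $\mathbb R^N$ consisting of generators of the spaces $E_h$, i.e. with $I_h:=\{i: e_i\in E_h\}$, the family $\{e_i:i\in I_h\}$ spans $E_h$ for each $h\in\{1,\dots,n\}$. We write $D_i$ for the derivative in the direction $e_i$, and $D^2_{i,j}$, $D^3_{i,j,k}$ for the corresponding second and third derivatives. Let $b\in\mathbb R^d$, let $Q\in\mathbb R^{d\times d}$ be symmetric and non-negative definite, and let $\nu$ be a Lévy measure on $\mathbb R^d\setminus\{0\}$, i.e. $\int(1\wedge|z|^2)\,\nu(dz)<\infty$.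 Assume that there are $r_0>0$, $\alpha\in(0,2)$ and a finite measure $\mu$ on the unit sphere $\mathbb S^{d-1}$ such that $$\nu(C)\ \ge\ \int_0^{r_0}\!\int_{\mathbb S^{d-1}}\mathbf 1_C(r\theta)\,\mu(d\theta)\,\frac{dr}{r^{1+\alpha}}\qquad\text{for all Borel } C\subset\mathbb R^d\setminus\{0\},$$ where $\mu$ is non-degenerate: for some $\eta\ge1$, $\ \eta^{-1}|p|^\alpha\le\int_{\mathbb S^{d-1}}|p\cdot s|^\alpha\mu(ds)\le\eta|p|^\alpha$ for all $p\in\mathbb R^d$. Let $(Z_t)_{t\ge0}$ be a (càdlàg) Lévy process on $\mathbb R^d$ with $\mathbb E[e^{ip\cdot Z_t}]=e^{-t\Phi(p)}$, where $$\Phi(p)=-ib\cdot p+\tfrac12\,p\cdot Qp+\int\bigl(1-e^{ip\cdot z}+ip\cdot z\,\mathbf 1_{\{|z|<1\}}\bigr)\,\nu(dz).$$ For $x\in\mathbb R^N$ let $X^x$ be the solution of $X^x_t=x+\int_0^tAX^x_s\,ds+BZ_t$, $t\ge0$, almost surely, and let $P_t\phi(x):=\mathbb E[\phi(X^x_t)]$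 for bounded Borel measurable $\phi:\mathbb R^N\to\mathbb R$. **Proposition.** There is a constant $C>0$, depending only on $d,N,A,B,\alpha,\nu,r_0,\mu$, such that for every bounded Borel measurable $\phi:\mathbb R^N\to\mathbb R$ and every $t>0$ the function $P_t\phi$ is three times continuously differentiable on $\mathbb R^N$ and, for all $h,h',h''\in\{1,\dots,n\}$, $i\in I_h$, $j\in I_{h'}$, $k\in I_{h''}$, $$\|D_iP_t\phi\|_\infty\le C\|\phi\|_\infty\Bigl(1+t^{-\frac{1+\alpha(h-1)}{\alpha}}\Bigr),$$ $$\|D^2_{i,j}P_t\phi\|_\infty\le C\|\phi\|_\infty\Bigl(1+t^{-\frac{2+\alpha(h+h'-2)}{\alpha}}\Bigr),$$ $$\|D^3_{i,j,k}P_t\phi\|_\infty\le C\|\phi\|_\infty\Bigl(1+t^{-\frac{3+\alpha(h+h'+h''-3)}{\alpha}}\Bigr).$$ -/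

import Mathlib

open MeasureTheory ProbabilityTheory Filter Topology
open scoped NNReal ENNReal

namespace LevyOU

/-! ### Geometry of the drift -/

/-- The block matrix `[B, AB, …, A^{r-1}B]`; its column `(k, j)` is the `j`-th column of `A^k B`. -/
def kalmanMatrix {N d : ℕ} (A : Matrix (Fin N) (Fin N) ℝ) (B : Matrix (Fin N) (Fin d) ℝ) (r : ℕ) :
    Matrix (Fin N) (Fin r × Fin d) ℝ :=
  Matrix.of fun i q => (A ^ (q.1 : ℕ) * B) i q.2

/-- The Kalman rank condition `rank [B, AB, …, A^{N-1}B] = N`. -/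
def KalmanCondition {N d : ℕ} (A : Matrix (Fin N) (Fin N) ℝ) (B : Matrix (Fin N) (Fin d) ℝ) :
    Prop :=
  (kalmanMatrix A B N).rank = N

/-- The number of steps `n = min {r | rank [B, AB, …, A^{r-1}B] = N}`. -/
noncomputable def kalmanIndex {N d : ℕ}
    (A : Matrix (Fin N) (Fin N) ℝ) (B : Matrix (Fin N) (Fin d) ℝ) : ℕ :=
  sInf {r : ℕ | (kalmanMatrix A B r).rank = N}

/-- `V_h = Im B + Im (AB) + ⋯ + Im (A^{h-1}B)`; in particular `V_0 = 0`. -/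
noncomputable def flag {N d : ℕ} (A : Matrix (Fin N) (Fin N) ℝ) (B : Matrix (Fin N) (Fin d) ℝ)
    (h : ℕ) : Submodule ℝ (EuclideanSpace ℝ (Fin N)) :=
  ⨆ k : Fin h, LinearMap.range (Matrix.toEuclideanLin (A ^ (k : ℕ) * B))

/-- The space `E_h(ℝ^N)`, for `h ≥ 1`: it is `V_1` for `h = 1` and `(V_{h-1})^⊥ ∩ V_h` for `h ≥ 2`
(the two cases agree, as `V_0 = 0`). -/
noncomputable def block {N d : ℕ} (A : Matrix (Fin N) (Fin N) ℝ) (B : Matrix (Fin N) (Fin d) ℝ)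
    (h : ℕ) : Submodule ℝ (EuclideanSpace ℝ (Fin N)) :=
  (flag A B (h - 1))ᗮ ⊓ flag A B h

/-- The family `I_h` of the indexes `i` such that `e_i` lies in `E_h(ℝ^N)`. -/
def blockIndices {N d : ℕ} (A : Matrix (Fin N) (Fin N) ℝ) (B : Matrix (Fin N) (Fin d) ℝ)
    (e : OrthonormalBasis (Fin N) ℝ (EuclideanSpace ℝ (Fin N))) (h : ℕ) : Set (Fin N) :=
  {i | e i ∈ block A B h}

/-- An orthonormal basis of `ℝ^N` consisting of generators of the spaces `E_1, …, E_n`. -/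
def IsAdaptedBasis {N d : ℕ} (A : Matrix (Fin N) (Fin N) ℝ) (B : Matrix (Fin N) (Fin d) ℝ)
    (e : OrthonormalBasis (Fin N) ℝ (EuclideanSpace ℝ (Fin N))) : Prop :=
  ∀ h ∈ Finset.Icc 1 (kalmanIndex A B),
    Submodule.span ℝ (e '' blockIndices A B e h) = block A B h

/-! ### Lévy measures and non-degeneracy -/

/-- A Lévy measure on `ℝ^d ∖ {0}`, seen as a measure on `ℝ^d` that does not charge the origin. -/
structure IsLevyMeasure {d : ℕ} (ν : Measure (EuclideanSpace ℝ (Fin d))) : Prop where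
  zero : ν {0} = 0
  lintegral_lt_top : ∫⁻ z, ENNReal.ofReal (min 1 (‖z‖ ^ 2)) ∂ν < ∞

/-- Non-degeneracy of a finite measure on the unit sphere `S^{d-1}`, relative to the exponent
`α`. -/
def IsNonDegenerate {d : ℕ} (α : ℝ)
    (μ : Measure (Metric.sphere (0 : EuclideanSpace ℝ (Fin d)) 1)) : Prop :=
  ∃ η : ℝ, 1 ≤ η ∧ ∀ p : EuclideanSpace ℝ (Fin d),
    η⁻¹ * ‖p‖ ^ α ≤ ∫ s, |inner ℝ p (s : EuclideanSpace ℝ (Fin d))| ^ α ∂μ ∧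
      ∫ s, |inner ℝ p (s : EuclideanSpace ℝ (Fin d))| ^ α ∂μ ≤ η * ‖p‖ ^ α

/-- The non-degeneracy condition on `ν`: it dominates, on Borel subsets of `ℝ^d ∖ {0}`, the
truncated `α`-stable Lévy measure `1_{(0, r₀]}(r) μ(dθ) dr / r^{1+α}`. -/
structure ConditionND {d : ℕ} (ν : Measure (EuclideanSpace ℝ (Fin d))) (r₀ α : ℝ)
    (μ : Measure (Metric.sphere (0 : EuclideanSpace ℝ (Fin d)) 1)) : Prop where
  radius_pos : 0 < r₀
  exponent_pos : 0 < α
  exponent_lt_two : α < 2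
  isFiniteMeasure : IsFiniteMeasure μ
  nonDegenerate : IsNonDegenerate α μ
  le : ∀ C : Set (EuclideanSpace ℝ (Fin d)), MeasurableSet C → (0 : EuclideanSpace ℝ (Fin d)) ∉ C →
    ∫⁻ r in Set.Ioc 0 r₀,
      (∫⁻ θ, C.indicator 1 (r • (θ : EuclideanSpace ℝ (Fin d))) ∂μ) *
        ENNReal.ofReal (r ^ (-(1 + α))) ≤ ν C

/-- The Lévy symbol
`Φ(p) = -i b·p + ½ p·Qp + ∫ (1 - e^{i p·z} + i (p·z) 1_{B(0,1)}(z)) ν(dz)`. -/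
noncomputable def levySymbol {d : ℕ} (b : EuclideanSpace ℝ (Fin d)) (Q : Matrix (Fin d) (Fin d) ℝ)
    (ν : Measure (EuclideanSpace ℝ (Fin d))) (p : EuclideanSpace ℝ (Fin d)) : ℂ :=
  -Complex.I * (inner ℝ b p : ℝ) + (1 / 2 : ℂ) * (inner ℝ p (Matrix.toEuclideanLin Q p) : ℝ) +
    ∫ z, (1 - Complex.exp (Complex.I * (inner ℝ p z : ℝ)) +
      Complex.I * (inner ℝ p z : ℝ) *
        (Metric.ball (0 : EuclideanSpace ℝ (Fin d)) 1).indicator 1 z) ∂ν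

/-! ### Lévy processes and the Ornstein–Uhlenbeck equation -/

/-- Right-continuous functions of time with left limits. -/
def IsCadlag {E : Type*} [TopologicalSpace E] (f : ℝ≥0 → E) : Prop :=
  ∀ t, ContinuousWithinAt f (Set.Ici t) t ∧ ∃ l, Tendsto f (𝓝[<] t) (𝓝 l)

/-- `Z` is a Lévy process on `ℝ^d` under `P`, with Lévy symbol `Φ`, i.e.
`E[exp(i p·Z_t)] = exp(-t Φ(p))`. -/
structure IsLevyProcess {d : ℕ} {Ω : Type*} [MeasurableSpace Ω] (P : Measure Ω)
    (Z : ℝ≥0 → Ω → EuclideanSpace ℝ (Fin d)) (Φ : EuclideanSpace ℝ (Fin d) → ℂ) : Prop where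
  measurable : ∀ t, Measurable (Z t)
  zero : ∀ᵐ ω ∂P, Z 0 ω = 0
  indepIncrements : HasIndepIncrements Z P
  stationaryIncrements : ∀ s t : ℝ≥0, IdentDistrib (fun ω => Z (s + t) ω - Z s ω) (Z t) P P
  cadlag : ∀ᵐ ω ∂P, IsCadlag fun t => Z t ω
  charFun_eq : ∀ (t : ℝ≥0) (p : EuclideanSpace ℝ (Fin d)),
    charFun (P.map (Z t)) p = Complex.exp (-((t : ℝ) : ℂ) * Φ p)

/-- `X` is a solution of `X_t = x + ∫_0^t A X_s ds + B Z_t`, `t ≥ 0`, almost surely. -/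
structure IsOUProcess {N d : ℕ} (A : Matrix (Fin N) (Fin N) ℝ) (B : Matrix (Fin N) (Fin d) ℝ)
    {Ω : Type*} [MeasurableSpace Ω] (P : Measure Ω) (Z : ℝ≥0 → Ω → EuclideanSpace ℝ (Fin d))
    (x : EuclideanSpace ℝ (Fin N)) (X : ℝ≥0 → Ω → EuclideanSpace ℝ (Fin N)) : Prop where
  measurable : ∀ t, Measurable (X t)
  cadlag : ∀ᵐ ω ∂P, IsCadlag fun t => X t ω
  equation : ∀ᵐ ω ∂P, ∀ t : ℝ≥0,
    X t ω = x + (∫ s in (0 : ℝ)..t, Matrix.toEuclideanLin A (X s.toNNReal ω)) +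
      Matrix.toEuclideanLin B (Z t ω)

/-- The transition semigroup `P_t φ(x) = E[φ(X^x_t)]`, where `X x` is the process started
at `x`. -/
noncomputable def semigroup {N : ℕ} {Ω : Type*} [MeasurableSpace Ω] (P : Measure Ω)
    (X : EuclideanSpace ℝ (Fin N) → ℝ≥0 → Ω → EuclideanSpace ℝ (Fin N)) (t : ℝ≥0)
    (φ : EuclideanSpace ℝ (Fin N) → ℝ) (x : EuclideanSpace ℝ (Fin N)) : ℝ :=
  ∫ ω, φ (X x t ω) ∂P

/-- The supremum norm of a (bounded) function. -/
noncomputable def supNorm {E : Type*} (φ : E → ℝ) : ℝ := ⨆ x, |φ x|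

end LevyOU

set_option linter.unusedSectionVars false

/-! Fix t > 0 and put τ = min(t, 1). The variation of constants formula gives the law of X^x_t the
characteristic function e^{i⟨e^{tA}x, p⟩} exp(-∫₀ᵗ Φ((e^{uA}B)* p) du). The plan is to split off a
factor of this function that is smooth at exactly the right scale, and to let everything else act as
a harmless probability measure.

Since ν dominates the truncated stable measure, the stable jumps of size at most τ^{1/α} r₀ can be
removed from Φ for u in [t - τ, t], and what is left is still the exponent of a probability measure
m (`IsLevyMeasure.isExponent_sub`, `exists_remainder`). The drift b, the matrix Q and all other
jumps enter only through m, so no constant depends on b or Q.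

The factor split off is then rescaled. Let M_τ be the dilation acting as τ^{h-1} on E_h. As A raises
the degree of the flag V_h by at most one, there is a drift A_τ, polynomial in τ, with M_τ A_τ = τ A
M_τ, and M_τ B = B. Together with the α-homogeneity of the stable exponent
(`compExponent_polarMeasure_smul`) this turns the factor into exp(-∫₀¹ ψ((e^{sA_τ}B)* S* p) ds),
where ψ is the exponent of the stable measure truncated at r₀ and S = τ^{1/α} e^{(t-τ)A} M_τ
(`integral_compExponent_scalingMap`).

The parameter τ now ranges over the compact interval [0, 1]. Every pair (A_τ, B) is controllable,
including τ = 0, so by compactness ∫₀¹ |(e^{sA_τ}B)* q|^α ds ≥ c|q|^α uniformly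
(`exists_lower_bound_rescaled`). Bounded jumps make ψ smooth, the lower bound makes exp(-∫ψ) decay
rapidly, and Fourier inversion gives Schwartz functions ρ_τ whose derivatives are bounded in L¹
uniformly in τ (`exists_schwartz_density`, `exists_rescaled_density`).

Finally e^{tA}x = SΛx with Λ = τ^{-1/α} e^{A_τ} M_τ⁻¹, so P_tφ(x) = ∫ g(Λx + y) ρ_τ(y) dy with g(y)
= ∫ φ(Sy + w) m(dw), |g| ≤ ‖φ‖_∞ (`exists_semigroup_eq_average`). All derivatives fall on ρ_τ, and
one in a direction of E_h costs |Λe_i| ≤ K τ^{-(1/α + h - 1)}. These powers multiply, and τ^{-a} ≤ 1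
+ t^{-a}. -/

namespace LevyOU

/-! ### Characteristic functions and infinitely divisible exponents -/

section CharacteristicFunctions

variable {E F : Type*} [NormedAddCommGroup E] [InnerProductSpace ℝ E] [FiniteDimensional ℝ E]
  [MeasurableSpace E] [BorelSpace E] [NormedAddCommGroup F] [InnerProductSpace ℝ F]
  [FiniteDimensional ℝ F] [MeasurableSpace F] [BorelSpace F]

/-- `g` is the characteristic function of a probability measure. -/
def IsCharFun (g : E → ℂ) : Prop :=
  ∃ m : Measure E, IsProbabilityMeasure m ∧ ∀ p, charFun m p = g p

theorem isCharFun_one : IsCharFun (fun _ : E => (1 : ℂ)) :=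
  ⟨Measure.dirac 0, inferInstance, fun p => by simp [charFun_dirac]⟩

theorem IsCharFun.mul {g g' : E → ℂ} (hg : IsCharFun g) (hg' : IsCharFun g') :
    IsCharFun (fun p => g p * g' p) := by
  obtain ⟨m, hm, h⟩ := hg
  obtain ⟨m', hm', h'⟩ := hg'
  exact ⟨m ∗ m', inferInstance, fun p => by rw [charFun_conv, h, h']⟩

theorem IsCharFun.pow {g : E → ℂ} (hg : IsCharFun g) (n : ℕ) : IsCharFun (fun p => g p ^ n) := by
  induction n with
  | zero => simpa using isCharFun_one
  | succ n ih => simpa [pow_succ] using ih.mul hg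

theorem IsCharFun.comp_adjoint {g : E → ℂ} (hg : IsCharFun g) (L : E →L[ℝ] F) :
    IsCharFun (fun p => g (L.adjoint p)) := by
  obtain ⟨m, hm, h⟩ := hg
  refine ⟨m.map L, Measure.isProbabilityMeasure_map (by fun_prop), fun p => ?_⟩
  beta_reduce
  rw [← h, charFun_apply, charFun_apply, integral_map (by fun_prop) (by fun_prop)]
  simp_rw [ContinuousLinearMap.adjoint_inner_right]

/-- The witness is the mixture (1 - a) δ₀ + a m; its powers approximate compound Poisson laws. -/
theorem IsCharFun.convex_combination_one {g : E → ℂ} (hg : IsCharFun g) {a : ℝ} (ha : 0 ≤ a)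
    (ha1 : a ≤ 1) : IsCharFun (fun p => 1 + a * (g p - 1)) := by
  obtain ⟨m, hm, h⟩ := hg
  refine ⟨ENNReal.ofReal (1 - a) • Measure.dirac 0 + ENNReal.ofReal a • m, ⟨?_⟩, fun p => ?_⟩
  · simp [← ENNReal.ofReal_add (sub_nonneg.2 ha1) ha]
  · have hi : ∀ (k : Measure E) [IsFiniteMeasure k],
        Integrable (fun x => Complex.exp ((inner ℝ x p : ℝ) * Complex.I)) k := fun k _ =>
      (integrable_const (1 : ℝ)).mono' (by fun_prop)
        (by simp [Complex.norm_exp_ofReal_mul_I])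
    rw [charFun_apply, integral_add_measure ((hi _).smul_measure ENNReal.ofReal_ne_top)
      ((hi _).smul_measure ENNReal.ofReal_ne_top), integral_smul_measure, integral_smul_measure,
      integral_dirac, ← charFun_apply, h]
    simp [ENNReal.toReal_ofReal (sub_nonneg.2 ha1), ENNReal.toReal_ofReal ha]
    ring

/-- A pointwise limit of characteristic functions which is continuous at `0` is one. -/
theorem IsCharFun.of_tendsto {g : ℕ → E → ℂ} {f : E → ℂ} (hg : ∀ n, IsCharFun (g n))
    (hf : ContinuousAt f 0) (h : ∀ p, Tendsto (fun n => g n p) atTop (𝓝 (f p))) :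
    IsCharFun f := by
  choose m hm hmg using hg
  have hlim : ∀ p, Tendsto (fun n => charFun (m n) p) atTop (𝓝 (f p)) := by simpa [hmg] using h
  have htight := isTightMeasureSet_of_tendsto_charFun hf hlim
  let k : ℕ → ProbabilityMeasure E := fun n => ⟨m n, hm n⟩
  have hc : IsCompact (closure (Set.range k)) := by
    refine isCompact_closure_of_isTightMeasureSet (htight.subset ?_)
    rintro _ ⟨x, ⟨n, rfl⟩, rfl⟩
    exact ⟨n, rfl⟩
  -- By tightness the laws stay in a compact set, and any cluster point has characteristic function
  -- f. The hyperfilter selects one without extracting a subsequence.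
  obtain ⟨l, -, hl⟩ := hc.ultrafilter_le_nhds ((hyperfilter ℕ : Ultrafilter ℕ).map k)
    (by
      refine le_trans ?_ (principal_mono.2 subset_closure)
      simp)
  have hl' : Tendsto k (hyperfilter ℕ) (𝓝 l) := hl
  refine ⟨l, inferInstance, fun p => ?_⟩
  rw [ProbabilityMeasure.tendsto_iff_forall_integral_rclike_tendsto ℂ] at hl'
  have h1 := hl' (BoundedContinuousFunction.innerProbChar p)
  simp_rw [← charFun_eq_integral_innerProbChar] at h1
  exact tendsto_nhds_unique h1 ((hlim p).mono_left Nat.hyperfilter_le_atTop)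

/-- `Ψ` is the exponent of a convolution semigroup of probability measures. -/
def IsExponent (Ψ : E → ℂ) : Prop :=
  ∀ s : ℝ, 0 ≤ s → IsCharFun (fun p => Complex.exp (-(s * Ψ p)))

theorem IsExponent.add {Ψ Ψ' : E → ℂ} (h : IsExponent Ψ) (h' : IsExponent Ψ') :
    IsExponent (fun p => Ψ p + Ψ' p) := fun s hs => by
  convert (h s hs).mul (h' s hs) using 2 with p
  rw [← Complex.exp_add]
  congr 1
  ring

theorem IsExponent.smul {Ψ : E → ℂ} (h : IsExponent Ψ) {a : ℝ} (ha : 0 ≤ a) :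
    IsExponent (fun p => a * Ψ p) := fun s hs => by
  convert h (s * a) (mul_nonneg hs ha) using 4
  push_cast
  ring

theorem isExponent_zero : IsExponent (fun _ : E => (0 : ℂ)) := fun s _ => by
  simpa using isCharFun_one

theorem IsExponent.sum {ι : Type*} {Ψ : ι → E → ℂ} (s : Finset ι)
    (hg : ∀ i ∈ s, IsExponent (Ψ i)) : IsExponent (fun p => ∑ i ∈ s, Ψ i p) := by
  classical
  induction s using Finset.induction_on with
  | empty => simpa using isExponent_zero
  | insert a s ha ih =>
    simp only [Finset.sum_insert ha]
    exact (hg a (Finset.mem_insert_self a s)).add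
      (ih fun i hi => hg i (Finset.mem_insert_of_mem hi))

theorem IsExponent.comp_adjoint {Ψ : E → ℂ} (h : IsExponent Ψ) (L : E →L[ℝ] F) :
    IsExponent (fun p => Ψ (L.adjoint p)) := fun s hs => (h s hs).comp_adjoint L

theorem IsExponent.of_tendsto {Ψ : ℕ → E → ℂ} {Ψ' : E → ℂ} (hg : ∀ n, IsExponent (Ψ n))
    (hf : ContinuousAt Ψ' 0) (h : ∀ p, Tendsto (fun n => Ψ n p) atTop (𝓝 (Ψ' p))) :
    IsExponent Ψ' := fun s hs => by
  refine IsCharFun.of_tendsto (fun n => hg n s hs) (by fun_prop) fun p => ?_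
  exact (Complex.continuous_exp.tendsto _).comp ((h p).const_mul (s : ℂ)).neg

/-- The exponent of a compound Poisson semigroup. -/
theorem IsCharFun.isExponent_one_sub {g : E → ℂ} (hg : IsCharFun g) (hc : ContinuousAt g 0) :
    IsExponent (fun p => 1 - g p) := fun s hs => by
  -- The exponential is the limit of (1 + (s/n)(g - 1))ⁿ, and the base is a mixture with δ₀ only
  -- when s/n ≤ 1; shifting the index by n₀ + 1 ensures this for every term.
  obtain ⟨n₀, hn₀⟩ := exists_nat_ge s
  have hlim : ∀ p, Tendsto (fun n : ℕ => (1 + s * (g p - 1) / n) ^ n) atTop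
      (𝓝 (Complex.exp (-(s * (1 - g p))))) := fun p => by
    have := Complex.tendsto_one_add_div_pow_exp (s * (g p - 1))
    convert this using 3
    ring
  have hlim' := fun p => (hlim p).comp (tendsto_add_atTop_nat (n₀ + 1))
  refine IsCharFun.of_tendsto (fun n => ?_) (by fun_prop) hlim'
  have hpos : (0 : ℝ) < (n + (n₀ + 1) : ℕ) := by positivity
  have h1 := (hg.convex_combination_one (a := s / (n + (n₀ + 1) : ℕ)) (by positivity) (by
    rw [div_le_one hpos]
    push_cast
    linarith [(Nat.cast_nonneg n : (0 : ℝ) ≤ n)])).pow (n + (n₀ + 1))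
  convert h1 using 2 with p
  simp only [Function.comp_apply]
  congr 1
  push_cast
  ring

theorem continuous_integral_exp_inner (κ : Measure E) [IsFiniteMeasure κ] :
    Continuous fun p : E => ∫ z, Complex.exp (Complex.I * (inner ℝ p z : ℝ)) ∂κ := by
  refine continuous_of_dominated (bound := fun _ => 1) (fun p => by fun_prop)
    (fun p => ae_of_all _ fun z => ?_) (integrable_const _) (ae_of_all _ fun z => by fun_prop)
  rw [mul_comm, Complex.norm_exp_ofReal_mul_I]

theorem integrable_exp_inner (κ : Measure E) [IsFiniteMeasure κ] (p : E) :
    Integrable (fun z => Complex.exp (Complex.I * (inner ℝ p z : ℝ))) κ := by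
  refine (integrable_const (1 : ℝ)).mono' (by fun_prop) (ae_of_all _ fun z => ?_)
  rw [mul_comm, Complex.norm_exp_ofReal_mul_I]

/-- κ is its total mass times a probability measure, so this is a compound Poisson exponent with the
mass as intensity. -/
theorem isExponent_integral_one_sub_exp (κ : Measure E) [IsFiniteMeasure κ] :
    IsExponent (fun p => ∫ z, (1 - Complex.exp (Complex.I * (inner ℝ p z : ℝ))) ∂κ) := by
  by_cases h0 : κ = 0
  · simpa [h0] using isExponent_zero (E := E)
  have : NeZero κ := ⟨h0⟩
  have hg : IsCharFun fun p : E =>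
      ∫ z, Complex.exp (Complex.I * (inner ℝ p z : ℝ)) ∂((κ Set.univ)⁻¹ • κ) := by
    refine ⟨(κ Set.univ)⁻¹ • κ, inferInstance, fun p => ?_⟩
    rw [charFun_apply]
    congr 1 with z
    rw [mul_comm, real_inner_comm]
  have h1 := (hg.isExponent_one_sub
    (continuous_integral_exp_inner _).continuousAt).smul (a := κ.real Set.univ) (by positivity)
  convert h1 using 2 with p
  have hne : (κ.real Set.univ : ℂ) ≠ 0 := by
    simpa [Measure.real, ENNReal.toReal_eq_zero_iff] using h0
  rw [integral_sub (integrable_const _) (integrable_exp_inner κ p), integral_smul_measure]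
  simp only [integral_const, ENNReal.toReal_inv]
  rw [← Measure.real, Complex.real_smul, Complex.real_smul]
  push_cast
  field_simp

theorem isExponent_drift (b : E) :
    IsExponent (fun p : E => -Complex.I * (inner ℝ b p : ℝ)) := fun s _ =>
  ⟨Measure.dirac (s • b), inferInstance, fun p => by
    rw [charFun_dirac, real_inner_smul_left]
    congr 1
    push_cast
    ring⟩

theorem isExponent_gaussian {d : ℕ} {Q : Matrix (Fin d) (Fin d) ℝ} (hQ : Q.PosSemidef) :
    IsExponent (fun p : EuclideanSpace ℝ (Fin d) =>
      (1 / 2 : ℂ) * (inner ℝ p (Matrix.toEuclideanLin Q p) : ℝ)) := fun s hs =>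
  ⟨multivariateGaussian 0 (s • Q), inferInstance, fun p => by
    rw [charFun_multivariateGaussian (hQ.smul hs)]
    congr 1
    have : inner ℝ p (Matrix.toEuclideanLin Q p) = p.ofLp ⬝ᵥ Q.mulVec p.ofLp := by
      rw [EuclideanSpace.inner_eq_star_dotProduct]
      simp [Matrix.toLpLin_apply, dotProduct_comm]
    beta_reduce
    rw [this]
    simp [Matrix.smul_mulVec]
    ring⟩

end CharacteristicFunctions

/-! ### Riemann sums of right-continuous functions -/

section RiemannSums

variable {G : Type*} [NormedAddCommGroup G]

/-- The smallest multiple of `δ` which is at least `s`. -/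
noncomputable def gridCeil (δ s : ℝ) : ℝ := ⌈s / δ⌉₊ * δ

theorem le_gridCeil {δ : ℝ} (hδ : 0 < δ) (s : ℝ) : s ≤ gridCeil δ s :=
  (div_le_iff₀ hδ).1 (Nat.le_ceil _)

theorem gridCeil_lt {δ s : ℝ} (hδ : 0 < δ) (hs : 0 ≤ s) : gridCeil δ s < s + δ := by
  have h := mul_lt_mul_of_pos_right (Nat.ceil_lt_add_one (div_nonneg hs hδ.le)) hδ
  rwa [add_mul, div_mul_cancel₀ _ hδ.ne', one_mul] at h

theorem gridCeil_le_of_le {δ s : ℝ} (hδ : 0 < δ) {n : ℕ} (hs : s ≤ n * δ) :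
    gridCeil δ s ≤ n * δ := by
  refine mul_le_mul_of_nonneg_right ?_ hδ.le
  exact_mod_cast Nat.ceil_le.2 ((div_le_iff₀ hδ).2 hs)

theorem gridCeil_eq {δ s : ℝ} (hδ : 0 < δ) {k : ℕ} (hs : k * δ < s) (hs' : s ≤ (k + 1) * δ) :
    gridCeil δ s = (k + 1) * δ := by
  have : ⌈s / δ⌉₊ = k + 1 := by
    rw [Nat.ceil_eq_iff (by simp)]
    exact ⟨by simpa using (lt_div_iff₀ hδ).2 hs, by push_cast; exact (div_le_iff₀ hδ).2 hs'⟩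
  rw [gridCeil, this]
  push_cast
  rfl

/-- The composition factors through ℕ, hence no measurability of f is needed. -/
theorem stronglyMeasurable_comp_gridCeil (f : ℝ → G) (δ : ℝ) :
    StronglyMeasurable fun s => f (gridCeil δ s) := by
  have h1 : StronglyMeasurable fun k : ℕ => f (k * δ) := StronglyMeasurable.of_discrete
  exact h1.comp_measurable (Nat.measurable_ceil.comp (measurable_id.div_const δ))

/-- Rounding up approaches s from the right, which is why grids use right endpoints throughout:
right continuity then suffices. -/
theorem tendsto_comp_gridCeil {f : ℝ → G} {s : ℝ} (hs : 0 ≤ s)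
    (hf : ContinuousWithinAt f (Set.Ici s) s) {δ : ℕ → ℝ} (hδ : ∀ n, 0 < δ n)
    (hδ0 : Tendsto δ atTop (𝓝 0)) :
    Tendsto (fun n => f (gridCeil (δ n) s)) atTop (𝓝 (f s)) := by
  refine hf.tendsto.comp (tendsto_nhdsWithin_iff.2 ⟨?_, ?_⟩)
  · refine tendsto_of_tendsto_of_tendsto_of_le_of_le tendsto_const_nhds
      (h := fun n => s + δ n) (by simpa using hδ0.const_add s) (fun n => le_gridCeil (hδ n) s)
      (fun n => (gridCeil_lt (hδ n) hs).le)
  · exact Eventually.of_forall fun n => le_gridCeil (hδ n) s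

theorem tendsto_div_nat_succ (t : ℝ) : Tendsto (fun n : ℕ => t / ((n : ℝ) + 1)) atTop (𝓝 0) :=
  tendsto_const_nhds.div_atTop (tendsto_natCast_atTop_atTop.atTop_add tendsto_const_nhds)

variable {f : ℝ → G} {t M : ℝ}

theorem intervalIntegrable_of_rightContinuous (ht : 0 < t)
    (hf : ∀ s ∈ Set.Icc 0 t, ContinuousWithinAt f (Set.Ici s) s)
    (hM : ∀ s ∈ Set.Icc 0 t, ‖f s‖ ≤ M) : IntervalIntegrable f volume 0 t := by
  rw [intervalIntegrable_iff_integrableOn_Ioc_of_le ht.le]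
  refine (integrable_const M).mono' ?_ ?_
  · refine aestronglyMeasurable_of_tendsto_ae atTop
      (fun n : ℕ => (stronglyMeasurable_comp_gridCeil f (t / ((n : ℝ) + 1))).aestronglyMeasurable) ?_
    filter_upwards [ae_restrict_mem measurableSet_Ioc] with s hs
    exact tendsto_comp_gridCeil hs.1.le (hf s ⟨hs.1.le, hs.2⟩) (fun n => by positivity)
      (tendsto_div_nat_succ t)
  · filter_upwards [ae_restrict_mem measurableSet_Ioc] with s hs
    exact hM s ⟨hs.1.le, hs.2⟩

/-- The sum over cells is a single integral of ‖f - f ∘ `gridCeil`‖, which vanishes by dominated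
convergence with bound 2M. The norm stays inside the integral because the discretization of the
linear equation needs this stronger form. -/
theorem tendsto_sum_integral_norm_sub (ht : 0 < t)
    (hf : ∀ s ∈ Set.Icc 0 t, ContinuousWithinAt f (Set.Ici s) s)
    (hM : ∀ s ∈ Set.Icc 0 t, ‖f s‖ ≤ M) :
    Tendsto (fun n : ℕ => ∑ k ∈ Finset.range (n + 1),
      ∫ s in ((k : ℝ) * (t / ((n : ℝ) + 1)))..(((k : ℝ) + 1) * (t / ((n : ℝ) + 1))),
        ‖f s - f (((k : ℝ) + 1) * (t / ((n : ℝ) + 1)))‖) atTop (𝓝 0) := by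
  have hδ : ∀ n : ℕ, 0 < t / ((n : ℝ) + 1) := fun n => by positivity
  have hend : ∀ n : ℕ, t = ((n + 1 : ℕ) : ℝ) * (t / ((n : ℝ) + 1)) := fun n => by
    push_cast
    field_simp
  have hI := intervalIntegrable_of_rightContinuous ht hf hM
  have hg : ∀ n : ℕ, IntervalIntegrable (fun s => f (gridCeil (t / ((n : ℝ) + 1)) s)) volume 0 t :=
    fun n => by
    rw [intervalIntegrable_iff_integrableOn_Ioc_of_le ht.le]
    refine (integrable_const M).mono'
      (stronglyMeasurable_comp_gridCeil f _).aestronglyMeasurable ?_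
    filter_upwards [ae_restrict_mem measurableSet_Ioc] with s hs
    refine hM _ ⟨hs.1.le.trans (le_gridCeil (hδ n) s), ?_⟩
    have h1 := gridCeil_le_of_le (hδ n) (n := n + 1) (s := s) (by rw [← hend]; exact hs.2)
    rwa [← hend] at h1
  have key : ∀ n : ℕ, ∑ k ∈ Finset.range (n + 1),
      ∫ s in ((k : ℝ) * (t / ((n : ℝ) + 1)))..(((k : ℝ) + 1) * (t / ((n : ℝ) + 1))),
        ‖f s - f (((k : ℝ) + 1) * (t / ((n : ℝ) + 1)))‖ =
      ∫ s in (0 : ℝ)..t, ‖f s - f (gridCeil (t / ((n : ℝ) + 1)) s)‖ := fun n => by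
    have h1 := intervalIntegral.sum_integral_adjacent_intervals (μ := volume)
      (f := fun s => ‖f s - f (gridCeil (t / ((n : ℝ) + 1)) s)‖)
      (a := fun k : ℕ => (k : ℝ) * (t / ((n : ℝ) + 1))) (n := n + 1) (fun k hk => by
        refine (hI.sub (hg n)).norm.mono_set ?_
        rw [Set.uIcc_of_le (by gcongr; simp), Set.uIcc_of_le ht.le]
        refine Set.Icc_subset_Icc (mul_nonneg (Nat.cast_nonneg k) (hδ n).le) ?_
        refine le_trans (mul_le_mul_of_nonneg_right ?_ (hδ n).le) (hend n).ge
        exact_mod_cast hk)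
    beta_reduce at h1
    rw [← hend n, Nat.cast_zero, zero_mul] at h1
    rw [← h1]
    refine Finset.sum_congr rfl fun k _ => ?_
    push_cast
    refine intervalIntegral.integral_congr_ae (ae_of_all _ fun s hs => ?_)
    rw [Set.uIoc_of_le (by gcongr; simp)] at hs
    rw [gridCeil_eq (hδ n) hs.1 hs.2]
  simp_rw [key]
  rw [show 𝓝 (0 : ℝ) = 𝓝 (∫ s in (0 : ℝ)..t, (0 : ℝ)) by simp]
  refine intervalIntegral.tendsto_integral_filter_of_dominated_convergence (fun _ => M + M)
    (Eventually.of_forall fun n => ?_) (Eventually.of_forall fun n => ae_of_all _ fun s hs => ?_)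
    intervalIntegrable_const (ae_of_all _ fun s hs => ?_)
  · simpa only [Set.uIoc_of_le ht.le] using ((hI.sub (hg n)).norm).1.aestronglyMeasurable
  · rw [Set.uIoc_of_le ht.le] at hs
    rw [norm_norm]
    refine (norm_sub_le _ _).trans (add_le_add (hM s ⟨hs.1.le, hs.2⟩) (hM _ ⟨?_, ?_⟩))
    · exact hs.1.le.trans (le_gridCeil (hδ n) s)
    · have h1 := gridCeil_le_of_le (hδ n) (n := n + 1) (s := s) (by rw [← hend]; exact hs.2)
      rwa [← hend] at h1
  · rw [Set.uIoc_of_le ht.le] at hs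
    have h1 := tendsto_comp_gridCeil hs.1.le (hf s ⟨hs.1.le, hs.2⟩) hδ (tendsto_div_nat_succ t)
    simpa using (tendsto_const_nhds.sub h1).norm (a := f s - f s)

/-- Convergence of the Riemann sums over the right endpoints. -/
theorem tendsto_riemann_sum [NormedSpace ℝ G] [CompleteSpace G] (ht : 0 < t)
    (hf : ∀ s ∈ Set.Icc 0 t, ContinuousWithinAt f (Set.Ici s) s)
    (hM : ∀ s ∈ Set.Icc 0 t, ‖f s‖ ≤ M) :
    Tendsto (fun n : ℕ => ∑ k ∈ Finset.range (n + 1),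
      (t / ((n : ℝ) + 1)) • f (((k : ℝ) + 1) * (t / ((n : ℝ) + 1)))) atTop
      (𝓝 (∫ s in (0 : ℝ)..t, f s)) := by
  have hδ : ∀ n : ℕ, 0 < t / ((n : ℝ) + 1) := fun n => by positivity
  have hend : ∀ n : ℕ, t = ((n + 1 : ℕ) : ℝ) * (t / ((n : ℝ) + 1)) := fun n => by
    push_cast
    field_simp
  have hI := intervalIntegrable_of_rightContinuous ht hf hM
  rw [tendsto_iff_norm_sub_tendsto_zero]
  refine squeeze_zero (fun _ => norm_nonneg _) (fun n => ?_)
    (tendsto_sum_integral_norm_sub ht hf hM)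
  have hIk : ∀ k < n + 1, IntervalIntegrable f volume ((k : ℝ) * (t / ((n : ℝ) + 1)))
      (((k + 1 : ℕ) : ℝ) * (t / ((n : ℝ) + 1))) := fun k hk => by
    refine hI.mono_set ?_
    rw [Set.uIcc_of_le (by gcongr; simp), Set.uIcc_of_le ht.le]
    refine Set.Icc_subset_Icc (mul_nonneg (Nat.cast_nonneg k) (hδ n).le) ?_
    refine le_trans (mul_le_mul_of_nonneg_right ?_ (hδ n).le) (hend n).ge
    exact_mod_cast hk
  have h1 := intervalIntegral.sum_integral_adjacent_intervals (μ := volume) (f := f)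
    (a := fun k : ℕ => (k : ℝ) * (t / ((n : ℝ) + 1))) (n := n + 1) hIk
  beta_reduce at h1
  rw [← hend n, Nat.cast_zero, zero_mul] at h1
  rw [← h1, ← Finset.sum_sub_distrib]
  refine (norm_sum_le _ _).trans (Finset.sum_le_sum fun k hk => ?_)
  have hk' := hIk k (Finset.mem_range.1 hk)
  push_cast at hk' ⊢
  have h2 : (t / ((n : ℝ) + 1)) • f (((k : ℝ) + 1) * (t / ((n : ℝ) + 1))) =
      ∫ s in ((k : ℝ) * (t / ((n : ℝ) + 1)))..(((k : ℝ) + 1) * (t / ((n : ℝ) + 1))),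
        f (((k : ℝ) + 1) * (t / ((n : ℝ) + 1))) := by
    rw [intervalIntegral.integral_const]
    congr 1
    ring
  rw [h2, norm_sub_rev, ← intervalIntegral.integral_sub hk' (by simp)]
  exact intervalIntegral.norm_integral_le_integral_norm (by gcongr; simp)

end RiemannSums

/-! ### Integrals of exponents -/

section IntegralExponent

variable {E F : Type*} [NormedAddCommGroup E] [InnerProductSpace ℝ E] [FiniteDimensional ℝ E]
  [MeasurableSpace E] [BorelSpace E] [NormedAddCommGroup F] [InnerProductSpace ℝ F]
  [FiniteDimensional ℝ F] [MeasurableSpace F] [BorelSpace F]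

/-- Riemann sums are nonnegative combinations of the exponents Ψ ∘ (L u)*, and exponents are stable
under pointwise limits that are continuous at 0. -/
theorem IsExponent.intervalIntegral_comp_adjoint {Ψ : E → ℂ} (h : IsExponent Ψ)
    (hc : Continuous Ψ) {L : ℝ → E →L[ℝ] F} (hL : Continuous L) {a b : ℝ} (hab : a ≤ b) :
    IsExponent (fun p => ∫ u in a..b, Ψ ((L u).adjoint p)) := by
  rcases hab.eq_or_lt with rfl | hab
  · simpa using isExponent_zero
  have hLa : Continuous fun u : ℝ => (L u).adjoint := by
    exact (ContinuousLinearMap.adjoint (𝕜 := ℝ) (E := E) (F := F)).continuous.comp hL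
  have hj : Continuous fun q : F × ℝ => Ψ ((L q.2).adjoint q.1) :=
    hc.comp ((hLa.comp continuous_snd).clm_apply continuous_fst)
  refine IsExponent.of_tendsto (E := F) (Ψ := fun n p => ∑ k ∈ Finset.range (n + 1),
    (((b - a) / ((n : ℝ) + 1) : ℝ) : ℂ) *
      Ψ ((L (((k : ℝ) + 1) * ((b - a) / ((n : ℝ) + 1)) + a)).adjoint p)) (fun n => ?_) ?_ fun p => ?_
  · exact IsExponent.sum _ fun k _ =>
      (h.comp_adjoint _).smul (div_nonneg (sub_nonneg.2 hab.le) (by positivity))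
  · exact (intervalIntegral.continuous_parametric_intervalIntegral_of_continuous' hj a b).continuousAt
  · have hcont : Continuous fun u : ℝ => Ψ ((L (u + a)).adjoint p) :=
      hc.comp ((hLa.comp (continuous_id.add continuous_const)).clm_apply continuous_const)
    obtain ⟨M, hM⟩ := (isCompact_Icc (a := (0 : ℝ)) (b := b - a)).exists_bound_of_continuousOn
      hcont.continuousOn
    have h1 := tendsto_riemann_sum (sub_pos.2 hab) (fun s _ => hcont.continuousWithinAt) hM
    rw [intervalIntegral.integral_comp_add_right (fun u => Ψ ((L u).adjoint p))] at h1
    simpa [Complex.real_smul] using h1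

end IntegralExponent

/-! ### The linear flow -/

section Flow

variable {E : Type*} [NormedAddCommGroup E] [NormedSpace ℝ E] [CompleteSpace E]

/-- The flow `u ↦ e^{uA}`. -/
noncomputable def flow (A : E →L[ℝ] E) (u : ℝ) : E →L[ℝ] E := NormedSpace.exp (u • A)

theorem flow_zero (A : E →L[ℝ] E) : flow A 0 = 1 := by simp [flow]

theorem flow_add (A : E →L[ℝ] E) (u v : ℝ) : flow A (u + v) = flow A u * flow A v := by
  let : NormedAlgebra ℚ (E →L[ℝ] E) := NormedAlgebra.restrictScalars ℚ ℝ (E →L[ℝ] E)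
  rw [flow, add_smul]
  exact NormedSpace.exp_add_of_commute (((Commute.refl A).smul_left u).smul_right v)

theorem hasDerivAt_flow (A : E →L[ℝ] E) (u : ℝ) : HasDerivAt (flow A) (flow A u * A) u :=
  hasDerivAt_exp_smul_const A u

theorem continuous_flow (A : E →L[ℝ] E) : Continuous (flow A) :=
  continuous_iff_continuousAt.2 fun u => (hasDerivAt_flow A u).continuousAt

end Flow

/-! ### Càdlàg paths -/

/-- Near each point the left limit controls the path on the left and right continuity controls it on
the right; compactness of [0, t] does the rest. -/
theorem IsCadlag.exists_bound {E : Type*} [NormedAddCommGroup E] {f : ℝ≥0 → E} (hf : IsCadlag f)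
    (t : ℝ≥0) : ∃ M, ∀ s ≤ t, ‖f s‖ ≤ M := by
  have hloc : ∀ s : ℝ≥0, ∃ M, ∀ᶠ r in 𝓝 s, ‖f r‖ ≤ M := fun s => by
    obtain ⟨hr, l, hl⟩ := hf s
    refine ⟨max (‖f s‖ + 1) (‖l‖ + 1), ?_⟩
    rw [← nhdsLT_sup_nhdsGE, eventually_sup]
    refine ⟨?_, ?_⟩
    · filter_upwards [hl.norm.eventually_le_const (lt_add_one _)] with r h
      exact h.trans (le_max_right _ _)
    · filter_upwards [hr.norm.tendsto.eventually_le_const (lt_add_one _)] with r h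
      exact h.trans (le_max_left _ _)
  have := (isCompact_Icc (a := (0 : ℝ≥0)) (b := t)).induction_on
    (p := fun S => ∃ M, ∀ s ∈ S, ‖f s‖ ≤ M) ⟨0, by simp⟩
    (fun S T hST ⟨M, hM⟩ => ⟨M, fun s hs => hM s (hST hs)⟩)
    (fun S T ⟨M, hM⟩ ⟨M', hM'⟩ => ⟨max M M', fun s hs => hs.elim
      (fun h => (hM s h).trans (le_max_left _ _)) fun h => (hM' s h).trans (le_max_right _ _)⟩)
    (fun s _ => by
      obtain ⟨M, hM⟩ := hloc s
      exact ⟨_, mem_nhdsWithin_of_mem_nhds hM, M, fun r hr => hr⟩)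
  obtain ⟨M, hM⟩ := this
  exact ⟨M, fun s hs => hM s ⟨zero_le, hs⟩⟩

theorem IsCadlag.continuousWithinAt_toNNReal {E : Type*} [NormedAddCommGroup E] {f : ℝ≥0 → E}
    (hf : IsCadlag f) (s : ℝ) :
    ContinuousWithinAt (fun r : ℝ => f r.toNNReal) (Set.Ici s) s :=
  ((hf s.toNNReal).1).comp continuous_real_toNNReal.continuousWithinAt
    fun _ hr => Real.toNNReal_le_toNNReal hr

/-! ### Discretization of linear equations driven by a path -/

section Discretization

variable {E : Type*} [NormedAddCommGroup E] [NormedSpace ℝ E] [CompleteSpace E]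

/-- A solution of `X_t = x + ∫_0^t A X_s ds + z_t` is obtained from the Riemann–Stieltjes sums of
`∫_0^t e^{(t-s)A} dz_s`. -/
theorem tendsto_riemannStieltjes_sum (A : E →L[ℝ] E) {X z : ℝ≥0 → E} {x : E} (hX : IsCadlag X)
    (hz : z 0 = 0)
    (heq : ∀ t : ℝ≥0, X t = x + (∫ s in (0 : ℝ)..t, A (X s.toNNReal)) + z t) {t : ℝ≥0}
    (ht : 0 < t) :
    Tendsto (fun n : ℕ => ∑ k ∈ Finset.range (n + 1), flow A (t - k * (t / (n + 1)))
      (z ((k + 1 : ℕ) * (t / (n + 1))) - z (k * (t / (n + 1))))) atTop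
      (𝓝 (X t - flow A t x)) := by
  have ht' : (0 : ℝ) < t := ht
  have hδ : ∀ n : ℕ, (0 : ℝ) < t / ((n : ℝ) + 1) := fun n => by positivity
  have hend : ∀ n : ℕ, ((n + 1 : ℕ) : ℝ) * ((t : ℝ) / ((n : ℝ) + 1)) = t := fun n => by
    push_cast
    field_simp
  obtain ⟨M, hM⟩ := hX.exists_bound t
  have hM0 : 0 ≤ M := (norm_nonneg _).trans (hM 0 zero_le)
  have hfM : ∀ s ∈ Set.Icc (0 : ℝ) t, ‖X s.toNNReal‖ ≤ M := fun s hs =>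
    hM _ (Real.toNNReal_le_iff_le_coe.2 hs.2)
  have hfc : ∀ s ∈ Set.Icc (0 : ℝ) t,
      ContinuousWithinAt (fun r : ℝ => X r.toNNReal) (Set.Ici s) s := fun s _ =>
    hX.continuousWithinAt_toNNReal s
  have hI := intervalIntegrable_of_rightContinuous ht' hfc hfM
  have hsum := tendsto_sum_integral_norm_sub ht' hfc hfM
  obtain ⟨K, hK⟩ := (isCompact_Icc (a := (0 : ℝ)) (b := t)).exists_bound_of_continuousOn
    (continuous_flow A).continuousOn
  have hK0 : 0 ≤ K := (norm_nonneg _).trans (hK 0 ⟨le_rfl, ht'.le⟩)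
  have hx0 : X 0 = x := by simpa [hz] using heq 0
  -- the remainder of the first-order expansion of the flow
  let ρ : ℝ → ℝ := fun δ => ‖(1 : E →L[ℝ] E) - δ • A - flow A (-δ)‖
  -- Since e^{-δA} has derivative -A at δ = 0, ρ(δ) = o(δ), so n + 1 copies of ρ(t/(n+1)) still
  -- vanish.
  have hρ : Tendsto (fun n : ℕ => ((n : ℝ) + 1) * ρ (t / ((n : ℝ) + 1))) atTop (𝓝 0) := by
    have h1 : HasDerivAt (fun δ : ℝ => flow A (-δ)) (-A) 0 := by
      have := (hasDerivAt_flow A (-0)).scomp (0 : ℝ) (hasDerivAt_neg (0 : ℝ))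
      simpa [flow_zero, Function.comp_def] using this
    have h2 := (hasDerivAt_iff_isLittleO_nhds_zero.1 h1).norm_left
    have h3 := (h2.comp_tendsto (tendsto_div_nat_succ (t : ℝ))).tendsto_div_nhds_zero
    have h4 := h3.const_mul (t : ℝ)
    rw [mul_zero] at h4
    refine h4.congr fun n => ?_
    simp only [Function.comp_apply, zero_add, neg_zero, flow_zero, ρ]
    rw [← norm_neg]
    have : -(flow A (-(t / ((n : ℝ) + 1))) - 1 - (t / ((n : ℝ) + 1)) • -A) =
        1 - (t / ((n : ℝ) + 1)) • A - flow A (-(t / ((n : ℝ) + 1))) := by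
      rw [smul_neg]
      abel
    rw [this]
    field_simp
  rw [tendsto_iff_norm_sub_tendsto_zero]
  have hbound : Tendsto (fun n : ℕ => K * M * (((n : ℝ) + 1) * ρ (t / ((n : ℝ) + 1))) +
      K * ‖A‖ * ∑ k ∈ Finset.range (n + 1),
        ∫ s in ((k : ℝ) * (t / ((n : ℝ) + 1)))..(((k : ℝ) + 1) * (t / ((n : ℝ) + 1))),
          ‖X s.toNNReal - X (((k : ℝ) + 1) * (t / ((n : ℝ) + 1))).toNNReal‖) atTop (𝓝 0) := by
    simpa using (hρ.const_mul (K * M)).add (hsum.const_mul (K * ‖A‖))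
  refine squeeze_zero (fun _ => norm_nonneg _) (fun n => ?_) hbound
  have hfn : ∀ k : ℕ, X (((k : ℝ) * (t / ((n : ℝ) + 1))).toNNReal) = X (k * (t / (n + 1))) :=
    fun k => by
    congr 1
    rw [← Real.toNNReal_coe (r := k * (t / (n + 1)))]
    push_cast
    rfl
  -- telescoping
  have htel : X t - flow A t x = ∑ k ∈ Finset.range (n + 1),
      (flow A (t - (k + 1 : ℕ) * (t / ((n : ℝ) + 1))) (X ((k + 1 : ℕ) * (t / (n + 1)))) -
        flow A (t - (k : ℕ) * (t / ((n : ℝ) + 1))) (X ((k : ℕ) * (t / (n + 1))))) := by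
    rw [Finset.sum_range_sub (fun k : ℕ => flow A (t - k * (t / ((n : ℝ) + 1)))
      (X (k * (t / (n + 1)))))]
    have e1 : ((n + 1 : ℕ) : ℝ≥0) * (t / (n + 1)) = t := by
      rw [← NNReal.coe_inj]
      simpa using hend n
    rw [hend, e1]
    simp [flow_zero, hx0]
  rw [htel, ← Finset.sum_sub_distrib]
  -- With δ = t/(n+1) and y the value of X at the right end of the cell, the equation expresses the
  -- increment of z through X. The gap to the telescoping term is then e^{(t-kδ)A} applied to (1 -
  -- δA - e^{-δA})y - A∫(X_s - y)ds: a Taylor remainder and an oscillation of X.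
  have hterm : ∀ k ∈ Finset.range (n + 1), ‖flow A (t - k * (t / (n + 1)))
      (z ((k + 1 : ℕ) * (t / (n + 1))) - z (k * (t / (n + 1)))) -
      (flow A (t - (k + 1 : ℕ) * (t / ((n : ℝ) + 1))) (X ((k + 1 : ℕ) * (t / (n + 1)))) -
        flow A (t - (k : ℕ) * (t / ((n : ℝ) + 1))) (X ((k : ℕ) * (t / (n + 1)))))‖ ≤
      K * M * ρ (t / ((n : ℝ) + 1)) + K * ‖A‖ *
        ∫ s in ((k : ℝ) * (t / ((n : ℝ) + 1)))..(((k : ℝ) + 1) * (t / ((n : ℝ) + 1))),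
          ‖X s.toNNReal - X (((k : ℝ) + 1) * (t / ((n : ℝ) + 1))).toNNReal‖ := fun k hk => by
    have hk1 : (((k + 1 : ℕ) : ℝ)) * (t / ((n : ℝ) + 1)) ≤ t := by
      calc _ ≤ (((n + 1 : ℕ) : ℝ)) * (t / ((n : ℝ) + 1)) := by
            refine mul_le_mul_of_nonneg_right ?_ (hδ n).le
            exact_mod_cast Finset.mem_range.1 hk
        _ = t := hend n
    have hk0 : (0 : ℝ) ≤ (k : ℝ) * (t / ((n : ℝ) + 1)) := mul_nonneg (Nat.cast_nonneg k) (hδ n).le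
    have hkk : (k : ℝ) * (t / ((n : ℝ) + 1)) ≤ ((k + 1 : ℕ) : ℝ) * (t / ((n : ℝ) + 1)) := by
      gcongr
      simp
    have hI1 : IntervalIntegrable (fun r : ℝ => X r.toNNReal) volume 0
        ((k : ℝ) * (t / ((n : ℝ) + 1))) := hI.mono_set (by
      rw [Set.uIcc_of_le hk0, Set.uIcc_of_le ht'.le]
      exact Set.Icc_subset_Icc le_rfl (hkk.trans hk1))
    have hI2 : IntervalIntegrable (fun r : ℝ => X r.toNNReal) volume
        ((k : ℝ) * (t / ((n : ℝ) + 1))) (((k + 1 : ℕ) : ℝ) * (t / ((n : ℝ) + 1))) := hI.mono_set (by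
      rw [Set.uIcc_of_le hkk, Set.uIcc_of_le ht'.le]
      exact Set.Icc_subset_Icc hk0 hk1)
    set y : E := X ((k + 1 : ℕ) * (t / (n + 1))) with hy
    have hyM : ‖y‖ ≤ M := hM _ (by
      rw [← NNReal.coe_le_coe]
      simpa using hk1)
    have hdz : z ((k + 1 : ℕ) * (t / (n + 1))) - z (k * (t / (n + 1))) =
        y - X (k * (t / (n + 1))) -
          ∫ s in ((k : ℝ) * (t / ((n : ℝ) + 1)))..(((k + 1 : ℕ) : ℝ) * (t / ((n : ℝ) + 1))),
            A (X s.toNNReal) := by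
      have e1 := heq ((k + 1 : ℕ) * (t / (n + 1)))
      have e2 := heq (k * (t / (n + 1)))
      push_cast at e1 e2
      have e3 := intervalIntegral.integral_add_adjacent_intervals
        (A.integrable_comp hI1.1 |> fun h => (⟨h, A.integrable_comp hI1.2⟩ :
          IntervalIntegrable (fun s : ℝ => A (X s.toNNReal)) volume 0 _))
        (A.integrable_comp hI2.1 |> fun h => (⟨h, A.integrable_comp hI2.2⟩ :
          IntervalIntegrable (fun s : ℝ => A (X s.toNNReal)) volume _ _))
      push_cast at e3 ⊢
      rw [← e3] at e1
      rw [hy]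
      push_cast
      rw [e1, e2]
      abel
    have hflow : flow A (t - (k + 1 : ℕ) * (t / ((n : ℝ) + 1))) =
        flow A (t - k * (t / ((n : ℝ) + 1))) * flow A (-(t / ((n : ℝ) + 1))) := by
      rw [← flow_add]
      congr 1
      push_cast
      ring
    have hint : (∫ s in ((k : ℝ) * (t / ((n : ℝ) + 1)))..(((k + 1 : ℕ) : ℝ) * (t / ((n : ℝ) + 1))),
        A (X s.toNNReal)) = (t / ((n : ℝ) + 1)) • A y +
        A (∫ s in ((k : ℝ) * (t / ((n : ℝ) + 1)))..(((k + 1 : ℕ) : ℝ) * (t / ((n : ℝ) + 1))),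
          (X s.toNNReal - y)) := by
      rw [ContinuousLinearMap.intervalIntegral_comp_comm A hI2,
        intervalIntegral.integral_sub hI2 (by simp), intervalIntegral.integral_const, map_sub,
        map_smul]
      have : ((k + 1 : ℕ) : ℝ) * ((t : ℝ) / ((n : ℝ) + 1)) - k * (t / ((n : ℝ) + 1)) =
        t / ((n : ℝ) + 1) := by
        push_cast
        ring
      rw [this]
      abel
    rw [hdz, hflow, hint]
    have hrew : flow A (t - k * (t / ((n : ℝ) + 1))) (y - X (k * (t / (n + 1))) -
          ((t / ((n : ℝ) + 1)) • A y +
          A (∫ s in ((k : ℝ) * (t / ((n : ℝ) + 1)))..(((k + 1 : ℕ) : ℝ) * (t / ((n : ℝ) + 1))),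
            (X s.toNNReal - y)))) -
        ((flow A (t - k * (t / ((n : ℝ) + 1))) * flow A (-(t / ((n : ℝ) + 1)))) y -
          flow A (t - k * (t / ((n : ℝ) + 1))) (X (k * (t / (n + 1))))) =
        flow A (t - k * (t / ((n : ℝ) + 1)))
          (((1 : E →L[ℝ] E) - (t / ((n : ℝ) + 1)) • A - flow A (-(t / ((n : ℝ) + 1)))) y -
          A (∫ s in ((k : ℝ) * (t / ((n : ℝ) + 1)))..(((k + 1 : ℕ) : ℝ) * (t / ((n : ℝ) + 1))),
            (X s.toNNReal - y))) := by
      simp only [mul_apply_eq_comp, sub_apply, one_apply_eq_self, smul_apply, map_sub, map_add]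
      abel
    rw [hrew]
    have hKk : ‖flow A (t - k * (t / ((n : ℝ) + 1)))‖ ≤ K :=
      hK _ ⟨sub_nonneg.2 (hkk.trans hk1), by linarith⟩
    have hyy : X (((k : ℝ) + 1) * (t / ((n : ℝ) + 1))).toNNReal = y := by
      have := hfn (k + 1)
      push_cast at this
      rw [this, hy]
      push_cast
      rfl
    rw [hyy]
    refine (ContinuousLinearMap.le_opNorm _ _).trans ?_
    refine (mul_le_mul hKk (norm_sub_le _ _) (norm_nonneg _) hK0).trans ?_
    rw [mul_add]
    refine add_le_add ?_ ?_
    · rw [mul_assoc, mul_comm M]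
      exact mul_le_mul_of_nonneg_left ((ContinuousLinearMap.le_opNorm _ _).trans
        (mul_le_mul_of_nonneg_left hyM (norm_nonneg _))) hK0
    · rw [mul_assoc]
      refine mul_le_mul_of_nonneg_left ((ContinuousLinearMap.le_opNorm _ _).trans
        (mul_le_mul_of_nonneg_left ?_ (norm_nonneg _))) hK0
      have := intervalIntegral.norm_integral_le_integral_norm (f := fun s : ℝ => X s.toNNReal - y)
        (μ := volume) hkk
      push_cast at this ⊢
      exact this
  refine (norm_sum_le _ _).trans ((Finset.sum_le_sum hterm).trans ?_)
  rw [Finset.sum_add_distrib, Finset.sum_const, Finset.card_range, ← Finset.mul_sum, nsmul_eq_mul]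
  push_cast
  exact le_of_eq (by ring)

end Discretization

/-! ### The characteristic function of the Ornstein–Uhlenbeck process -/

section CharFunOU

variable {N d : ℕ}

/-- The continuous linear map between Euclidean spaces given by a matrix. -/
noncomputable def matrixCLM {m k : ℕ} (A : Matrix (Fin m) (Fin k) ℝ) :
    EuclideanSpace ℝ (Fin k) →L[ℝ] EuclideanSpace ℝ (Fin m) :=
  (Matrix.toEuclideanLin A).toContinuousLinearMap

/-- The maps `u ↦ e^{uA} B`. -/
noncomputable def flowMap (A : Matrix (Fin N) (Fin N) ℝ) (B : Matrix (Fin N) (Fin d) ℝ) (u : ℝ) :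
    EuclideanSpace ℝ (Fin d) →L[ℝ] EuclideanSpace ℝ (Fin N) :=
  (flow (matrixCLM A) u).comp (matrixCLM B)

theorem continuous_flowMap (A : Matrix (Fin N) (Fin N) ℝ) (B : Matrix (Fin N) (Fin d) ℝ) :
    Continuous (flowMap A B) :=
  (continuous_flow _).clm_comp continuous_const

theorem continuous_comp_adjoint {E F G : Type*} [NormedAddCommGroup E] [InnerProductSpace ℝ E]
    [CompleteSpace E] [NormedAddCommGroup F] [InnerProductSpace ℝ F] [CompleteSpace F]
    [TopologicalSpace G] {Φ : E → G} (hΦ : Continuous Φ) {L : ℝ → E →L[ℝ] F} (hL : Continuous L)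
    (p : F) : Continuous fun u => Φ ((L u).adjoint p) := by
  have hLa : Continuous fun u : ℝ => (L u).adjoint :=
    (ContinuousLinearMap.adjoint (𝕜 := ℝ) (E := E) (F := F)).continuous.comp hL
  exact hΦ.comp (hLa.clm_apply continuous_const)

variable {Ω : Type*} [MeasurableSpace Ω] {P : Measure Ω} [IsProbabilityMeasure P]
  {Z : ℝ≥0 → Ω → EuclideanSpace ℝ (Fin d)} {Φ : EuclideanSpace ℝ (Fin d) → ℂ}

theorem IsLevyProcess.charFun_map_sub (hZ : IsLevyProcess P Z Φ) (s t : ℝ≥0)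
    (p : EuclideanSpace ℝ (Fin d)) :
    charFun (P.map fun ω => Z (s + t) ω - Z s ω) p = Complex.exp (-((t : ℝ) : ℂ) * Φ p) := by
  rw [(hZ.stationaryIncrements s t).map_eq, hZ.charFun_eq]

theorem IsLevyProcess.charFun_map_sum (hZ : IsLevyProcess P Z Φ)
    (L : ℕ → EuclideanSpace ℝ (Fin d) →L[ℝ] EuclideanSpace ℝ (Fin N)) (δ : ℝ≥0) (n : ℕ)
    (p : EuclideanSpace ℝ (Fin N)) :
    charFun (P.map fun ω => ∑ k ∈ Finset.range n,
      L k (Z ((k + 1 : ℕ) * δ) ω - Z (k * δ) ω)) p =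
      Complex.exp (-∑ k ∈ Finset.range n, ((δ : ℝ) : ℂ) * Φ ((L k).adjoint p)) := by
  have hmono : Monotone fun k : ℕ => (k : ℝ≥0) * δ := fun a b hab => by
    beta_reduce
    gcongr
  have hind := (hZ.indepIncrements.nat hmono).comp (fun k => L k) fun k => (L k).measurable
  have hmeas : ∀ k : ℕ, Measurable fun ω => L k (Z ((k + 1 : ℕ) * δ) ω - Z (k * δ) ω) := fun k =>
    (L k).measurable.comp ((hZ.measurable _).sub (hZ.measurable _))
  have h1 := iIndepFun.charFun_map_fun_finsetSum_eq_prod (P := P) (s := Finset.range n)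
    (X := fun k ω => L k (Z ((k + 1 : ℕ) * δ) ω - Z (k * δ) ω))
    (fun k _ => (hmeas k).aemeasurable)
    (hind.precomp (g := fun k : Finset.range n => (k : ℕ)) Subtype.val_injective)
  rw [h1, Finset.prod_apply, ← Finset.sum_neg_distrib, Complex.exp_sum]
  refine Finset.prod_congr rfl fun k _ => ?_
  have h2 : (fun ω => L k (Z ((k + 1 : ℕ) * δ) ω - Z (k * δ) ω)) =
      L k ∘ fun ω => Z (k * δ + δ) ω - Z (k * δ) ω := by
    ext1 ω
    simp [add_mul]
  have h3 : Measurable fun ω => Z (k * δ + δ) ω - Z (k * δ) ω :=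
    (hZ.measurable _).sub (hZ.measurable _)
  rw [h2, ← Measure.map_map (L k).measurable h3,
    charFun_apply, integral_map (by fun_prop) (by fun_prop), ← neg_mul,
    ← hZ.charFun_map_sub (k * δ) δ, charFun_apply]
  simp_rw [ContinuousLinearMap.adjoint_inner_right]

/-- The Riemann–Stieltjes sums W n converge almost surely to X_t - e^{tA}x, while independence and
stationarity of increments make their characteristic functions exponentials of Riemann sums. The two
limits must agree. -/
theorem IsOUProcess.charFun_map {A : Matrix (Fin N) (Fin N) ℝ} {B : Matrix (Fin N) (Fin d) ℝ}
    (hZ : IsLevyProcess P Z Φ) (hΦ : Continuous Φ) {x : EuclideanSpace ℝ (Fin N)}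
    {X : ℝ≥0 → Ω → EuclideanSpace ℝ (Fin N)} (hX : IsOUProcess A B P Z x X) {t : ℝ≥0} (ht : 0 < t)
    (p : EuclideanSpace ℝ (Fin N)) :
    charFun (P.map (X t)) p = Complex.exp ((inner ℝ (flow (matrixCLM A) t x) p : ℝ) * Complex.I) *
      Complex.exp (-∫ u in (0 : ℝ)..t, Φ ((flowMap A B u).adjoint p)) := by
  have ht' : (0 : ℝ) < t := ht
  let L : ℕ → ℕ → EuclideanSpace ℝ (Fin d) →L[ℝ] EuclideanSpace ℝ (Fin N) := fun n k =>
    flowMap A B (t - k * (t / (n + 1)))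
  let W : ℕ → Ω → EuclideanSpace ℝ (Fin N) := fun n ω => ∑ k ∈ Finset.range (n + 1),
    L n k (Z ((k + 1 : ℕ) * (t / (n + 1))) ω - Z (k * (t / (n + 1))) ω)
  have hWm : ∀ n, Measurable (W n) := fun n => Finset.measurable_sum _ fun k _ =>
    (L n k).measurable.comp ((hZ.measurable _).sub (hZ.measurable _))
  have hlim : ∀ᵐ ω ∂P, Tendsto (fun n => W n ω) atTop
      (𝓝 (X t ω - flow (matrixCLM A) t x)) := by
    filter_upwards [hX.cadlag, hX.equation, hZ.zero] with ω hc he h0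
    have := tendsto_riemannStieltjes_sum (matrixCLM A) (X := fun t => X t ω)
      (z := fun t => matrixCLM B (Z t ω)) hc (by simp [h0]) he ht
    simpa only [W, L, flowMap, ContinuousLinearMap.comp_apply, map_sub] using this
  have hint : Tendsto (fun n => charFun (P.map (W n)) p) atTop
      (𝓝 (∫ ω, Complex.exp ((inner ℝ (X t ω - flow (matrixCLM A) t x) p : ℝ) * Complex.I) ∂P)) := by
    have h1 : ∀ n, charFun (P.map (W n)) p =
        ∫ ω, Complex.exp ((inner ℝ (W n ω) p : ℝ) * Complex.I) ∂P := fun n => by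
      rw [charFun_apply, integral_map (hWm n).aemeasurable (by fun_prop)]
    simp_rw [h1]
    refine tendsto_integral_of_dominated_convergence (fun _ => 1) (fun n => ?_)
      (integrable_const _) (fun n => ae_of_all _ fun ω => ?_) ?_
    · have := hWm n
      fun_prop
    · rw [Complex.norm_exp_ofReal_mul_I]
    · filter_upwards [hlim] with ω hω
      have hc : Continuous fun y : EuclideanSpace ℝ (Fin N) =>
          Complex.exp ((inner ℝ y p : ℝ) * Complex.I) := by fun_prop
      exact (hc.tendsto _).comp hω
  have hΦc := continuous_comp_adjoint hΦ (continuous_flowMap A B) p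
  have hriem : Tendsto (fun n => charFun (P.map (W n)) p) atTop
      (𝓝 (Complex.exp (-∫ u in (0 : ℝ)..t, Φ ((flowMap A B u).adjoint p)))) := by
    have h1 : ∀ n, charFun (P.map (W n)) p = Complex.exp (-∑ k ∈ Finset.range (n + 1),
        ((t : ℝ) / ((n : ℝ) + 1)) • Φ ((flowMap A B (((k : ℝ) + 1) * (t / (n + 1)))).adjoint p)) :=
      fun n => by
      have h2 := hZ.charFun_map_sum (L n) (t / (n + 1)) (n + 1) p
      -- The k-th increment carries the weight e^{(t-kδ)A}; reversing the order gives the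
      -- right-endpoint sum in the elapsed time u.
      rw [h2, ← Finset.sum_range_reflect]
      congr 2
      refine Finset.sum_congr rfl fun k hk => ?_
      rw [Complex.real_smul]
      have h3 : ((n + 1 - 1 - k : ℕ) : ℝ) = n - k := by
        rw [add_tsub_cancel_right, Nat.cast_sub (by simpa [Nat.lt_succ_iff] using hk)]
      simp only [L, h3]
      have h4 : (t : ℝ) - ((n : ℝ) - k) * (t / (n + 1)) = ((k : ℝ) + 1) * (t / (n + 1)) := by
        field_simp
        ring
      rw [h4]
      push_cast
      rfl
    simp_rw [h1]
    obtain ⟨M, hM⟩ := (isCompact_Icc (a := (0 : ℝ)) (b := t)).exists_bound_of_continuousOn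
      hΦc.continuousOn
    exact (Complex.continuous_exp.tendsto _).comp
      (tendsto_riemann_sum ht' (fun s _ => hΦc.continuousWithinAt) hM).neg
  rw [← tendsto_nhds_unique hint hriem, charFun_apply,
    integral_map (hX.measurable t).aemeasurable (by fun_prop), ← integral_const_mul]
  congr 1 with ω
  rw [← Complex.exp_add, inner_sub_left]
  congr 1
  push_cast
  ring

end CharFunOU

/-! ### Exponents of Lévy measures -/

theorem norm_one_sub_exp_le (x : ℝ) : ‖1 - Complex.exp (Complex.I * x)‖ ≤ |x| := by
  rw [norm_sub_rev]
  exact Real.norm_exp_I_mul_ofReal_sub_one_le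

theorem norm_one_sub_exp_le_two (x : ℝ) : ‖1 - Complex.exp (Complex.I * x)‖ ≤ 2 := by
  refine (norm_sub_le _ _).trans ?_
  rw [mul_comm, Complex.norm_exp_ofReal_mul_I]
  norm_num

theorem norm_one_sub_exp_add_le (x : ℝ) :
    ‖1 - Complex.exp (Complex.I * x) + Complex.I * x‖ ≤ 2 * x ^ 2 := by
  rcases le_total |x| 1 with hx | hx
  · have h := Complex.norm_exp_sub_one_sub_id_le (x := Complex.I * x) (by simpa using hx)
    rw [show 1 - Complex.exp (Complex.I * x) + Complex.I * x =
      -(Complex.exp (Complex.I * x) - 1 - Complex.I * x) by ring, norm_neg]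
    refine h.trans ?_
    simp only [norm_mul, Complex.norm_I, one_mul, Complex.norm_real, Real.norm_eq_abs, sq_abs]
    nlinarith [sq_nonneg x]
  · refine (norm_add_le _ _).trans ?_
    have h1 := norm_one_sub_exp_le x
    have h2 : ‖Complex.I * (x : ℂ)‖ = |x| := by simp
    rw [h2, ← sq_abs x]
    nlinarith

section Exponents

variable {F : Type*} [NormedAddCommGroup F] [InnerProductSpace ℝ F] [FiniteDimensional ℝ F]
  [MeasurableSpace F] [BorelSpace F]

theorem sq_inner_le (p z : F) : (inner ℝ p z) ^ 2 ≤ ‖p‖ ^ 2 * ‖z‖ ^ 2 := by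
  rw [← mul_pow, ← sq_abs]
  gcongr
  exact abs_real_inner_le_norm p z

/-- The fully compensated integrand of a Lévy exponent. -/
noncomputable def compKernel (p z : F) : ℂ :=
  1 - Complex.exp (Complex.I * (inner ℝ p z : ℝ)) + Complex.I * (inner ℝ p z : ℝ)

/-- The exponent with full compensation `∫ (1 - e^{i p·z} + i p·z) σ(dz)`. -/
noncomputable def compExponent (σ : Measure F) (p : F) : ℂ := ∫ z, compKernel p z ∂σ

theorem continuous_compKernel : Continuous fun q : F × F => compKernel q.1 q.2 := by
  unfold compKernel
  fun_prop

theorem norm_compKernel_le (p z : F) : ‖compKernel p z‖ ≤ 2 * ‖p‖ ^ 2 * ‖z‖ ^ 2 := by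
  refine (norm_one_sub_exp_add_le _).trans ?_
  have := sq_inner_le p z
  linarith

/-- Continuity of parametric integrals with a quadratic bound in the parameter. -/
theorem continuous_integral_of_quadratic_bound {k : F → F → ℂ} {w : F → ℝ} {σ : Measure F}
    {c : ℝ} (hk : ∀ p, AEStronglyMeasurable (k p) σ) (hc : ∀ z, Continuous fun p => k p z)
    (hw : Integrable w σ) (hw0 : ∀ z, 0 ≤ w z) (hb : ∀ p z, ‖k p z‖ ≤ (c + 2 * ‖p‖ ^ 2) * w z) :
    Continuous fun p => ∫ z, k p z ∂σ := by
  refine continuous_iff_continuousAt.2 fun p₀ => ?_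
  refine continuousAt_of_dominated (bound := fun z => (c + 2 * (‖p₀‖ + 1) ^ 2) * w z)
    (Eventually.of_forall hk) ?_ (hw.const_mul _) (ae_of_all _ fun z => (hc z).continuousAt)
  filter_upwards [Metric.ball_mem_nhds p₀ one_pos] with p hp
  refine ae_of_all _ fun z => (hb p z).trans ?_
  have h1 : ‖p‖ ≤ ‖p₀‖ + 1 := by
    have := norm_le_norm_add_norm_sub' p p₀
    rw [← dist_eq_norm] at this
    linarith [Metric.mem_ball.1 hp]
  have := hw0 z
  gcongr

theorem integrable_compKernel {σ : Measure F} (hσ : Integrable (fun z => ‖z‖ ^ 2) σ) (p : F) :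
    Integrable (compKernel p) σ := by
  refine (hσ.const_mul (2 * ‖p‖ ^ 2)).mono' ?_ (ae_of_all _ fun z => norm_compKernel_le p z)
  exact (continuous_compKernel.comp (by fun_prop : Continuous fun z : F => (p, z))).aestronglyMeasurable

theorem continuous_compExponent {σ : Measure F} (hσ : Integrable (fun z => ‖z‖ ^ 2) σ) :
    Continuous (compExponent σ) := by
  refine continuous_integral_of_quadratic_bound (c := 0) (fun p => (integrable_compKernel hσ p).1)
    (fun z => continuous_compKernel.comp (by fun_prop : Continuous fun p : F => (p, z))) hσ
    (fun z => by positivity) fun p z => ?_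
  rw [zero_add]
  exact norm_compKernel_le p z

end Exponents

/-! ### The Lévy symbol and the removal of a dominated jump measure -/

section LevySymbol

variable {d : ℕ} {ν : Measure (EuclideanSpace ℝ (Fin d))}

/-- The integrand of the Lévy symbol, compensated on the unit ball. -/
noncomputable def levyKernel (p z : EuclideanSpace ℝ (Fin d)) : ℂ :=
  1 - Complex.exp (Complex.I * (inner ℝ p z : ℝ)) + Complex.I * (inner ℝ p z : ℝ) *
    (Metric.ball (0 : EuclideanSpace ℝ (Fin d)) 1).indicator 1 z

theorem norm_levyKernel_le (p z : EuclideanSpace ℝ (Fin d)) :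
    ‖levyKernel p z‖ ≤ (2 + 2 * ‖p‖ ^ 2) * min 1 (‖z‖ ^ 2) := by
  unfold levyKernel
  by_cases hz : z ∈ Metric.ball (0 : EuclideanSpace ℝ (Fin d)) 1
  · have h1 : ‖z‖ < 1 := by simpa using hz
    have h2 : ‖z‖ ^ 2 ≤ 1 := by nlinarith [norm_nonneg z]
    have h3 := norm_compKernel_le p z
    rw [compKernel] at h3
    simp only [Set.indicator_of_mem hz, Pi.one_apply, mul_one, min_eq_right h2]
    nlinarith [sq_nonneg ‖z‖]
  · have h1 : 1 ≤ ‖z‖ := by simpa using hz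
    have h2 : 1 ≤ ‖z‖ ^ 2 := by nlinarith
    simp only [Set.indicator_of_notMem hz, mul_zero, add_zero, min_eq_left h2, mul_one]
    nlinarith [norm_one_sub_exp_le_two (inner ℝ p z), sq_nonneg ‖p‖]

theorem IsLevyMeasure.integrable_min (hν : IsLevyMeasure ν) :
    Integrable (fun z => min 1 (‖z‖ ^ 2)) ν := by
  refine ⟨by fun_prop, ?_⟩
  rw [hasFiniteIntegral_iff_ofReal (ae_of_all _ fun z => by positivity)]
  exact hν.lintegral_lt_top

theorem aestronglyMeasurable_levyKernel (p : EuclideanSpace ℝ (Fin d)) :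
    AEStronglyMeasurable (levyKernel p) ν := by
  refine Measurable.aestronglyMeasurable ?_
  unfold levyKernel
  refine Measurable.add (by fun_prop) (Measurable.mul (by fun_prop) ?_)
  exact measurable_one.indicator measurableSet_ball

theorem IsLevyMeasure.integrable_levyKernel (hν : IsLevyMeasure ν)
    (p : EuclideanSpace ℝ (Fin d)) : Integrable (levyKernel p) ν :=
  (hν.integrable_min.const_mul _).mono' (aestronglyMeasurable_levyKernel p)
    (ae_of_all _ fun z => norm_levyKernel_le p z)

theorem IsLevyMeasure.continuous_levySymbol (hν : IsLevyMeasure ν)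
    (b : EuclideanSpace ℝ (Fin d)) (Q : Matrix (Fin d) (Fin d) ℝ) :
    Continuous (levySymbol b Q ν) := by
  have h1 : Continuous fun p => ∫ z, levyKernel p z ∂ν := by
    refine continuous_integral_of_quadratic_bound (c := 2) aestronglyMeasurable_levyKernel
      (fun z => ?_) hν.integrable_min (fun z => by positivity) fun p z => norm_levyKernel_le p z
    unfold levyKernel
    fun_prop
  have h2 : Continuous fun p : EuclideanSpace ℝ (Fin d) => Matrix.toEuclideanLin Q p :=
    (Matrix.toEuclideanLin Q).continuous_of_finiteDimensional
  unfold levySymbol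
  unfold levyKernel at h1
  fun_prop

/-- The complement of a small ball. -/
def outerSet (d : ℕ) (n : ℕ) : Set (EuclideanSpace ℝ (Fin d)) := {z | 1 / ((n : ℝ) + 1) < ‖z‖}

theorem measurableSet_outerSet (n : ℕ) : MeasurableSet (outerSet d n) :=
  measurableSet_lt measurable_const measurable_norm

theorem monotone_outerSet : Monotone (outerSet d) := fun a b hab z hz => by
  simp only [outerSet, Set.mem_ofPred_eq] at hz ⊢
  refine lt_of_le_of_lt ?_ hz
  gcongr

theorem iUnion_outerSet : ⋃ n, outerSet d n = {0}ᶜ := by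
  ext z
  simp only [outerSet, Set.mem_iUnion, Set.mem_ofPred_eq, Set.mem_compl_iff, Set.mem_singleton_iff]
  refine ⟨fun ⟨n, hn⟩ h => ?_, fun h => exists_nat_one_div_lt (norm_pos_iff.2 h)⟩
  rw [h, norm_zero] at hn
  exact absurd hn (not_lt.2 (by positivity))

theorem tendsto_setIntegral_outerSet {σ : Measure (EuclideanSpace ℝ (Fin d))}
    {f : EuclideanSpace ℝ (Fin d) → ℂ} (hf : Integrable f σ) (hf0 : f 0 = 0) :
    Tendsto (fun n => ∫ z in outerSet d n, f z ∂σ) atTop (𝓝 (∫ z, f z ∂σ)) := by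
  have h := tendsto_setIntegral_of_monotone (fun n => measurableSet_outerSet (d := d) n)
    monotone_outerSet (hf.integrableOn)
  rwa [iUnion_outerSet, setIntegral_eq_integral_of_forall_compl_eq_zero] at h
  intro z hz
  rw [Set.notMem_compl_iff, Set.mem_singleton_iff] at hz
  rw [hz, hf0]

theorem measure_outerSet_lt_top {σ : Measure (EuclideanSpace ℝ (Fin d))}
    (hσ : Integrable (fun z => min 1 (‖z‖ ^ 2)) σ) (n : ℕ) : σ (outerSet d n) < ∞ := by
  have hε : (0 : ℝ) < (1 / ((n : ℝ) + 1)) ^ 2 := by positivity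
  refine (measure_mono ?_).trans_lt (hσ.measure_ge_lt_top hε)
  intro z hz
  simp only [outerSet, Set.mem_ofPred_eq] at hz ⊢
  refine le_min ?_ ?_
  · refine pow_le_one₀ (by positivity) ?_
    rw [div_le_one (by positivity)]
    linarith [(Nat.cast_nonneg n : (0 : ℝ) ≤ n)]
  · gcongr

/-- If `σ ≤ ν` away from the origin and `σ` has a second moment, then the Lévy symbol minus the
fully compensated exponent of `σ` is again an exponent. -/
theorem IsLevyMeasure.isExponent_sub (hν : IsLevyMeasure ν) (b : EuclideanSpace ℝ (Fin d))
    {Q : Matrix (Fin d) (Fin d) ℝ} (hQ : Q.PosSemidef) {σ : Measure (EuclideanSpace ℝ (Fin d))}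
    (hσ : Integrable (fun z => ‖z‖ ^ 2) σ)
    (hle : ∀ C : Set (EuclideanSpace ℝ (Fin d)), MeasurableSet C →
      (0 : EuclideanSpace ℝ (Fin d)) ∉ C → σ C ≤ ν C) :
    IsExponent (fun p => levySymbol b Q ν p - compExponent σ p) := by
  have hσmin : Integrable (fun z => min 1 (‖z‖ ^ 2)) σ :=
    hσ.mono' (by fun_prop) (ae_of_all _ fun z => by
      rw [Real.norm_of_nonneg (by positivity)]
      exact min_le_right _ _)
  have hνfin : ∀ n, IsFiniteMeasure (ν.restrict (outerSet d n)) := fun n =>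
    ⟨by simpa using measure_outerSet_lt_top hν.integrable_min n⟩
  have hσfin : ∀ n, IsFiniteMeasure (σ.restrict (outerSet d n)) := fun n =>
    ⟨by simpa using measure_outerSet_lt_top hσmin n⟩
  have hle' : ∀ n, σ.restrict (outerSet d n) ≤ ν.restrict (outerSet d n) := fun n => by
    refine Measure.le_iff.2 fun s hs => ?_
    rw [Measure.restrict_apply hs, Measure.restrict_apply hs]
    refine hle _ (hs.inter (measurableSet_outerSet n)) fun h => ?_
    have := h.2
    simp only [outerSet, Set.mem_ofPred_eq, norm_zero] at this
    exact absurd this (not_lt.2 (by positivity))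
  -- Both measures may be infinite near the origin. Outside a small ball they are finite, so their
  -- difference is a genuine finite measure and yields a compound Poisson exponent.
  let κ : ℕ → Measure (EuclideanSpace ℝ (Fin d)) := fun n =>
    ν.restrict (outerSet d n) - σ.restrict (outerSet d n)
  have hκ : ∀ n, κ n + σ.restrict (outerSet d n) = ν.restrict (outerSet d n) := fun n =>
    Measure.sub_add_cancel_of_le (hle' n)
  have hκfin : ∀ n, IsFiniteMeasure (κ n) := fun n =>
    ⟨lt_of_le_of_lt (Measure.sub_le _) (measure_lt_top (ν.restrict (outerSet d n)) _)⟩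
  -- the compensating drifts
  have hν1 : ∀ n, Integrable (fun z : EuclideanSpace ℝ (Fin d) =>
      (Metric.ball (0 : EuclideanSpace ℝ (Fin d)) 1).indicator id z)
      (ν.restrict (outerSet d n)) := fun n => by
    refine (integrable_const (1 : ℝ)).mono'
      (measurable_id.indicator measurableSet_ball).aestronglyMeasurable (ae_of_all _ fun z => ?_)
    by_cases hz : z ∈ Metric.ball (0 : EuclideanSpace ℝ (Fin d)) 1
    · rw [Set.indicator_of_mem hz]
      exact (mem_ball_zero_iff.1 hz).le
    · rw [Set.indicator_of_notMem hz]
      simp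
  have hσ1 : ∀ n, Integrable (fun z : EuclideanSpace ℝ (Fin d) => z)
      (σ.restrict (outerSet d n)) := fun n => by
    refine ((hσ.restrict).const_mul ((n : ℝ) + 1)).mono' (by fun_prop) ?_
    filter_upwards [ae_restrict_mem (measurableSet_outerSet n)] with z hz
    have h1 : 1 < ((n : ℝ) + 1) * ‖z‖ := by
      have := (div_lt_iff₀ (by positivity : (0 : ℝ) < (n : ℝ) + 1)).1 hz
      linarith
    nlinarith [norm_nonneg z]
  -- This drift accounts for both compensators, that of ν on the unit ball and the full one of σ. It
  -- need not converge; only the combined exponent does.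
  let c : ℕ → EuclideanSpace ℝ (Fin d) := fun n =>
    b - (∫ z in outerSet d n, (Metric.ball (0 : EuclideanSpace ℝ (Fin d)) 1).indicator id z ∂ν) +
      ∫ z in outerSet d n, z ∂σ
  have happrox : ∀ n p, -Complex.I * (inner ℝ (c n) p : ℝ) +
      (1 / 2 : ℂ) * (inner ℝ p (Matrix.toEuclideanLin Q p) : ℝ) +
      (∫ z, (1 - Complex.exp (Complex.I * (inner ℝ p z : ℝ))) ∂(κ n)) =
      -Complex.I * (inner ℝ b p : ℝ) +
        (1 / 2 : ℂ) * (inner ℝ p (Matrix.toEuclideanLin Q p) : ℝ) +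
        (∫ z in outerSet d n, levyKernel p z ∂ν) - ∫ z in outerSet d n, compKernel p z ∂σ :=
    fun n p => by
    have hi : ∀ (k : Measure (EuclideanSpace ℝ (Fin d))) [IsFiniteMeasure k],
        Integrable (fun z => 1 - Complex.exp (Complex.I * (inner ℝ p z : ℝ))) k := fun k _ =>
      (integrable_const 1).sub (integrable_exp_inner k p)
    have e1 := integral_add_measure (hi (κ n)) (hi (σ.restrict (outerSet d n)))
    rw [hκ n] at e1
    have e2 : ∫ z in outerSet d n, levyKernel p z ∂ν =
        (∫ z in outerSet d n, (1 - Complex.exp (Complex.I * (inner ℝ p z : ℝ))) ∂ν) +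
        Complex.I * (inner ℝ (∫ z in outerSet d n,
          (Metric.ball (0 : EuclideanSpace ℝ (Fin d)) 1).indicator id z ∂ν) p : ℝ) := by
      have hi2 : Integrable (fun z => Complex.I * ((inner ℝ p
          ((Metric.ball (0 : EuclideanSpace ℝ (Fin d)) 1).indicator id z) : ℝ) : ℂ))
          (ν.restrict (outerSet d n)) := (((hν1 n).const_inner p).ofReal).const_mul _
      rw [real_inner_comm, ← integral_inner (hν1 n) p, ← integral_complex_ofReal,
        ← integral_const_mul, ← integral_add (hi _) hi2]
      congr 1 with z
      unfold levyKernel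
      by_cases hz : z ∈ Metric.ball (0 : EuclideanSpace ℝ (Fin d)) 1
      · simp [Set.indicator_of_mem hz]
      · simp [Set.indicator_of_notMem hz]
    have e3 : ∫ z in outerSet d n, compKernel p z ∂σ =
        (∫ z in outerSet d n, (1 - Complex.exp (Complex.I * (inner ℝ p z : ℝ))) ∂σ) +
        Complex.I * (inner ℝ (∫ z in outerSet d n, z ∂σ) p : ℝ) := by
      have hi2 : Integrable (fun z => Complex.I * ((inner ℝ p z : ℝ) : ℂ))
          (σ.restrict (outerSet d n)) := (((hσ1 n).const_inner p).ofReal).const_mul _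
      rw [real_inner_comm, ← integral_inner (hσ1 n) p, ← integral_complex_ofReal,
        ← integral_const_mul, ← integral_add (hi _) hi2]
      rfl
    rw [e2, e3, e1]
    simp only [c, inner_add_left, inner_sub_left]
    push_cast
    ring
  refine IsExponent.of_tendsto (Ψ := fun n p => -Complex.I * (inner ℝ (c n) p : ℝ) +
      (1 / 2 : ℂ) * (inner ℝ p (Matrix.toEuclideanLin Q p) : ℝ) +
      (∫ z, (1 - Complex.exp (Complex.I * (inner ℝ p z : ℝ))) ∂(κ n))) (fun n => ?_) ?_ fun p => ?_
  · exact ((isExponent_drift _).add (isExponent_gaussian hQ)).add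
      (isExponent_integral_one_sub_exp (κ n))
  · exact ((hν.continuous_levySymbol b Q).sub (continuous_compExponent hσ)).continuousAt
  · simp_rw [happrox]
    refine (tendsto_const_nhds.add (tendsto_setIntegral_outerSet (hν.integrable_levyKernel p)
      ?_)).sub (tendsto_setIntegral_outerSet (integrable_compKernel hσ p) ?_)
    · simp [levyKernel]
    · simp [compKernel]

end LevySymbol

/-! ### The truncated stable measure -/

section Polar

variable {d : ℕ}

/-- The radial measure `1_{(0, ρ]}(r) dr / r^{1+α}`. -/
noncomputable def radialMeasure (α ρ : ℝ) : Measure ℝ :=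
  (volume.restrict (Set.Ioc 0 ρ)).withDensity fun r => ENNReal.ofReal (r ^ (-(1 + α)))

instance (α ρ : ℝ) : SFinite (radialMeasure α ρ) := by
  unfold radialMeasure
  infer_instance

/-- The measure `1_{(0, ρ]}(r) μ(dθ) dr / r^{1+α}` in polar coordinates. -/
noncomputable def polarMeasure (α ρ : ℝ)
    (μ : Measure (Metric.sphere (0 : EuclideanSpace ℝ (Fin d)) 1)) :
    Measure (EuclideanSpace ℝ (Fin d)) :=
  ((radialMeasure α ρ).prod μ).map fun q => q.1 • (q.2 : EuclideanSpace ℝ (Fin d))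

variable {α ρ : ℝ} {μ : Measure (Metric.sphere (0 : EuclideanSpace ℝ (Fin d)) 1)}

theorem measurable_rpow_density (α : ℝ) :
    Measurable fun r : ℝ => ENNReal.ofReal (r ^ (-(1 + α))) := by fun_prop

theorem measurable_polar :
    Measurable fun q : ℝ × Metric.sphere (0 : EuclideanSpace ℝ (Fin d)) 1 =>
      q.1 • (q.2 : EuclideanSpace ℝ (Fin d)) := by fun_prop

instance [SFinite μ] : SFinite (polarMeasure α ρ μ) := by
  unfold polarMeasure
  infer_instance

theorem polarMeasure_apply [SFinite μ] {C : Set (EuclideanSpace ℝ (Fin d))}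
    (hC : MeasurableSet C) :
    polarMeasure α ρ μ C = ∫⁻ r in Set.Ioc 0 ρ,
      (∫⁻ θ, C.indicator 1 (r • (θ : EuclideanSpace ℝ (Fin d))) ∂μ) *
        ENNReal.ofReal (r ^ (-(1 + α))) := by
  have h1 : MeasurableSet ((fun q : ℝ × Metric.sphere (0 : EuclideanSpace ℝ (Fin d)) 1 =>
      q.1 • (q.2 : EuclideanSpace ℝ (Fin d))) ⁻¹' C) := measurable_polar hC
  rw [polarMeasure, Measure.map_apply measurable_polar hC, Measure.prod_apply h1, radialMeasure,
    lintegral_withDensity_eq_lintegral_mul _ (measurable_rpow_density α)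
      (measurable_measure_prodMk_left h1)]
  refine lintegral_congr fun r => ?_
  rw [Pi.mul_apply, mul_comm]
  congr 1
  rw [← lintegral_indicator_one (measurable_prodMk_left h1)]
  rfl

theorem ConditionND.polarMeasure_le {ν : Measure (EuclideanSpace ℝ (Fin d))} {r₀ : ℝ}
    (h : ConditionND ν r₀ α μ) (hρ : ρ ≤ r₀) (C : Set (EuclideanSpace ℝ (Fin d)))
    (hC : MeasurableSet C) (h0 : (0 : EuclideanSpace ℝ (Fin d)) ∉ C) :
    polarMeasure α ρ μ C ≤ ν C := by
  have := h.isFiniteMeasure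
  rw [polarMeasure_apply hC]
  exact (lintegral_mono_set (Set.Ioc_subset_Ioc_right hρ)).trans (h.le C hC h0)

theorem integrable_sq_radialMeasure (hα : α < 2) (hρ : 0 ≤ ρ) :
    Integrable (fun r : ℝ => r ^ 2) (radialMeasure α ρ) := by
  rw [radialMeasure, integrable_withDensity_iff_integrable_smul' (measurable_rpow_density α)
    (ae_of_all _ fun _ => ENNReal.ofReal_lt_top)]
  have h1 : IntervalIntegrable (fun r : ℝ => r ^ (1 - α)) volume 0 ρ :=
    intervalIntegral.intervalIntegrable_rpow' (by linarith)
  rw [intervalIntegrable_iff_integrableOn_Ioc_of_le hρ] at h1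
  refine h1.congr ?_
  filter_upwards [ae_restrict_mem measurableSet_Ioc] with r hr
  rw [ENNReal.toReal_ofReal (Real.rpow_nonneg hr.1.le _), smul_eq_mul, ← Real.rpow_natCast r 2,
    ← Real.rpow_add hr.1]
  congr 1
  push_cast
  ring

theorem integrable_sq_polarMeasure [IsFiniteMeasure μ] (hα : α < 2) (hρ : 0 ≤ ρ) :
    Integrable (fun z => ‖z‖ ^ 2) (polarMeasure α ρ μ) := by
  rw [polarMeasure, integrable_map_measure (by fun_prop) (by fun_prop)]
  have h1 := (integrable_sq_radialMeasure hα hρ).mul_prod (integrable_const (1 : ℝ) (μ := μ))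
  refine h1.congr (ae_of_all _ fun q => ?_)
  simp [norm_smul]

theorem ae_norm_le_polarMeasure [SFinite μ] : ∀ᵐ z ∂(polarMeasure α ρ μ), ‖z‖ ≤ ρ := by
  rw [ae_iff, polarMeasure_apply (by measurability)]
  refine (setLIntegral_congr_fun measurableSet_Ioc fun r hr => ?_).trans lintegral_zero
  have : ∀ θ : Metric.sphere (0 : EuclideanSpace ℝ (Fin d)) 1,
      r • (θ : EuclideanSpace ℝ (Fin d)) ∉ {z : EuclideanSpace ℝ (Fin d) | ¬‖z‖ ≤ ρ} := fun θ => by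
    simp [norm_smul, abs_of_pos hr.1, hr.2]
  simp only [Set.indicator_of_notMem (this _), lintegral_zero, zero_mul]

/-- Integration in polar coordinates. -/
theorem integral_polarMeasure [IsFiniteMeasure μ] (hρ : 0 ≤ ρ) {G : Type*} [NormedAddCommGroup G]
    [NormedSpace ℝ G] {f : EuclideanSpace ℝ (Fin d) → G}
    (hf : Integrable f (polarMeasure α ρ μ)) :
    ∫ z, f z ∂(polarMeasure α ρ μ) = ∫ θ, (∫ r in (0 : ℝ)..ρ,
      r ^ (-(1 + α)) • f (r • (θ : EuclideanSpace ℝ (Fin d)))) ∂μ := by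
  have hf' := hf
  rw [polarMeasure, integrable_map_measure hf.1 (by fun_prop)] at hf'
  rw [polarMeasure, integral_map (by fun_prop) hf.1]
  refine (integral_prod_symm _ hf').trans (integral_congr_ae (ae_of_all _ fun θ => ?_))
  simp only [Function.comp_apply]
  rw [radialMeasure, integral_withDensity_eq_integral_toReal_smul (measurable_rpow_density α)
    (ae_of_all _ fun _ => ENNReal.ofReal_lt_top), intervalIntegral.integral_of_le hρ]
  refine setIntegral_congr_fun measurableSet_Ioc fun r hr => ?_
  beta_reduce
  rw [ENNReal.toReal_ofReal (Real.rpow_nonneg hr.1.le _)]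

/-- The integrand is integrable along almost every ray, and so are the integrals over the rays. -/
theorem integrable_integral_ray [IsFiniteMeasure μ] (hρ : 0 ≤ ρ) {G : Type*}
    [NormedAddCommGroup G] [NormedSpace ℝ G] {f : EuclideanSpace ℝ (Fin d) → G}
    (hf : Integrable f (polarMeasure α ρ μ)) :
    Integrable (fun θ : Metric.sphere (0 : EuclideanSpace ℝ (Fin d)) 1 => ∫ r in (0 : ℝ)..ρ,
      r ^ (-(1 + α)) • f (r • (θ : EuclideanSpace ℝ (Fin d)))) μ := by
  have hf' := hf
  rw [polarMeasure, integrable_map_measure hf.1 (by fun_prop)] at hf'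
  refine hf'.integral_prod_right.congr (ae_of_all _ fun θ => ?_)
  simp only [Function.comp_apply]
  rw [radialMeasure, integral_withDensity_eq_integral_toReal_smul (measurable_rpow_density α)
    (ae_of_all _ fun _ => ENNReal.ofReal_lt_top), intervalIntegral.integral_of_le hρ]
  refine setIntegral_congr_fun measurableSet_Ioc fun r hr => ?_
  beta_reduce
  rw [ENNReal.toReal_ofReal (Real.rpow_nonneg hr.1.le _)]

theorem compKernel_smul (c : ℝ) (p z : EuclideanSpace ℝ (Fin d)) :
    compKernel (c • p) z = compKernel p (c • z) := by
  simp [compKernel, real_inner_smul_left, real_inner_smul_right]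

/-- Scaling of the truncated stable exponent. -/
theorem compExponent_polarMeasure_smul [IsFiniteMeasure μ] (hα : α < 2) (hρ : 0 ≤ ρ) {c : ℝ}
    (hc : 0 < c) (p : EuclideanSpace ℝ (Fin d)) :
    compExponent (polarMeasure α ρ μ) (c • p) =
      (c ^ α : ℝ) * compExponent (polarMeasure α (c * ρ) μ) p := by
  have hcρ : 0 ≤ c * ρ := by positivity
  rw [compExponent, compExponent,
    integral_polarMeasure hρ (integrable_compKernel (integrable_sq_polarMeasure hα hρ) _),
    integral_polarMeasure hcρ (integrable_compKernel (integrable_sq_polarMeasure hα hcρ) _),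
    ← integral_const_mul]
  refine integral_congr_ae (ae_of_all _ fun θ => ?_)
  beta_reduce
  -- Substituting r ↦ cr, the density gives c^{1+α} and dr gives c⁻¹, which leaves c^α and moves the
  -- truncation radius to cρ.
  have h1 := intervalIntegral.integral_comp_mul_left (a := 0) (b := ρ)
    (fun r : ℝ => r ^ (-(1 + α)) • compKernel p (r • (θ : EuclideanSpace ℝ (Fin d)))) hc.ne'
  rw [mul_zero] at h1
  have h2 : ∫ r in (0 : ℝ)..ρ, (c * r) ^ (-(1 + α)) •
      compKernel p ((c * r) • (θ : EuclideanSpace ℝ (Fin d))) =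
      (c ^ (-(1 + α)) : ℝ) • ∫ r in (0 : ℝ)..ρ, r ^ (-(1 + α)) •
        compKernel (c • p) (r • (θ : EuclideanSpace ℝ (Fin d))) := by
    rw [← intervalIntegral.integral_smul]
    refine intervalIntegral.integral_congr fun r hr => ?_
    rw [Set.uIcc_of_le hρ] at hr
    beta_reduce
    rw [compKernel_smul, Real.mul_rpow hc.le hr.1, smul_smul, smul_smul]
  rw [h2] at h1
  have h3 : (c ^ α : ℝ) * c = c ^ (1 + α) := by
    rw [add_comm, Real.rpow_add_one hc.ne']
  have h4 : (c ^ (-(1 + α)) : ℝ) = (c ^ (1 + α))⁻¹ := Real.rpow_neg hc.le _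
  have h5 : (c ^ (1 + α) : ℝ) ≠ 0 := (Real.rpow_pos_of_pos hc _).ne'
  have h6 := congrArg (fun x : ℂ => (c ^ (1 + α) : ℝ) • x) h1
  simp only [smul_smul, h4, mul_inv_cancel₀ h5, one_smul] at h6
  rw [← Complex.real_smul, h6, ← h3]
  congr 1
  field_simp

theorem one_sub_cos_ge {x : ℝ} (hx : |x| ≤ 1) : x ^ 2 / 5 ≤ 1 - Real.cos x := by
  have h1 := Real.cos_le_one_sub_mul_cos_sq (x := x) (hx.trans (by linarith [Real.pi_gt_three]))
  have h2 : (1 : ℝ) / 5 ≤ 2 / Real.pi ^ 2 := by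
    rw [div_le_div_iff₀ (by norm_num) (by positivity)]
    nlinarith [Real.pi_lt_d2, Real.pi_gt_three]
  nlinarith [sq_nonneg x]

theorem integrableOn_ray (hα : α < 2) (hρ : 0 ≤ ρ) (u : ℝ) :
    IntervalIntegrable (fun r : ℝ => r ^ (-(1 + α)) * (1 - Real.cos (r * u))) volume 0 ρ := by
  have h1 : IntervalIntegrable (fun r : ℝ => r ^ (1 - α) * u ^ 2) volume 0 ρ :=
    (intervalIntegral.intervalIntegrable_rpow' (by linarith)).mul_const _
  rw [intervalIntegrable_iff_integrableOn_Ioc_of_le hρ] at h1 ⊢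
  refine h1.mono' (by fun_prop) ?_
  filter_upwards [ae_restrict_mem measurableSet_Ioc] with r hr
  have h0 : 0 ≤ 1 - Real.cos (r * u) := by linarith [Real.cos_le_one (r * u)]
  have h2 : 1 - Real.cos (r * u) ≤ r ^ 2 * u ^ 2 := by
    have := Real.one_sub_sq_div_two_le_cos (x := r * u)
    nlinarith [sq_nonneg (r * u)]
  rw [Real.norm_of_nonneg (mul_nonneg (Real.rpow_nonneg hr.1.le _) h0)]
  calc r ^ (-(1 + α)) * (1 - Real.cos (r * u)) ≤ r ^ (-(1 + α)) * (r ^ 2 * u ^ 2) :=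
        mul_le_mul_of_nonneg_left h2 (Real.rpow_nonneg hr.1.le _)
    _ = r ^ (1 - α) * u ^ 2 := by
        rw [← mul_assoc, ← Real.rpow_natCast r 2, ← Real.rpow_add hr.1]
        congr 2
        push_cast
        ring

/-- The one-dimensional lower bound for the truncated stable exponent. -/
theorem exists_ray_lower_bound (hα0 : 0 < α) (hα : α < 2) (hρ : 0 < ρ) :
    ∃ c : ℝ, 0 < c ∧ ∀ u : ℝ, c * (|u| ^ α - 1) ≤
      ∫ r in (0 : ℝ)..ρ, r ^ (-(1 + α)) * (1 - Real.cos (r * u)) := by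
  -- For |u| ≤ 1 the left side is nonpositive. For |u| ≥ 1 only r ≤ a/|u| is kept: there |ru| ≤ 1,
  -- so 1 - cos(ru) ≥ (ru)²/5, and ∫ r^{1-α} u²/5 dr = a^{2-α}|u|^α / (5(2-α)).
  set a : ℝ := min ρ 1 with ha
  have ha0 : 0 < a := by positivity
  refine ⟨a ^ (2 - α) / (5 * (2 - α)), div_pos (Real.rpow_pos_of_pos ha0 _) (by linarith),
    fun u => ?_⟩
  have hpos : ∀ r ∈ Set.Ioc 0 ρ, 0 ≤ r ^ (-(1 + α)) * (1 - Real.cos (r * u)) := fun r hr =>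
    mul_nonneg (Real.rpow_nonneg hr.1.le _) (by linarith [Real.cos_le_one (r * u)])
  have hc : 0 < a ^ (2 - α) / (5 * (2 - α)) :=
    div_pos (Real.rpow_pos_of_pos ha0 _) (by linarith)
  rcases le_total |u| 1 with hu | hu
  · have h1 : |u| ^ α ≤ 1 := Real.rpow_le_one (abs_nonneg u) hu hα0.le
    refine le_trans (mul_nonpos_of_nonneg_of_nonpos hc.le (by linarith)) ?_
    rw [intervalIntegral.integral_of_le hρ.le]
    exact setIntegral_nonneg measurableSet_Ioc hpos
  · have hu0 : 0 < |u| := by linarith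
    have hau : 0 < a / |u| := by positivity
    have haρ : a / |u| ≤ ρ := (div_le_self ha0.le hu).trans (min_le_left _ _)
    have hI := integrableOn_ray hα hρ.le u
    have h1 : ∫ r in (0 : ℝ)..(a / |u|), r ^ (1 - α) * (u ^ 2 / 5) ≤
        ∫ r in (0 : ℝ)..ρ, r ^ (-(1 + α)) * (1 - Real.cos (r * u)) := by
      have h2 : ∫ r in (0 : ℝ)..(a / |u|), r ^ (1 - α) * (u ^ 2 / 5) ≤
          ∫ r in (0 : ℝ)..(a / |u|), r ^ (-(1 + α)) * (1 - Real.cos (r * u)) := by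
        rw [intervalIntegral.integral_of_le hau.le, intervalIntegral.integral_of_le hau.le]
        refine setIntegral_mono_on ?_ ?_ measurableSet_Ioc fun r hr => ?_
        · rw [← intervalIntegrable_iff_integrableOn_Ioc_of_le hau.le]
          exact (intervalIntegral.intervalIntegrable_rpow' (by linarith)).mul_const _
        · rw [← intervalIntegrable_iff_integrableOn_Ioc_of_le hau.le]
          exact integrableOn_ray hα hau.le u
        · have h3 : |r * u| ≤ 1 := by
            rw [abs_mul, abs_of_pos hr.1]
            have := (le_div_iff₀ hu0).1 hr.2
            exact this.trans (min_le_right _ _)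
          have h4 := one_sub_cos_ge h3
          calc r ^ (1 - α) * (u ^ 2 / 5) = r ^ (-(1 + α)) * ((r * u) ^ 2 / 5) := by
                have : r ^ (1 - α) = r ^ (-(1 + α)) * r ^ 2 := by
                  rw [← Real.rpow_natCast r 2, ← Real.rpow_add hr.1]
                  congr 1
                  push_cast
                  ring
                rw [this]
                ring
            _ ≤ _ := mul_le_mul_of_nonneg_left h4 (Real.rpow_nonneg hr.1.le _)
      refine h2.trans ?_
      rw [intervalIntegral.integral_of_le hau.le, intervalIntegral.integral_of_le hρ.le]
      refine setIntegral_mono_set ?_ ?_ (Set.Ioc_subset_Ioc_right haρ).eventuallyLE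
      · rwa [← intervalIntegrable_iff_integrableOn_Ioc_of_le hρ.le]
      · filter_upwards [ae_restrict_mem measurableSet_Ioc] with r hr using hpos r hr
    refine le_trans ?_ h1
    rw [intervalIntegral.integral_mul_const, integral_rpow (Or.inl (by linarith)),
      Real.zero_rpow (by linarith), sub_zero, show 1 - α + 1 = 2 - α by ring,
      Real.div_rpow ha0.le hu0.le]
    have h5 : u ^ 2 = |u| ^ (2 - α) * |u| ^ α := by
      rw [← Real.rpow_add hu0, ← sq_abs, ← Real.rpow_natCast]
      congr 1
      push_cast
      ring
    have h6 : |u| ^ (2 - α) ≠ 0 := (Real.rpow_pos_of_pos hu0 _).ne'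
    have h7 : (2 - α) ≠ 0 := by linarith
    rw [h5]
    have h8 : a ^ (2 - α) / |u| ^ (2 - α) / (2 - α) * (|u| ^ (2 - α) * |u| ^ α / 5) =
        a ^ (2 - α) / (5 * (2 - α)) * |u| ^ α := by
      field_simp
    rw [h8]
    exact mul_le_mul_of_nonneg_left (by linarith) hc.le

theorem re_compKernel (p z : EuclideanSpace ℝ (Fin d)) :
    (compKernel p z).re = 1 - Real.cos (inner ℝ p z) := by
  have h1 : Complex.I * ((inner ℝ p z : ℝ) : ℂ) = ((inner ℝ p z : ℝ) : ℂ) * Complex.I := mul_comm _ _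
  rw [compKernel, h1, Complex.add_re, Complex.sub_re, Complex.exp_ofReal_mul_I_re]
  simp

/-- The real part of the truncated stable exponent grows like `|p|^α`. -/
theorem exists_re_compExponent_polarMeasure_lower_bound [IsFiniteMeasure μ] (hα0 : 0 < α)
    (hα : α < 2) (hρ : 0 < ρ) (hμ : IsNonDegenerate α μ) :
    ∃ c K : ℝ, 0 < c ∧ 0 ≤ K ∧ ∀ p : EuclideanSpace ℝ (Fin d),
      c * ‖p‖ ^ α - K ≤ (compExponent (polarMeasure α ρ μ) p).re := by
  obtain ⟨c, hc, hcu⟩ := exists_ray_lower_bound hα0 hα hρ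
  obtain ⟨η, hη, hηp⟩ := hμ
  -- The ray bound is integrated over θ with u = p·θ: non-degeneracy bounds the main term below by c
  -- η⁻¹|p|^α, and the -1 contributes the total mass of μ.
  refine ⟨c * η⁻¹, c * μ.real Set.univ, by positivity, by positivity, fun p => ?_⟩
  have hint := integrable_compKernel (integrable_sq_polarMeasure (μ := μ) hα hρ.le) p
  have hre : (compExponent (polarMeasure α ρ μ) p).re =
      ∫ z, (1 - Real.cos (inner ℝ p z)) ∂(polarMeasure α ρ μ) := by
    rw [compExponent, ← Complex.reCLM_apply, ← ContinuousLinearMap.integral_comp_comm _ hint]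
    simp_rw [Complex.reCLM_apply, re_compKernel]
  have hint' : Integrable (fun z => 1 - Real.cos (inner ℝ p z)) (polarMeasure α ρ μ) := by
    have h1 : Integrable (fun z => (compKernel p z).re) (polarMeasure α ρ μ) := hint.re
    simpa only [re_compKernel] using h1
  have hfin : Integrable (fun s : Metric.sphere (0 : EuclideanSpace ℝ (Fin d)) 1 =>
      |inner ℝ p (s : EuclideanSpace ℝ (Fin d))| ^ α) μ := by
    refine (integrable_const (‖p‖ ^ α)).mono'
      (Measurable.aestronglyMeasurable (by fun_prop)) (ae_of_all _ fun s => ?_)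
    rw [Real.norm_of_nonneg (by positivity)]
    refine Real.rpow_le_rpow (abs_nonneg _) ?_ hα0.le
    simpa using abs_real_inner_le_norm p (s : EuclideanSpace ℝ (Fin d))
  rw [hre, integral_polarMeasure hρ.le hint']
  calc c * η⁻¹ * ‖p‖ ^ α - c * μ.real Set.univ
      ≤ c * (∫ s, |inner ℝ p (s : EuclideanSpace ℝ (Fin d))| ^ α ∂μ) - c * μ.real Set.univ := by
        rw [mul_assoc]
        have := (hηp p).1
        gcongr
    _ = ∫ s, c * (|inner ℝ p (s : EuclideanSpace ℝ (Fin d))| ^ α - 1) ∂μ := by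
        rw [integral_const_mul, integral_sub hfin (integrable_const _)]
        simp
        ring
    _ ≤ _ := by
        refine integral_mono ((hfin.sub (integrable_const _)).const_mul _)
          (integrable_integral_ray hρ.le hint') fun θ => ?_
        refine (hcu _).trans (le_of_eq ?_)
        simp [real_inner_smul_right]

end Polar

/-! ### Rescaling of a linear drift along a flag -/

section Rescaling

variable {E : Type*} [NormedAddCommGroup E] [InnerProductSpace ℝ E] [FiniteDimensional ℝ E]

theorem flow_semiconj {M X Y : E →L[ℝ] E} (h : M * X = Y * M) (s : ℝ) :
    M * flow X s = flow Y s * M := by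
  let : NormedAlgebra ℚ (E →L[ℝ] E) := NormedAlgebra.restrictScalars ℚ ℝ (E →L[ℝ] E)
  refine SemiconjBy.exp_right ?_
  rw [SemiconjBy, mul_smul_comm, smul_mul_assoc, h]

/-- An increasing chain of subspaces, from `0` to the whole space, on which `A` acts with
degree `1`. -/
structure IsDriftFlag (A : E →L[ℝ] E) (V : ℕ → Submodule ℝ E) (n : ℕ) : Prop where
  mono : Monotone V
  zero : V 0 = ⊥
  top : V n = ⊤
  map : ∀ h, ∀ x ∈ V h, A x ∈ V (h + 1)

/-- The orthogonal projection onto `V_{h+1} ∩ V_h^⊥`. -/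
noncomputable def blockProj (V : ℕ → Submodule ℝ E) (h : ℕ) : E →L[ℝ] E :=
  (V (h + 1)).starProjection - (V h).starProjection

/-- The dilation acting as `τ^h` on `V_{h+1} ∩ V_h^⊥`. -/
noncomputable def dilation (V : ℕ → Submodule ℝ E) (n : ℕ) (τ : ℝ) : E →L[ℝ] E :=
  ∑ h ∈ Finset.range n, τ ^ h • blockProj V h

/-- The rescaled drift `τ M_τ⁻¹ A M_τ`, with `M_τ` the dilation. -/
noncomputable def rescaledDrift (A : E →L[ℝ] E) (V : ℕ → Submodule ℝ E) (n : ℕ) (τ : ℝ) :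
    E →L[ℝ] E :=
  ∑ k ∈ Finset.range n, ∑ j ∈ Finset.range n,
    (if j ≤ k + 1 then τ ^ (k + 1 - j) else 0) • (blockProj V j * A * blockProj V k)

variable {A : E →L[ℝ] E} {V : ℕ → Submodule ℝ E} {n : ℕ}

theorem blockProj_apply_of_mem (hV : Monotone V) {h j : ℕ} (hj : h ≤ j) {x : E} (hx : x ∈ V h) :
    blockProj V j x = 0 := by
  rw [blockProj, sub_apply, Submodule.starProjection_eq_self_iff.2 (hV (by lia) hx),
    Submodule.starProjection_eq_self_iff.2 (hV hj hx), sub_self]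

theorem blockProj_apply_mem (hV : Monotone V) (j : ℕ) (x : E) : blockProj V j x ∈ V (j + 1) :=
  Submodule.sub_mem _ (Submodule.starProjection_apply_mem _ x)
    (hV (Nat.le_succ j) (Submodule.starProjection_apply_mem _ x))

theorem blockProj_apply_of_orthogonal (hV : Monotone V) {h j : ℕ} (hj : j < h) {x : E}
    (hx : x ∈ (V h)ᗮ) : blockProj V j x = 0 := by
  have h1 : ∀ k ≤ h, (V k).starProjection x = 0 := fun k hk =>
    (Submodule.starProjection_apply_eq_zero_iff _).2 (Submodule.orthogonal_le (hV hk) hx)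
  rw [blockProj, sub_apply, h1 _ hj, h1 _ hj.le, sub_self]

theorem blockProj_apply_self {h : ℕ} {x : E} (hx : x ∈ (V h)ᗮ ⊓ V (h + 1)) :
    blockProj V h x = x := by
  rw [blockProj, sub_apply, Submodule.starProjection_eq_self_iff.2 hx.2,
    (Submodule.starProjection_apply_eq_zero_iff _).2 hx.1, sub_zero]

theorem blockProj_apply_mem_block (hV : Monotone V) (j : ℕ) (x : E) :
    blockProj V j x ∈ (V j)ᗮ ⊓ V (j + 1) := by
  refine ⟨?_, blockProj_apply_mem hV j x⟩
  have h1 : (V j).starProjection (blockProj V j x) = 0 := by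
    rw [blockProj, sub_apply, map_sub,
      Submodule.starProjection_eq_self_iff.2 (Submodule.starProjection_apply_mem (V j) x),
      ← ContinuousLinearMap.comp_apply,
      Submodule.starProjection_comp_starProjection_of_le (hV (Nat.le_succ j)), sub_self]
  exact (Submodule.starProjection_apply_eq_zero_iff _).1 h1

theorem blockProj_apply_of_mem_block (hV : Monotone V) {j k : ℕ} {x : E}
    (hx : x ∈ (V k)ᗮ ⊓ V (k + 1)) : blockProj V j x = if j = k then x else 0 := by
  rcases lt_trichotomy j k with h | rfl | h
  · rw [if_neg h.ne, blockProj_apply_of_orthogonal hV h hx.1]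
  · rw [if_pos rfl, blockProj_apply_self hx]
  · rw [if_neg h.ne', blockProj_apply_of_mem hV h hx.2]

theorem sum_blockProj (h0 : V 0 = ⊥) (hn : V n = ⊤) :
    ∑ h ∈ Finset.range n, blockProj V h = 1 := by
  unfold blockProj
  rw [Finset.sum_range_sub (fun h => (V h).starProjection)]
  simp [h0, hn, Submodule.starProjection_top']

theorem dilation_apply_of_mem_block (hV : Monotone V) {k : ℕ} (hk : k < n) (τ : ℝ) {x : E}
    (hx : x ∈ (V k)ᗮ ⊓ V (k + 1)) : dilation V n τ x = τ ^ k • x := by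
  simp only [dilation, sum_apply, smul_apply,
    blockProj_apply_of_mem_block hV hx, smul_ite, smul_zero, Finset.sum_ite_eq',
    Finset.mem_range, if_pos hk]

theorem dilation_apply_of_mem_one (hV : IsDriftFlag A V n) (hn : 0 < n) (τ : ℝ) {x : E}
    (hx : x ∈ V 1) : dilation V n τ x = x := by
  have := dilation_apply_of_mem_block hV.mono hn τ (x := x) (by simpa [hV.zero] using hx)
  simpa using this

theorem dilation_mul_dilation_inv (hV : IsDriftFlag A V n) {τ : ℝ} (hτ : τ ≠ 0) :
    dilation V n τ * dilation V n τ⁻¹ = 1 := by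
  rw [dilation.eq_def V n τ⁻¹, Finset.mul_sum, ← sum_blockProj hV.zero hV.top]
  refine Finset.sum_congr rfl fun k hk => ?_
  ext1 x
  rw [mul_apply_eq_comp, smul_apply, map_smul, dilation_apply_of_mem_block hV.mono
    (Finset.mem_range.1 hk) τ (blockProj_apply_mem_block hV.mono k x), smul_smul, inv_pow,
    inv_mul_cancel₀ (pow_ne_zero k hτ), one_smul]

/-- A raises the degree by at most one, i.e. it is block Hessenberg with respect to the
decomposition into the E_h. -/
theorem blockProj_mul_mul_blockProj (hV : IsDriftFlag A V n) {j k : ℕ} (h : k + 1 < j) :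
    blockProj V j * A * blockProj V k = 0 := by
  ext1 x
  exact blockProj_apply_of_mem hV.mono h (hV.map _ _ (blockProj_apply_mem hV.mono k x))

/-- In the block (j, k) both sides carry τ^{k+1}, as τ^j · τ^{k+1-j} on the left. Without M_τ⁻¹ the
relation makes sense at τ = 0 too. -/
theorem dilation_mul_rescaledDrift (hV : IsDriftFlag A V n) (τ : ℝ) :
    dilation V n τ * rescaledDrift A V n τ = (τ • A) * dilation V n τ := by
  have h1 : (τ • A) * dilation V n τ = ∑ k ∈ Finset.range n, ∑ j ∈ Finset.range n,
      τ ^ (k + 1) • (blockProj V j * A * blockProj V k) := by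
    rw [dilation, Finset.mul_sum]
    refine Finset.sum_congr rfl fun k _ => ?_
    rw [← Finset.smul_sum, ← Finset.sum_mul, ← Finset.sum_mul, sum_blockProj hV.zero hV.top,
      one_mul, smul_mul_smul_comm, pow_succ']
  rw [h1, rescaledDrift, Finset.mul_sum]
  refine Finset.sum_congr rfl fun k _ => ?_
  rw [Finset.mul_sum]
  refine Finset.sum_congr rfl fun j hj => ?_
  ext1 x
  rw [mul_apply_eq_comp, smul_apply, map_smul, mul_assoc, mul_apply_eq_comp,
    dilation_apply_of_mem_block hV.mono (Finset.mem_range.1 hj) τ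
      (blockProj_apply_mem_block hV.mono j _), smul_smul, smul_apply, mul_apply_eq_comp (blockProj V j)]
  split_ifs with h
  · rw [← pow_add, Nat.sub_add_cancel h]
  · have h2 := blockProj_mul_mul_blockProj hV (j := j) (k := k) (by lia)
    have h3 := congrArg (fun T : E →L[ℝ] E => T x) h2
    simp only [mul_assoc, mul_apply_eq_comp (blockProj V j), zero_apply] at h3
    rw [h3, smul_zero, smul_zero]

/-- The only blocks that raise the degree are j = k + 1, and they have coefficient τ⁰ = 1 for every
τ. Hence A_τ and A agree modulo terms that do not raise the degree, which is what preserves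
controllability down to τ = 0. -/
theorem rescaledDrift_sub_mem (hV : IsDriftFlag A V n) (τ : ℝ) {h : ℕ} {x : E} (hx : x ∈ V h) :
    rescaledDrift A V n τ x - A x ∈ V h := by
  have h1 : A = ∑ k ∈ Finset.range n, ∑ j ∈ Finset.range n,
      (blockProj V j * A * blockProj V k) := by
    simp_rw [← Finset.sum_mul, ← Finset.mul_sum, sum_blockProj hV.zero hV.top, one_mul, mul_one]
  have h2 : rescaledDrift A V n τ x - A x = ∑ k ∈ Finset.range n, ∑ j ∈ Finset.range n,
      ((if j ≤ k + 1 then τ ^ (k + 1 - j) else 0) - 1 : ℝ) •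
        blockProj V j (A (blockProj V k x)) := by
    have h3 : A x = ∑ k ∈ Finset.range n, ∑ j ∈ Finset.range n,
        blockProj V j (A (blockProj V k x)) := by
      simpa only [sum_apply, mul_apply_eq_comp] using congrArg (fun T : E →L[ℝ] E => T x) h1
    rw [h3, rescaledDrift]
    simp only [sum_apply, ← Finset.sum_sub_distrib, sub_smul, smul_apply, one_smul,
      mul_apply_eq_comp]
  rw [h2]
  refine Submodule.sum_mem _ fun k _ => Submodule.sum_mem _ fun j _ => ?_
  by_cases hk : h ≤ k
  · rw [blockProj_apply_of_mem hV.mono hk hx]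
    simp
  rcases lt_trichotomy j (k + 1) with hj | rfl | hj
  · exact Submodule.smul_mem _ _ (hV.mono (by lia) (blockProj_apply_mem hV.mono j _))
  · simp
  · rw [blockProj_apply_of_mem hV.mono hj (hV.map _ _ (blockProj_apply_mem hV.mono k x))]
    simp

theorem continuous_rescaledDrift (A : E →L[ℝ] E) (V : ℕ → Submodule ℝ E) (n : ℕ) :
    Continuous (rescaledDrift A V n) := by
  unfold rescaledDrift
  refine continuous_finsetSum _ fun k _ => continuous_finsetSum _ fun j _ => ?_
  split_ifs <;> fun_prop

theorem rescaledDrift_pow_sub_mem (hV : IsDriftFlag A V n) (τ : ℝ) {y : E} (hy : y ∈ V 1) (k : ℕ) :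
    (rescaledDrift A V n τ ^ k) y - (A ^ k) y ∈ V k ∧ (A ^ k) y ∈ V (k + 1) := by
  induction k with
  | zero => simpa using hy
  | succ k ih =>
    rw [pow_succ', pow_succ', mul_apply_eq_comp, mul_apply_eq_comp]
    refine ⟨?_, hV.map _ _ ih.2⟩
    have h1 : rescaledDrift A V n τ ((rescaledDrift A V n τ ^ k) y) - A ((A ^ k) y) =
        (rescaledDrift A V n τ ((rescaledDrift A V n τ ^ k) y - (A ^ k) y) -
          A ((rescaledDrift A V n τ ^ k) y - (A ^ k) y)) +
        A ((rescaledDrift A V n τ ^ k) y - (A ^ k) y) +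
        (rescaledDrift A V n τ ((A ^ k) y) - A ((A ^ k) y)) := by
      rw [map_sub, map_sub]
      abel
    rw [h1]
    exact Submodule.add_mem _ (Submodule.add_mem _
      (hV.mono (Nat.le_succ k) (rescaledDrift_sub_mem hV τ ih.1)) (hV.map _ _ ih.1))
      (rescaledDrift_sub_mem hV τ ih.2)

variable {F : Type*} [NormedAddCommGroup F] [InnerProductSpace ℝ F] [FiniteDimensional ℝ F]
  {B : F →L[ℝ] E}

/-- The pair `(A_τ, B)` satisfies the Kalman condition. -/
theorem eq_zero_of_inner_rescaledDrift_pow (hV : IsDriftFlag A V n)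
    (hVB : ∀ h, V (h + 1) = V h ⊔ LinearMap.range ((A ^ h).comp B : F →ₗ[ℝ] E)) (τ : ℝ) {q : E}
    (hq : ∀ k z, inner ℝ q ((rescaledDrift A V n τ ^ k) (B z)) = 0) : q = 0 := by
  have hB : ∀ z, B z ∈ V 1 := fun z => by
    rw [hVB 0]
    exact Submodule.mem_sup_right ⟨z, by simp⟩
  -- Induction on h: modulo V_h, A^h B z equals A_τ^h B z, to which q is orthogonal by hypothesis.
  have h1 : ∀ h, q ∈ (V h)ᗮ := fun h => by
    induction h with
    | zero => simp [hV.zero]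
    | succ h ih =>
      rw [hVB h, ← Submodule.inf_orthogonal]
      refine ⟨ih, ?_⟩
      rw [SetLike.mem_coe, Submodule.mem_orthogonal']
      rintro _ ⟨z, rfl⟩
      have h2 := (Submodule.mem_orthogonal' _ _).1 ih _ (rescaledDrift_pow_sub_mem hV τ (hB z) h).1
      rw [inner_sub_right, hq, zero_sub, neg_eq_zero] at h2
      exact h2
  have h2 := h1 n
  rwa [hV.top, Submodule.top_orthogonal_eq_bot, Submodule.mem_bot] at h2

/-- If B* (e^{sX})* q vanished for all s in [0, 1], then differentiating ⟨q, e^{sX}Bz⟩ repeatedly on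
the open interval and letting s → 0 would give ⟨q, X^k Bz⟩ = 0 for all k. -/
theorem exists_adjoint_flow_ne_zero {X : E →L[ℝ] E} {q : E}
    (hq : ¬∀ k z, inner ℝ q ((X ^ k) (B z)) = 0) :
    ∃ s ∈ Set.Icc (0 : ℝ) 1, ((flow X s).comp B).adjoint q ≠ 0 := by
  by_contra! hcon
  refine hq fun k z => ?_
  have hzero : ∀ s ∈ Set.Ioo (0 : ℝ) 1, inner ℝ q (flow X s (B z)) = 0 := fun s hs => by
    have h1 := hcon s ⟨hs.1.le, hs.2.le⟩
    rw [← ContinuousLinearMap.comp_apply, ← ContinuousLinearMap.adjoint_inner_left, h1,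
      inner_zero_left]
  have hder : ∀ k : ℕ, ∀ s ∈ Set.Ioo (0 : ℝ) 1, inner ℝ q ((flow X s * X ^ k) (B z)) = 0 := by
    intro k
    induction k with
    | zero => simpa using hzero
    | succ k ih =>
      intro s hs
      have h1 : HasDerivAt (fun s => inner ℝ q ((flow X s * X ^ k) (B z)))
          (inner ℝ q ((flow X s * X * X ^ k) (B z))) s := by
        have h2 := ((hasDerivAt_flow X s).mul_const (X ^ k)).clm_apply (hasDerivAt_const s (B z))
        simp only [map_zero, add_zero] at h2
        simpa using (hasDerivAt_const s q).inner ℝ h2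
      have h3 : HasDerivAt (fun s => inner ℝ q ((flow X s * X ^ k) (B z))) 0 s :=
        (hasDerivAt_const s (0 : ℝ)).congr_of_eventuallyEq
          (by filter_upwards [Ioo_mem_nhds hs.1 hs.2] with r hr using ih r hr)
      rw [pow_succ', ← mul_assoc]
      exact h1.unique h3
  have hcont : Continuous fun s => inner ℝ q ((flow X s * X ^ k) (B z)) := by
    have := continuous_flow X
    exact continuous_const.inner ((this.mul continuous_const).clm_apply continuous_const)
  have hcl := (isClosed_eq hcont continuous_const).closure_subset_iff.2 (hder k)
  rw [closure_Ioo zero_ne_one] at hcl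
  simpa [flow_zero] using hcl (Set.left_mem_Icc.2 zero_le_one)

theorem continuous_flow_rescaledDrift (A : E →L[ℝ] E) (V : ℕ → Submodule ℝ E) (n : ℕ) :
    Continuous fun p : ℝ × ℝ => flow (rescaledDrift A V n p.1) p.2 := by
  let : NormedAlgebra ℚ (E →L[ℝ] E) := NormedAlgebra.restrictScalars ℚ ℝ (E →L[ℝ] E)
  unfold flow
  have := continuous_rescaledDrift A V n
  exact NormedSpace.exp_continuous.comp (by fun_prop)

theorem exists_norm_flow_rescaledDrift_le (A : E →L[ℝ] E) (V : ℕ → Submodule ℝ E) (n : ℕ) :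
    ∃ K : ℝ, 0 < K ∧ ∀ τ ∈ Set.Icc (0 : ℝ) 1, ∀ s ∈ Set.Icc (0 : ℝ) 1,
      ‖flow (rescaledDrift A V n τ) s‖ ≤ K := by
  obtain ⟨K, hK⟩ := ((isCompact_Icc (a := (0 : ℝ)) (b := 1)).prod
    (isCompact_Icc (a := (0 : ℝ)) (b := 1))).exists_bound_of_continuousOn
    (continuous_flow_rescaledDrift A V n).continuousOn
  exact ⟨max K 1, by positivity, fun τ hτ s hs => (hK (τ, s) ⟨hτ, hs⟩).trans (le_max_left _ _)⟩

/-- Uniform controllability of the rescaled pairs `(A_τ, B)`. -/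
theorem exists_lower_bound_rescaled (hV : IsDriftFlag A V n)
    (hVB : ∀ h, V (h + 1) = V h ⊔ LinearMap.range ((A ^ h).comp B : F →ₗ[ℝ] E)) {α : ℝ}
    (hα : 0 < α) :
    ∃ c : ℝ, 0 < c ∧ ∀ τ ∈ Set.Icc (0 : ℝ) 1, ∀ q : E, c * ‖q‖ ^ α ≤
      ∫ s in (0 : ℝ)..1, ‖((flow (rescaledDrift A V n τ) s).comp B).adjoint q‖ ^ α := by
  have hcomp : Continuous fun p : ℝ × ℝ =>
      ((flow (rescaledDrift A V n p.1) p.2).comp B).adjoint :=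
    (ContinuousLinearMap.adjoint (𝕜 := ℝ) (E := F) (F := E)).continuous.comp
      ((continuous_flow_rescaledDrift A V n).clm_comp continuous_const)
  have hcont : Continuous fun p : (ℝ × E) × ℝ =>
      ‖((flow (rescaledDrift A V n p.1.1) p.2).comp B).adjoint p.1.2‖ ^ α := by
    refine Continuous.rpow_const (Continuous.norm ?_) fun _ => Or.inr hα.le
    exact (hcomp.comp (by fun_prop : Continuous fun p : (ℝ × E) × ℝ => (p.1.1, p.2))).clm_apply
      (by fun_prop)
  have hG := intervalIntegral.continuous_parametric_intervalIntegral_of_continuous'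
    (f := fun (p : ℝ × E) (s : ℝ) => ‖((flow (rescaledDrift A V n p.1) s).comp B).adjoint p.2‖ ^ α)
    (μ := volume) hcont 0 1
  -- The integral is continuous and positive on the compact set [0, 1] × unit sphere, hence bounded
  -- below; homogeneity in q extends the bound to all q.
  obtain ⟨c, hc, hcG⟩ := ((isCompact_Icc (a := (0 : ℝ)) (b := 1)).prod
    (isCompact_sphere (0 : E) 1)).exists_forall_le' hG.continuousOn (a := 0) (by
      rintro ⟨τ, q⟩ ⟨-, hq⟩
      have hq1 : ‖q‖ = 1 := by simpa using hq
      obtain ⟨s, hs, hne⟩ := exists_adjoint_flow_ne_zero (B := B) (X := rescaledDrift A V n τ)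
        (q := q) fun h => by
          rw [eq_zero_of_inner_rescaledDrift_pow hV hVB τ h, norm_zero] at hq1
          exact zero_ne_one hq1
      refine intervalIntegral.integral_pos zero_lt_one
        (hcont.comp (by fun_prop : Continuous fun s : ℝ => ((τ, q), s))).continuousOn
        (fun s _ => by positivity) ⟨s, hs, ?_⟩
      exact Real.rpow_pos_of_pos (norm_pos_iff.2 hne) _)
  refine ⟨c, hc, fun τ hτ q => ?_⟩
  rcases eq_or_ne q 0 with rfl | hq
  · simp [Real.zero_rpow hα.ne']
  have hq0 : 0 < ‖q‖ := norm_pos_iff.2 hq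
  have h1 := hcG (τ, ‖q‖⁻¹ • q) ⟨hτ, by simp [norm_smul, hq0.ne']⟩
  have h2 : ∫ s in (0 : ℝ)..1, ‖((flow (rescaledDrift A V n τ) s).comp B).adjoint q‖ ^ α =
      ‖q‖ ^ α * ∫ s in (0 : ℝ)..1,
        ‖((flow (rescaledDrift A V n τ) s).comp B).adjoint (‖q‖⁻¹ • q)‖ ^ α := by
    rw [← intervalIntegral.integral_const_mul]
    congr 1 with s
    rw [← Real.mul_rpow hq0.le (norm_nonneg _), map_smul, norm_smul, norm_inv, norm_norm,
      mul_inv_cancel_left₀ hq0.ne']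
  rw [h2, mul_comm]
  gcongr

end Rescaling

/-! ### The flag of a matrix pair -/

section Flag

variable {N d : ℕ} {A : Matrix (Fin N) (Fin N) ℝ} {B : Matrix (Fin N) (Fin d) ℝ}

theorem matrixCLM_apply_mul {m k l : ℕ} (A : Matrix (Fin m) (Fin k) ℝ)
    (B : Matrix (Fin k) (Fin l) ℝ) (x : EuclideanSpace ℝ (Fin l)) :
    matrixCLM (A * B) x = matrixCLM A (matrixCLM B x) := by
  simp [matrixCLM, Matrix.toLpLin_apply, Matrix.mulVec_mulVec]

theorem flag_zero : flag A B 0 = ⊥ := by simp [flag]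

theorem matrixCLM_pow (k : ℕ) : matrixCLM (A ^ k) = matrixCLM A ^ k := by
  induction k with
  | zero =>
    ext1 x
    simp [matrixCLM]
  | succ k ih =>
    ext1 x
    rw [pow_succ', matrixCLM_apply_mul, ih, pow_succ', mul_apply_eq_comp]

theorem flag_succ (h : ℕ) : flag A B (h + 1) = flag A B h ⊔
    LinearMap.range ((matrixCLM A ^ h).comp (matrixCLM B) :
      EuclideanSpace ℝ (Fin d) →ₗ[ℝ] EuclideanSpace ℝ (Fin N)) := by
  have h1 : ((matrixCLM A ^ h).comp (matrixCLM B) :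
      EuclideanSpace ℝ (Fin d) →ₗ[ℝ] EuclideanSpace ℝ (Fin N)) =
      Matrix.toEuclideanLin (A ^ h * B) := by
    ext1 x
    rw [← matrixCLM_pow]
    exact (matrixCLM_apply_mul _ _ x).symm
  rw [h1]
  refine le_antisymm (iSup_le fun k => ?_) (sup_le (iSup_le fun k => ?_) ?_)
  · rcases (Nat.lt_succ_iff_lt_or_eq.1 k.2) with hk | hk
    · exact le_sup_of_le_left (le_iSup (fun k : Fin h =>
        LinearMap.range (Matrix.toEuclideanLin (A ^ (k : ℕ) * B))) ⟨k, hk⟩)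
    · rw [hk]
      exact le_sup_right
  · exact le_iSup (fun k : Fin (h + 1) =>
      LinearMap.range (Matrix.toEuclideanLin (A ^ (k : ℕ) * B))) k.castSucc
  · exact le_iSup (fun k : Fin (h + 1) =>
      LinearMap.range (Matrix.toEuclideanLin (A ^ (k : ℕ) * B))) (Fin.last h)

theorem monotone_flag : Monotone (flag A B) :=
  monotone_nat_of_le_succ fun h => by
    rw [flag_succ]
    exact le_sup_left

theorem matrixCLM_mem_flag (h : ℕ) {x : EuclideanSpace ℝ (Fin N)} (hx : x ∈ flag A B h) :
    matrixCLM A x ∈ flag A B (h + 1) := by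
  induction h generalizing x with
  | zero =>
    rw [flag_zero, Submodule.mem_bot] at hx
    simp [hx]
  | succ h ih =>
    rw [flag_succ] at hx
    obtain ⟨y, hy, w, ⟨z, rfl⟩, rfl⟩ := Submodule.mem_sup.1 hx
    rw [map_add]
    refine Submodule.add_mem _ (monotone_flag (Nat.le_succ _) (ih hy)) ?_
    rw [flag_succ (h + 1)]
    refine Submodule.mem_sup_right ⟨z, ?_⟩
    simp [pow_succ']

theorem flag_kalmanIndex (hK : KalmanCondition A B) : flag A B (kalmanIndex A B) = ⊤ := by
  have hn : (kalmanMatrix A B (kalmanIndex A B)).rank = N :=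
    Nat.sInf_mem (s := {r : ℕ | (kalmanMatrix A B r).rank = N}) ⟨N, hK⟩
  set n := kalmanIndex A B
  have hrange : LinearMap.range (kalmanMatrix A B n).mulVecLin = ⊤ := by
    apply Submodule.eq_top_of_finrank_eq
    rw [← Matrix.rank, hn]
    simp
  rw [eq_top_iff]
  intro x _
  obtain ⟨v, hv⟩ : x.ofLp ∈ LinearMap.range (kalmanMatrix A B n).mulVecLin := by
    rw [hrange]
    trivial
  have hx : x = ∑ k : Fin n, Matrix.toEuclideanLin (A ^ (k : ℕ) * B)
      (WithLp.toLp 2 fun j => v (k, j)) := by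
    ext i
    rw [← hv]
    simp only [WithLp.ofLp_sum, Finset.sum_apply, Matrix.toLpLin_apply, Matrix.mulVecLin_apply,
      Matrix.mulVec, dotProduct, kalmanMatrix, Fintype.sum_prod_type, Matrix.of_apply]
  rw [hx]
  refine Submodule.sum_mem _ fun k _ => ?_
  exact le_iSup (fun k : Fin n => LinearMap.range (Matrix.toEuclideanLin (A ^ (k : ℕ) * B))) k
    ⟨_, rfl⟩

theorem isDriftFlag_flag (hK : KalmanCondition A B) :
    IsDriftFlag (matrixCLM A) (flag A B) (kalmanIndex A B) :=
  ⟨monotone_flag, flag_zero, flag_kalmanIndex hK, fun _ _ hx => matrixCLM_mem_flag _ hx⟩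

end Flag

/-! ### Smoothness of the exponent of a measure with bounded support -/

section Smoothness

variable {E : Type*} [NormedAddCommGroup E] [InnerProductSpace ℝ E] [FiniteDimensional ℝ E]
  [MeasurableSpace E] [BorelSpace E]

/-- `σ` has second moment at most `K` and is carried by the ball of radius `R`. -/
structure HasBoundedJumps (σ : Measure E) (K R : ℝ) : Prop where
  integrable : Integrable (fun w => ‖w‖ ^ 2) σ
  integral_le : ∫ w, ‖w‖ ^ 2 ∂σ ≤ K
  ae_norm_le : ∀ᵐ w ∂σ, ‖w‖ ≤ R
  radius_nonneg : 0 ≤ R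

/-- The scalar product, as a complex-valued functional. -/
noncomputable def innerComplex : E →L[ℝ] E →L[ℝ] ℂ :=
  (ContinuousLinearMap.compL ℝ E ℝ ℂ Complex.ofRealCLM).comp (innerSL ℝ)

theorem innerComplex_apply (w p : E) : innerComplex w p = (inner ℝ p w : ℝ) := by
  simp [innerComplex, real_inner_comm]

theorem norm_innerComplex_le (w : E) : ‖innerComplex w‖ ≤ ‖w‖ := by
  refine ContinuousLinearMap.opNorm_le_bound _ (norm_nonneg w) fun p => ?_
  rw [innerComplex_apply, Complex.norm_real, mul_comm]
  exact norm_inner_le_norm p w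

/-- The square of the scalar product, as a bilinear form. -/
noncomputable def innerComplexSq (w : E) : E →L[ℝ] E →L[ℝ] ℂ :=
  (innerComplex w).smulRight (innerComplex w)

theorem continuous_innerComplexSq : Continuous (innerComplexSq (E := E)) := by
  unfold innerComplexSq
  have h1 : Continuous (innerComplex (E := E)) := innerComplex.continuous
  have h2 : ∀ w : E, (innerComplex w).smulRight (innerComplex w) =
      (ContinuousLinearMap.lsmul ℝ ℂ).flip (innerComplex w) ∘L (innerComplex w) := fun w => rfl
  simp_rw [h2]
  exact ((ContinuousLinearMap.continuous _).comp h1).clm_comp h1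

theorem norm_innerComplexSq_le (w : E) : ‖innerComplexSq w‖ ≤ ‖w‖ ^ 2 := by
  refine ContinuousLinearMap.opNorm_le_bound₂ _ (by positivity) fun v v' => ?_
  have h1 := (innerComplex w).le_of_opNorm_le (norm_innerComplex_le w)
  calc ‖innerComplexSq w v v'‖ = ‖innerComplex w v‖ * ‖innerComplex w v'‖ := by
        simp [innerComplexSq]
    _ ≤ (‖w‖ * ‖v‖) * (‖w‖ * ‖v'‖) := by
        gcongr
        exacts [h1 v, h1 v']
    _ = _ := by ring

theorem hasFDerivAt_exp_inner (w p : E) :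
    HasFDerivAt (fun p => Complex.exp (Complex.I * (inner ℝ p w : ℝ)))
      ((Complex.I * Complex.exp (Complex.I * (inner ℝ p w : ℝ))) • innerComplex w) p := by
  have h1 : HasFDerivAt (fun p : E => Complex.I * (inner ℝ p w : ℝ))
      (Complex.I • innerComplex w) p := by
    have := (innerComplex w).hasFDerivAt (x := p).const_mul Complex.I
    simpa only [innerComplex_apply] using this
  have h2 := h1.cexp
  rwa [smul_smul, mul_comm] at h2

theorem hasFDerivAt_compKernel (w p : E) : HasFDerivAt (fun p => compKernel p w)
    ((Complex.I * (1 - Complex.exp (Complex.I * (inner ℝ p w : ℝ)))) • innerComplex w) p := by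
  have h1 : HasFDerivAt (fun p : E => Complex.I * (inner ℝ p w : ℝ))
      (Complex.I • innerComplex w) p := by
    have := (innerComplex w).hasFDerivAt (x := p).const_mul Complex.I
    simpa only [innerComplex_apply] using this
  refine (((hasFDerivAt_exp_inner w p).const_sub 1).add h1).congr_fderiv ?_
  ext v
  simp only [add_apply, neg_apply, smul_apply, smul_eq_mul]
  ring

theorem hasFDerivAt_fderiv_compKernel (w p : E) :
    HasFDerivAt (fun p => (Complex.I * (1 - Complex.exp (Complex.I * (inner ℝ p w : ℝ)))) •
        innerComplex w)
      (Complex.exp (Complex.I * (inner ℝ p w : ℝ)) • innerComplexSq w) p := by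
  refine ((((hasFDerivAt_exp_inner w p).const_sub 1).const_mul Complex.I).smul_const
    (innerComplex w)).congr_fderiv ?_
  ext v v'
  simp only [innerComplexSq, smul_apply, ContinuousLinearMap.smulRight_apply, neg_apply, smul_eq_mul]
  linear_combination (-Complex.exp (Complex.I * (inner ℝ p w : ℝ)) * innerComplex w v *
    innerComplex w v') * Complex.I_sq

variable {σ : Measure E} {K R : ℝ}

theorem norm_fderiv_compKernel_le (p w : E) :
    ‖(Complex.I * (1 - Complex.exp (Complex.I * (inner ℝ p w : ℝ)))) • innerComplex w‖ ≤
      ‖p‖ * ‖w‖ ^ 2 := by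
  rw [norm_smul, norm_mul, Complex.norm_I, one_mul]
  calc _ ≤ (‖p‖ * ‖w‖) * ‖w‖ := by
        gcongr
        · exact (norm_one_sub_exp_le _).trans (abs_real_inner_le_norm p w)
        · exact norm_innerComplex_le w
    _ = _ := by ring

theorem integrable_fderiv_compKernel (h : Integrable (fun w => ‖w‖ ^ 2) σ) (p : E) :
    Integrable (fun w => (Complex.I * (1 - Complex.exp (Complex.I * (inner ℝ p w : ℝ)))) •
      innerComplex w) σ := by
  refine (h.const_mul ‖p‖).mono' ?_ (ae_of_all _ fun w => norm_fderiv_compKernel_le p w)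
  exact Continuous.aestronglyMeasurable (by fun_prop)

theorem norm_le_norm_add_one {p q : E} (h : p ∈ Metric.ball q 1) : ‖p‖ ≤ ‖q‖ + 1 := by
  have := norm_le_norm_add_norm_sub' p q
  rw [← dist_eq_norm] at this
  linarith [Metric.mem_ball.1 h]

theorem hasFDerivAt_compExponent (h : Integrable (fun w => ‖w‖ ^ 2) σ) (p : E) :
    HasFDerivAt (compExponent σ) (∫ w, (Complex.I * (1 - Complex.exp (Complex.I *
      (inner ℝ p w : ℝ)))) • innerComplex w ∂σ) p := by
  refine hasFDerivAt_integral_of_dominated_of_fderiv_le (𝕜 := ℝ) (Metric.ball_mem_nhds p one_pos)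
    (bound := fun w => (‖p‖ + 1) * ‖w‖ ^ 2)
    (Eventually.of_forall fun q => (integrable_compKernel h q).1) (integrable_compKernel h p)
    (integrable_fderiv_compKernel h p).1 (ae_of_all _ fun w q hq => ?_) (h.const_mul _)
    (ae_of_all _ fun w q _ => hasFDerivAt_compKernel w q)
  refine (norm_fderiv_compKernel_le q w).trans ?_
  gcongr
  exact norm_le_norm_add_one hq

theorem fderiv_compExponent (h : Integrable (fun w => ‖w‖ ^ 2) σ) :
    fderiv ℝ (compExponent σ) = fun p => ∫ w, (Complex.I * (1 - Complex.exp (Complex.I *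
      (inner ℝ p w : ℝ)))) • innerComplex w ∂σ :=
  funext fun p => (hasFDerivAt_compExponent h p).fderiv

theorem norm_fderiv_compExponent_le (h : HasBoundedJumps σ K R) (p : E) :
    ‖fderiv ℝ (compExponent σ) p‖ ≤ K * ‖p‖ := by
  rw [fderiv_compExponent h.integrable]
  refine (norm_integral_le_of_norm_le (h.integrable.const_mul ‖p‖)
    (ae_of_all _ fun w => norm_fderiv_compKernel_le p w)).trans ?_
  rw [integral_const_mul, mul_comm]
  gcongr
  exact h.integral_le

theorem hasFDerivAt_fderiv_compExponent (h : Integrable (fun w => ‖w‖ ^ 2) σ) (p : E) :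
    HasFDerivAt (fderiv ℝ (compExponent σ))
      (∫ w, Complex.exp (Complex.I * (inner ℝ p w : ℝ)) • innerComplexSq w ∂σ) p := by
  rw [fderiv_compExponent h]
  refine hasFDerivAt_integral_of_dominated_of_fderiv_le (𝕜 := ℝ) (Metric.ball_mem_nhds p one_pos)
    (bound := fun w => ‖w‖ ^ 2)
    (Eventually.of_forall fun q => (integrable_fderiv_compKernel h q).1)
    (integrable_fderiv_compKernel h p) ?_ (ae_of_all _ fun w q hq => ?_) h
    (ae_of_all _ fun w q _ => hasFDerivAt_fderiv_compKernel w q)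
  · have := continuous_innerComplexSq (E := E)
    exact Continuous.aestronglyMeasurable (by fun_prop)
  · rw [norm_smul, mul_comm Complex.I, Complex.norm_exp_ofReal_mul_I, one_mul]
    exact norm_innerComplexSq_le w

/-- The pairing for which the Fourier integral has kernel `e^{i p·w}`. -/
noncomputable def fourierPairing : E →L[ℝ] E →L[ℝ] ℝ := (-(2 * Real.pi)⁻¹) • innerSL ℝ

theorem fourierPairing_apply (v w : E) :
    fourierPairing v w = -(2 * Real.pi)⁻¹ * inner ℝ v w := rfl

theorem norm_fourierPairing_le : 2 * Real.pi * ‖fourierPairing (E := E)‖ ≤ 1 := by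
  have h2 := Real.pi_pos
  have h1 : ‖fourierPairing (E := E)‖ ≤ (2 * Real.pi)⁻¹ := by
    refine ContinuousLinearMap.opNorm_le_bound₂ _ (by positivity) fun v v' => ?_
    rw [fourierPairing_apply, norm_mul, norm_neg, norm_inv,
      Real.norm_of_nonneg (by positivity : 0 ≤ 2 * Real.pi), mul_assoc]
    gcongr
    exact norm_inner_le_norm v v'
  calc _ ≤ 2 * Real.pi * (2 * Real.pi)⁻¹ := by gcongr
    _ = 1 := mul_inv_cancel₀ (by positivity)

/-- Two derivatives remove the compensation and leave the Fourier transform of a kernel of size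
|w|², integrable even if σ has infinite mass. All further derivatives come from the theory of
Fourier integrals. -/
theorem fderiv_fderiv_compExponent (h : Integrable (fun w => ‖w‖ ^ 2) σ) :
    fderiv ℝ (fderiv ℝ (compExponent σ)) = VectorFourier.fourierIntegral Real.fourierChar σ
      fourierPairing.toLinearMap₁₂ innerComplexSq := by
  ext1 p
  rw [(hasFDerivAt_fderiv_compExponent h p).fderiv, VectorFourier.fourierIntegral]
  congr 1 with w : 1
  rw [Circle.smul_def, Real.fourierChar_apply]
  congr 2
  have h1 : fourierPairing.toLinearMap₁₂ w p = -(2 * Real.pi)⁻¹ * inner ℝ p w := by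
    rw [real_inner_comm]
    rfl
  rw [h1, mul_comm Complex.I]
  congr 2
  have := Real.pi_pos
  field_simp

theorem HasBoundedJumps.integrable_pow_mul (h : HasBoundedJumps σ K R) (n : ℕ) :
    Integrable (fun w => ‖w‖ ^ n * ‖innerComplexSq w‖) σ := by
  refine (h.integrable.const_mul (R ^ n)).mono' ?_ ?_
  · have h1 : Continuous fun w : E => ‖innerComplexSq w‖ :=
      (continuous_norm (E := E →L[ℝ] E →L[ℝ] ℂ)).comp continuous_innerComplexSq
    exact ((continuous_norm.pow n).mul h1).aestronglyMeasurable
  · filter_upwards [h.ae_norm_le] with w hw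
    rw [Real.norm_of_nonneg (by positivity)]
    have := h.radius_nonneg
    gcongr
    exact norm_innerComplexSq_le w

theorem HasBoundedJumps.contDiff_compExponent (h : HasBoundedJumps σ K R) :
    ContDiff ℝ ((⊤ : ℕ∞) : WithTop ℕ∞) (compExponent σ) := by
  refine contDiff_infty_iff_fderiv.2
    ⟨fun p => (hasFDerivAt_compExponent h.integrable p).differentiableAt,
      contDiff_infty_iff_fderiv.2
        ⟨fun p => (hasFDerivAt_fderiv_compExponent h.integrable p).differentiableAt, ?_⟩⟩
  rw [fderiv_fderiv_compExponent h.integrable]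
  exact VectorFourier.contDiff_fourierIntegral _ fun n _ => h.integrable_pow_mul n

/-- Only the gradient grows, by at most K|p|; every higher derivative is bounded through |w| ≤ R and
the second moment. The right side merges both cases and depends on σ only through K and R. -/
theorem HasBoundedJumps.norm_iteratedFDeriv_fderiv_le (h : HasBoundedJumps σ K R) (n : ℕ) (p : E) :
    ‖iteratedFDeriv ℝ n (fderiv ℝ (compExponent σ)) p‖ ≤ K * (1 + R) ^ n * (1 + ‖p‖) := by
  have hK : 0 ≤ K := (integral_nonneg fun w => by positivity).trans h.integral_le
  have hR := h.radius_nonneg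
  cases n with
  | zero =>
    rw [norm_iteratedFDeriv_zero, pow_zero, mul_one]
    refine (norm_fderiv_compExponent_le h p).trans ?_
    gcongr
    linarith
  | succ n =>
    have h0 : AEStronglyMeasurable (innerComplexSq (E := E)) σ :=
      continuous_innerComplexSq.aestronglyMeasurable
    rw [← norm_iteratedFDeriv_fderiv, fderiv_fderiv_compExponent h.integrable,
      VectorFourier.iteratedFDeriv_fourierIntegral (N := ⊤) fourierPairing
        (fun n _ => h.integrable_pow_mul n) h0 le_top]
    refine (VectorFourier.norm_fourierIntegral_le_integral_norm _ _ _ _ _).trans ?_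
    have h1 : ∀ᵐ w ∂σ, ‖VectorFourier.fourierPowSMulRight fourierPairing innerComplexSq w n‖ ≤
        R ^ n * ‖w‖ ^ 2 := by
      filter_upwards [h.ae_norm_le] with w hw
      refine (VectorFourier.norm_fourierPowSMulRight_le _ _ _ _).trans ?_
      calc _ ≤ 1 ^ n * R ^ n * ‖w‖ ^ 2 := by
            gcongr
            · exact norm_fourierPairing_le
            · exact norm_innerComplexSq_le w
        _ = _ := by ring
    calc ∫ w, ‖VectorFourier.fourierPowSMulRight fourierPairing innerComplexSq w n‖ ∂σ
        ≤ ∫ w, R ^ n * ‖w‖ ^ 2 ∂σ := integral_mono_of_nonneg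
          (ae_of_all _ fun _ => norm_nonneg _) (h.integrable.const_mul _) h1
      _ ≤ R ^ n * K := by
          rw [integral_const_mul]
          gcongr
          exact h.integral_le
      _ ≤ (1 + R) ^ (n + 1) * K := by
          gcongr ?_ * K
          calc R ^ n ≤ (1 + R) ^ n := by gcongr; linarith
            _ ≤ (1 + R) ^ (n + 1) := pow_le_pow_right₀ (by linarith) n.le_succ
      _ ≤ K * (1 + R) ^ (n + 1) * (1 + ‖p‖) := by
          rw [mul_comm K]
          exact le_mul_of_one_le_right (by positivity) (by linarith [norm_nonneg p])

end Smoothness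

/-! ### Schwartz densities -/

section Schwartz

open scoped SchwartzMap FourierTransform ContDiff

/-- The gradient of e^{-Ψ} is -e^{-Ψ}∇Ψ, so Leibniz' rule and strong induction apply, each
derivative costing a factor 1 + |p|. The constant is chosen before Ψ and depends only on n and M. -/
theorem exists_norm_iteratedFDeriv_exp_neg_le {E : Type*} [NormedAddCommGroup E]
    [NormedSpace ℝ E] {M : ℕ → ℝ} (hM : ∀ n, 0 ≤ M n) (n : ℕ) :
    ∃ C : ℝ, 0 ≤ C ∧ ∀ Ψ : E → ℂ, ContDiff ℝ ∞ Ψ →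
      (∀ j p, ‖iteratedFDeriv ℝ j (fderiv ℝ Ψ) p‖ ≤ M j * (1 + ‖p‖)) →
      ∀ p, ‖iteratedFDeriv ℝ n (fun p => Complex.exp (-Ψ p)) p‖ ≤
        C * (1 + ‖p‖) ^ n * Real.exp (-(Ψ p).re) := by
  induction n using Nat.strong_induction_on with
  | _ n ih =>
  cases n with
  | zero =>
    refine ⟨1, zero_le_one, fun Ψ _ _ p => ?_⟩
    rw [norm_iteratedFDeriv_zero, Complex.norm_exp, Complex.neg_re]
    simp
  | succ n =>
    choose! C hC0 hC using ih
    refine ⟨∑ i ∈ Finset.range (n + 1), (n.choose i : ℝ) * C i * M (n - i),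
      Finset.sum_nonneg fun i hi => ?_, fun Ψ hΨ hb p => ?_⟩
    · have := hC0 i (Finset.mem_range.1 hi)
      have := hM (n - i)
      positivity
    have hg : ContDiff ℝ ∞ fun p => Complex.exp (-Ψ p) := hΨ.neg.cexp
    have hd : fderiv ℝ (fun p => Complex.exp (-Ψ p)) =
        -fun p => Complex.exp (-Ψ p) • fderiv ℝ Ψ p := by
      ext1 p
      have h1 := (hΨ.differentiable (by simp) p).hasFDerivAt
      have h2 : HasFDerivAt (fun p => Complex.exp (-Ψ p)) _ p := h1.neg.cexp
      rw [h2.fderiv]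
      simp
    have hΨ' : ContDiff ℝ ∞ (fderiv ℝ Ψ) := (contDiff_infty_iff_fderiv.1 hΨ).2
    rw [← norm_iteratedFDeriv_fderiv, hd, iteratedFDeriv_neg_apply, norm_neg]
    refine (norm_iteratedFDeriv_smul_le hg hΨ' p (n := n) (mod_cast le_top)).trans ?_
    rw [Finset.sum_mul, Finset.sum_mul]
    refine Finset.sum_le_sum fun i hi => ?_
    have hi' : i < n + 1 := Finset.mem_range.1 hi
    have h0 := hC0 i hi'
    have h1 := hM (n - i)
    have h2 : (1 : ℝ) ≤ 1 + ‖p‖ := by linarith [norm_nonneg p]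
    calc _ ≤ (n.choose i : ℝ) * (C i * (1 + ‖p‖) ^ i * Real.exp (-(Ψ p).re)) *
          (M (n - i) * (1 + ‖p‖)) := by
          gcongr
          · exact hC i hi' Ψ hΨ hb p
          · exact hb _ _
      _ = (n.choose i : ℝ) * C i * M (n - i) * (1 + ‖p‖) ^ (i + 1) * Real.exp (-(Ψ p).re) := by
          ring
      _ ≤ _ := by
          gcongr
          lia

theorem exists_pow_mul_exp_neg_rpow_le {c α : ℝ} (hc : 0 < c) (hα : 0 < α) (k : ℕ) :
    ∃ C : ℝ, 0 ≤ C ∧ ∀ r : ℝ, 0 ≤ r → (1 + r) ^ k * Real.exp (-(c * r ^ α)) ≤ C := by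
  -- For r ≥ 1 and m ≥ k/α, r^k ≤ (r^α)^m, and e^x ≥ x^m/m! at x = c r^α gives the constant m!/c^m.
  -- The factor 2^k comes from 1 + r ≤ 2 max(1, r).
  obtain ⟨m, hm⟩ := exists_nat_ge (k / α)
  rw [div_le_iff₀ hα] at hm
  refine ⟨2 ^ k * (1 + m.factorial / c ^ m), by positivity, fun r hr => ?_⟩
  have h0 : 0 ≤ r ^ α := Real.rpow_nonneg hr _
  have h2 : 0 ≤ (m.factorial : ℝ) / c ^ m := by positivity
  rcases le_total r 1 with h1 | h1
  · calc (1 + r) ^ k * Real.exp (-(c * r ^ α)) ≤ 2 ^ k * 1 := by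
          gcongr
          · linarith
          · exact Real.exp_le_one_iff.2 (by have := mul_nonneg hc.le h0; linarith)
      _ ≤ _ := by gcongr; linarith
  · have h3 : r ^ k ≤ (r ^ α) ^ m := by
      rw [← Real.rpow_natCast, ← Real.rpow_mul_natCast hr]
      exact Real.rpow_le_rpow_of_exponent_le h1 (by linarith)
    have h4 := Real.pow_div_factorial_le_exp (c * r ^ α) (by positivity) m
    rw [div_le_iff₀ (by positivity), mul_pow] at h4
    have h5 : r ^ k * Real.exp (-(c * r ^ α)) ≤ m.factorial / c ^ m := by
      rw [Real.exp_neg, ← div_eq_mul_inv, div_le_div_iff₀ (Real.exp_pos _) (by positivity)]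
      calc r ^ k * c ^ m ≤ (r ^ α) ^ m * c ^ m := by gcongr
        _ ≤ _ := by linarith
    calc (1 + r) ^ k * Real.exp (-(c * r ^ α)) ≤ (2 * r) ^ k * Real.exp (-(c * r ^ α)) := by
          gcongr
          linarith
      _ = 2 ^ k * (r ^ k * Real.exp (-(c * r ^ α))) := by ring
      _ ≤ _ := by gcongr; linarith

variable {E : Type*} [NormedAddCommGroup E] [InnerProductSpace ℝ E] [FiniteDimensional ℝ E]
  [MeasurableSpace E] [BorelSpace E]

theorem exists_pow_mul_norm_iteratedFDeriv_exp_neg_compExponent_le {K R c C₀ α : ℝ} (hK : 0 ≤ K)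
    (hR : 0 ≤ R) (hc : 0 < c) (hα : 0 < α) (k n : ℕ) :
    ∃ C : ℝ, 0 ≤ C ∧ ∀ σ : Measure E, HasBoundedJumps σ K R →
      (∀ p, c * ‖p‖ ^ α - C₀ ≤ (compExponent σ p).re) →
      ∀ p, ‖p‖ ^ k * ‖iteratedFDeriv ℝ n (fun p => Complex.exp (-compExponent σ p)) p‖ ≤ C := by
  obtain ⟨C₁, hC₁, h1⟩ := exists_norm_iteratedFDeriv_exp_neg_le (E := E)
    (M := fun j => K * (1 + R) ^ j) (fun j => by positivity) n
  obtain ⟨C₂, hC₂, h2⟩ := exists_pow_mul_exp_neg_rpow_le hc hα (k + n)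
  refine ⟨C₁ * Real.exp C₀ * C₂, by positivity, fun σ hσ hlow p => ?_⟩
  calc _ ≤ (1 + ‖p‖) ^ k * (C₁ * (1 + ‖p‖) ^ n * (Real.exp C₀ * Real.exp (-(c * ‖p‖ ^ α)))) := by
        gcongr
        · linarith
        · refine (h1 _ hσ.contDiff_compExponent hσ.norm_iteratedFDeriv_fderiv_le p).trans ?_
          rw [← Real.exp_add]
          gcongr
          linarith [hlow p]
    _ = C₁ * Real.exp C₀ * ((1 + ‖p‖) ^ (k + n) * Real.exp (-(c * ‖p‖ ^ α))) := by ring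
    _ ≤ _ := by
        gcongr
        exact h2 _ (norm_nonneg p)

/-- Continuity of T bounds each seminorm of T f by finitely many seminorms of f, and two seminorms
control the L¹ norm. So the bound is uniform over bounded sets of Schwartz functions. -/
theorem exists_integral_norm_iteratedFDeriv_le {F G : Type*} [NormedAddCommGroup F]
    [NormedSpace ℝ F] [NormedAddCommGroup G] [NormedSpace ℝ G] (T : 𝓢(E, F) →L[ℝ] 𝓢(E, G))
    {B : ℕ × ℕ → ℝ} (hB : ∀ m, 0 ≤ B m) (k : ℕ) :
    ∃ C : ℝ, ∀ f : 𝓢(E, F), (∀ m : ℕ × ℕ, SchwartzMap.seminorm ℝ m.1 m.2 f ≤ B m) →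
      ∫ x, ‖iteratedFDeriv ℝ k (T f) x‖ ≤ C := by
  have h1 : ∀ m : ℕ × ℕ, ∃ C : ℝ, ∀ f : 𝓢(E, F),
      (∀ m : ℕ × ℕ, SchwartzMap.seminorm ℝ m.1 m.2 f ≤ B m) →
      SchwartzMap.seminorm ℝ m.1 m.2 (T f) ≤ C := fun m => by
    have h2 : Continuous ((SchwartzMap.seminorm ℝ m.1 m.2).comp (T : 𝓢(E, F) →ₗ[ℝ] 𝓢(E, G))) :=
      ((schwartz_withSeminorms ℝ E G).continuous_seminorm m).comp T.continuous
    obtain ⟨s, C, -, hC⟩ := Seminorm.bound_of_continuous (schwartz_withSeminorms ℝ E F) _ h2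
    refine ⟨C * ∑ m ∈ s, B m, fun f hf => (hC f).trans ?_⟩
    change (C : ℝ) * _ ≤ _
    gcongr
    refine Seminorm.finset_sup_apply_le (Finset.sum_nonneg fun m _ => hB m) fun m hm => ?_
    exact (hf m).trans (Finset.single_le_sum (fun m _ => hB m) hm)
  choose C hC using h1
  refine ⟨2 ^ (volume : Measure E).integrablePower *
      (∫ x : E, (1 + ‖x‖) ^ (-((volume : Measure E).integrablePower : ℝ))) *
        (C (0, k) + C (0 + (volume : Measure E).integrablePower, k)), fun f hf => ?_⟩
  have h2 := SchwartzMap.integral_pow_mul_iteratedFDeriv_le ℝ (volume : Measure E) (T f) 0 k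
  simp only [pow_zero, one_mul] at h2
  refine h2.trans ?_
  have h3 : 0 ≤ ∫ x : E, (1 + ‖x‖) ^ (-((volume : Measure E).integrablePower : ℝ)) :=
    integral_nonneg fun x => by positivity
  gcongr
  · exact hC (0, k) f hf
  · exact hC (0 + (volume : Measure E).integrablePower, k) f hf

/-- The dilation by `-2π`. -/
noncomputable def fourierScaling : E ≃L[ℝ] E :=
  ContinuousLinearEquiv.smulLeft (Units.mk0 (-(2 * Real.pi)) (by simp [Real.pi_ne_zero]))

theorem fourierScaling_apply (x : E) : fourierScaling x = (-(2 * Real.pi)) • x := rfl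

/-- Fourier inversion, for the Fourier transform with kernel `e^{i p·x}`. -/
noncomputable def fourierInvCLM : 𝓢(E, ℂ) →L[ℝ] 𝓢(E, ℂ) :=
  ((FourierTransform.fourierInvCLM ℂ 𝓢(E, ℂ)).restrictScalars ℝ).comp
    (SchwartzMap.compCLMOfContinuousLinearEquiv ℝ fourierScaling)

theorem integral_fourierInvCLM (g : 𝓢(E, ℂ)) (p : E) :
    ∫ x, Complex.exp ((inner ℝ x p : ℝ) * Complex.I) * fourierInvCLM g x = g p := by
  have h1 : 𝓕 (fourierInvCLM g) = SchwartzMap.compCLMOfContinuousLinearEquiv ℝ fourierScaling g := by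
    simp [fourierInvCLM]
  have h2 := congrArg (fun f : 𝓢(E, ℂ) => f ((-(2 * Real.pi))⁻¹ • p)) h1
  have h3 : (-(2 * Real.pi)) ≠ 0 := by simp [Real.pi_ne_zero]
  simp only [SchwartzMap.compCLMOfContinuousLinearEquiv_apply, Function.comp_apply,
    fourierScaling_apply, smul_inv_smul₀ h3] at h2
  rw [SchwartzMap.fourier_coe, Real.fourier_eq'] at h2
  rw [← h2]
  congr 1 with x
  rw [inner_smul_right, ← mul_assoc, show -2 * Real.pi * (-(2 * Real.pi))⁻¹ = 1 by
    rw [neg_mul]; exact mul_inv_cancel₀ h3, one_mul, smul_eq_mul]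

theorem compExponent_neg (σ : Measure E) (p : E) :
    compExponent σ (-p) = (starRingEnd ℂ) (compExponent σ p) := by
  rw [compExponent, compExponent, ← integral_conj]
  congr 1 with w
  simp [compKernel, ← Complex.exp_conj]

/-- Conjugating a function replaces its transform g(p) by the conjugate of g(-p), which is g(p)
again under Hermitian symmetry; averaging the two gives the real part. -/
theorem integral_re_fourierInvCLM {g : 𝓢(E, ℂ)} (hg : ∀ p, g (-p) = (starRingEnd ℂ) (g p)) (p : E) :
    ∫ x, Complex.exp ((inner ℝ x p : ℝ) * Complex.I) * ((fourierInvCLM g x).re : ℂ) = g p := by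
  have hint : ∀ f : 𝓢(E, ℂ), ∀ p : E,
      Integrable fun x => Complex.exp ((inner ℝ x p : ℝ) * Complex.I) * f x := fun f p => by
    refine f.integrable.norm.mono' (Continuous.aestronglyMeasurable (by fun_prop))
      (ae_of_all _ fun x => ?_)
    rw [norm_mul, Complex.norm_exp_ofReal_mul_I, one_mul]
  have h1 : ∀ x, Complex.exp ((inner ℝ x p : ℝ) * Complex.I) * ((fourierInvCLM g x).re : ℂ) =
      2⁻¹ * (Complex.exp ((inner ℝ x p : ℝ) * Complex.I) * fourierInvCLM g x) +
      2⁻¹ * (starRingEnd ℂ) (Complex.exp ((inner ℝ x (-p) : ℝ) * Complex.I) *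
        fourierInvCLM g x) := fun x => by
    rw [Complex.re_eq_add_conj, map_mul, ← Complex.exp_conj, map_mul, Complex.conj_ofReal,
      Complex.conj_I, inner_neg_right, Complex.ofReal_neg, neg_mul_neg]
    ring
  have h2 : Integrable fun x => (starRingEnd ℂ) (Complex.exp ((inner ℝ x (-p) : ℝ) * Complex.I) *
      fourierInvCLM g x) := Complex.conjCLE.toContinuousLinearMap.integrable_comp (hint _ (-p))
  simp_rw [h1]
  rw [integral_add ((hint _ p).const_mul _) (h2.const_mul _), integral_const_mul,
    integral_const_mul, integral_conj, integral_fourierInvCLM, integral_fourierInvCLM, hg,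
    Complex.conj_conj]
  ring

/-- Exponents with a power lower bound are those of smooth densities, with derivatives controlled in
`L¹` uniformly over the measures with given bounds. -/
theorem exists_schwartz_density {K R c C₀ α : ℝ} (hK : 0 ≤ K) (hR : 0 ≤ R) (hc : 0 < c)
    (hα : 0 < α) :
    ∃ C : ℕ → ℝ, ∀ σ : Measure E, HasBoundedJumps σ K R →
      (∀ p, c * ‖p‖ ^ α - C₀ ≤ (compExponent σ p).re) →
      ∃ ρ : 𝓢(E, ℝ),
        (∀ p, ∫ x, Complex.exp ((inner ℝ x p : ℝ) * Complex.I) * (ρ x : ℂ) =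
          Complex.exp (-compExponent σ p)) ∧
        ∀ k, ∫ x, ‖iteratedFDeriv ℝ k ρ x‖ ≤ C k := by
  choose B hB0 hB using fun m : ℕ × ℕ =>
    exists_pow_mul_norm_iteratedFDeriv_exp_neg_compExponent_le (E := E) (C₀ := C₀) hK hR hc hα
      m.1 m.2
  choose C hC using fun k : ℕ => exists_integral_norm_iteratedFDeriv_le
    ((SchwartzMap.postcompCLM Complex.reCLM).comp (fourierInvCLM (E := E))) hB0 k
  refine ⟨C, fun σ hσ hlow => ?_⟩
  let g : 𝓢(E, ℂ) :=
    { toFun := fun p => Complex.exp (-compExponent σ p)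
      smooth' := hσ.contDiff_compExponent.neg.cexp
      decay' := fun k n => ⟨_, hB (k, n) σ hσ hlow⟩ }
  have hg : ∀ p, g p = Complex.exp (-compExponent σ p) := fun p => rfl
  refine ⟨SchwartzMap.postcompCLM Complex.reCLM (fourierInvCLM g), fun p => ?_, fun k => ?_⟩
  · simp only [SchwartzMap.postcompCLM_apply, Complex.reCLM_apply]
    rw [← hg p]
    refine integral_re_fourierInvCLM (fun q => ?_) p
    rw [hg, hg, compExponent_neg, ← Complex.exp_conj, map_neg]
  · exact hC k g fun m => SchwartzMap.seminorm_le_bound ℝ m.1 m.2 g (hB0 m)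
      (hB m σ hσ hlow)

end Schwartz

/-! ### Averaging a bounded function against a Schwartz function -/

section Averaging

open scoped SchwartzMap

universe u

variable {E : Type u} [NormedAddCommGroup E] [InnerProductSpace ℝ E] [FiniteDimensional ℝ E]
  [MeasurableSpace E] [BorelSpace E]

/-- The average `x ↦ ∫ ψ(x + y) f(y) dy`. -/
noncomputable def average {G : Type u} [NormedAddCommGroup G] [NormedSpace ℝ G] (ψ : E → ℝ)
    (f : E → G) (x : E) : G :=
  ∫ y, ψ (x + y) • f y

variable {G : Type u} [NormedAddCommGroup G] [NormedSpace ℝ G] {ψ : E → ℝ} {M : ℝ}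

/-- The variable x is moved from ψ, which is merely measurable in the applications, to the smooth
factor. -/
theorem average_eq (f : E → G) (x : E) : average ψ f x = ∫ u, ψ u • f (u - x) := by
  rw [average, ← integral_sub_right_eq_self _ x]
  simp

/-- An integrable majorant valid for all x near x₀, needed to differentiate under the integral. -/
theorem exists_norm_sub_le (f : 𝓢(E, G)) (x₀ : E) : ∃ w : E → ℝ, Integrable w ∧
    ∀ x ∈ Metric.ball x₀ 1, ∀ u, ‖f (u - x)‖ ≤ w u := by
  set m := (volume : Measure E).integrablePower
  set D := 2 ^ m * (Finset.Iic (m, 0)).sup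
    (fun m : ℕ × ℕ => SchwartzMap.seminorm ℝ m.1 m.2 (E := E) (F := G)) f
  have hD : ∀ y, (1 + ‖y‖) ^ m * ‖f y‖ ≤ D := fun y => by
    have := SchwartzMap.one_add_le_sup_seminorm_apply (𝕜 := ℝ) (m := (m, 0)) (k := m) (n := 0)
      le_rfl le_rfl f y
    simpa only [norm_iteratedFDeriv_zero] using this
  refine ⟨fun u => (2 ^ m * D) * (1 + ‖u - x₀‖) ^ (-(m : ℝ)), ?_, fun x hx u => ?_⟩
  · exact ((Measure.integrable_pow_neg_integrablePower (volume : Measure E)).comp_sub_right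
      x₀).const_mul _
  · have h1 : 1 + ‖u - x₀‖ ≤ 2 * (1 + ‖u - x‖) := by
      have h2 := norm_add_le (u - x) (x - x₀)
      rw [sub_add_sub_cancel, ← dist_eq_norm x x₀] at h2
      linarith [Metric.mem_ball.1 hx, norm_nonneg (u - x)]
    beta_reduce
    rw [Real.rpow_neg (by positivity), Real.rpow_natCast, ← div_eq_mul_inv,
      le_div_iff₀ (by positivity)]
    calc ‖f (u - x)‖ * (1 + ‖u - x₀‖) ^ m ≤ ‖f (u - x)‖ * (2 * (1 + ‖u - x‖)) ^ m := by gcongr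
      _ = 2 ^ m * ((1 + ‖u - x‖) ^ m * ‖f (u - x)‖) := by rw [mul_pow]; ring
      _ ≤ _ := by
          gcongr
          exact hD _

/-- The derivative is again an average, of a Schwartz function with values in `E →L[ℝ] G`; hence
higher orders follow by induction over varying targets G. -/
theorem hasFDerivAt_average (hψ : Measurable ψ) (hM : ∀ x, |ψ x| ≤ M) (f : 𝓢(E, G)) (x : E) :
    HasFDerivAt (average ψ f) (average ψ (-SchwartzMap.fderivCLM ℝ E G f) x) x := by
  have h0 : average ψ f = fun x => ∫ u, ψ u • f (u - x) := funext fun x => average_eq _ x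
  obtain ⟨w, hw, hwb⟩ := exists_norm_sub_le (-SchwartzMap.fderivCLM ℝ E G f) x
  obtain ⟨w', hw', hwb'⟩ := exists_norm_sub_le f x
  have hmeas : ∀ {G : Type u} [NormedAddCommGroup G] [NormedSpace ℝ G] (f : 𝓢(E, G)) (x : E),
      AEStronglyMeasurable (fun u => ψ u • f (u - x)) := fun f x =>
    hψ.aestronglyMeasurable.smul (Continuous.aestronglyMeasurable (by fun_prop))
  have hbd : ∀ {G : Type u} [NormedAddCommGroup G] [NormedSpace ℝ G] (z : G) (u : E) {r : ℝ},
      ‖z‖ ≤ r → ‖ψ u • z‖ ≤ M * r := fun z u r hr => by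
    rw [norm_smul]
    have := (abs_nonneg _).trans (hM u)
    gcongr
    exact hM u
  rw [h0, average_eq]
  refine hasFDerivAt_integral_of_dominated_of_fderiv_le (𝕜 := ℝ) (Metric.ball_mem_nhds x one_pos)
    (F' := fun x u => ψ u • (-SchwartzMap.fderivCLM ℝ E G f) (u - x)) (bound := fun u => M * w u)
    (Eventually.of_forall fun q => hmeas f q)
    ((hw'.const_mul M).mono' (hmeas f x) (ae_of_all _ fun u => hbd _ _
      (hwb' x (Metric.mem_ball_self one_pos) u)))
    (hmeas _ x) (ae_of_all _ fun u q hq => hbd _ _ (hwb q hq u)) (hw.const_mul M)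
    (ae_of_all _ fun u q _ => ?_)
  have h1 : HasFDerivAt (fun q => f (u - q)) (-fderiv ℝ f (u - q)) q := by
    have h2 : HasFDerivAt (fun q : E => u - q) (-ContinuousLinearMap.id ℝ E) q :=
      (hasFDerivAt_id q).const_sub u
    exact ((f.hasFDerivAt (u - q)).comp q h2).congr_fderiv (by ext; simp)
  exact (h1.const_smul (ψ u)).congr_fderiv (by simp)

theorem contDiff_average (hψ : Measurable ψ) (hM : ∀ x, |ψ x| ≤ M) (n : ℕ) (f : 𝓢(E, G)) :
    ContDiff ℝ n (average ψ f) := by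
  induction n generalizing G with
  | zero =>
    exact contDiff_zero.2 (continuous_iff_continuousAt.2 fun x =>
      (hasFDerivAt_average hψ hM f x).continuousAt)
  | succ n ih =>
    refine (contDiff_succ_iff_fderiv (n := n)).2
      ⟨fun x => (hasFDerivAt_average hψ hM f x).differentiableAt, by simp, ?_⟩
    rw [funext fun x => (hasFDerivAt_average hψ hM f x).fderiv]
    exact ih _

theorem norm_iteratedFDeriv_average_le (hψ : Measurable ψ) (hM : ∀ x, |ψ x| ≤ M) (n : ℕ)
    (f : 𝓢(E, G)) (x : E) :
    ‖iteratedFDeriv ℝ n (average ψ f) x‖ ≤ M * ∫ y, ‖iteratedFDeriv ℝ n f y‖ := by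
  induction n generalizing G with
  | zero =>
    simp only [norm_iteratedFDeriv_zero]
    rw [average, ← integral_const_mul]
    refine norm_integral_le_of_norm_le (f.integrable.norm.const_mul M) (ae_of_all _ fun y => ?_)
    rw [norm_smul]
    gcongr
    exact hM _
  | succ n ih =>
    rw [← norm_iteratedFDeriv_fderiv, funext fun x => (hasFDerivAt_average hψ hM f x).fderiv]
    refine (ih _).trans_eq ?_
    congr 2 with y
    rw [← norm_iteratedFDeriv_fderiv]
    have h1 : ⇑(-SchwartzMap.fderivCLM ℝ E G f) = -fderiv ℝ f := by
      ext1 y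
      simp
    rw [h1, iteratedFDeriv_neg_apply, norm_neg]

end Averaging

/-! ### Transport of a jump measure along a curve of linear maps -/

section Transport

variable {E F : Type*} [NormedAddCommGroup E] [InnerProductSpace ℝ E] [FiniteDimensional ℝ E]
  [MeasurableSpace E] [BorelSpace E] [NormedAddCommGroup F] [InnerProductSpace ℝ F]
  [FiniteDimensional ℝ F] [MeasurableSpace F] [BorelSpace F]

/-- The image of `1_{(0, 1]}(s) ds ⊗ σ(dz)` by `(s, z) ↦ L_s z`. -/
noncomputable def transportMeasure (L : ℝ → F →L[ℝ] E) (σ : Measure F) : Measure E :=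
  ((volume.restrict (Set.Ioc (0 : ℝ) 1)).prod σ).map fun q => L q.1 q.2

variable {L : ℝ → F →L[ℝ] E} {σ : Measure F} [SFinite σ] {K R : ℝ}

theorem continuous_uncurry_clm (hL : Continuous L) : Continuous fun q : ℝ × F => L q.1 q.2 :=
  (hL.comp continuous_fst).clm_apply continuous_snd

theorem ae_prod_Ioc {p : F → Prop} (hp : ∀ᵐ z ∂σ, p z) :
    ∀ᵐ q ∂(volume.restrict (Set.Ioc (0 : ℝ) 1)).prod σ, q.1 ∈ Set.Ioc (0 : ℝ) 1 ∧ p q.2 :=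
  (Measure.quasiMeasurePreserving_fst.ae (ae_restrict_mem measurableSet_Ioc)).and
    (Measure.quasiMeasurePreserving_snd.ae hp)

theorem hasBoundedJumps_transportMeasure (hL : Continuous L) (hK : 0 ≤ K) (hR : 0 ≤ R)
    (hLK : ∀ s ∈ Set.Icc (0 : ℝ) 1, ‖L s‖ ≤ K) (hσ : Integrable (fun z => ‖z‖ ^ 2) σ)
    (hσR : ∀ᵐ z ∂σ, ‖z‖ ≤ R) :
    HasBoundedJumps (transportMeasure L σ) (K ^ 2 * ∫ z, ‖z‖ ^ 2 ∂σ) (K * R) := by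
  have hc := continuous_uncurry_clm hL
  have hb : ∀ᵐ q ∂(volume.restrict (Set.Ioc (0 : ℝ) 1)).prod σ, ‖L q.1 q.2‖ ≤ K * ‖q.2‖ ∧
      ‖q.2‖ ≤ R := by
    filter_upwards [ae_prod_Ioc hσR] with q hq
    exact ⟨(L q.1).le_of_opNorm_le (hLK _ (Set.Ioc_subset_Icc_self hq.1)) _, hq.2⟩
  have hbd : ∀ᵐ q ∂(volume.restrict (Set.Ioc (0 : ℝ) 1)).prod σ,
      ‖L q.1 q.2‖ ^ 2 ≤ K ^ 2 * ‖q.2‖ ^ 2 := by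
    filter_upwards [hb] with q hq
    rw [← mul_pow]
    gcongr
    exact hq.1
  have hint : Integrable (fun q : ℝ × F => K ^ 2 * ‖q.2‖ ^ 2)
      ((volume.restrict (Set.Ioc (0 : ℝ) 1)).prod σ) := (hσ.comp_snd _).const_mul _
  refine ⟨?_, ?_, ?_, by positivity⟩
  · rw [transportMeasure, integrable_map_measure (by fun_prop) hc.aemeasurable]
    refine hint.mono' (Continuous.aestronglyMeasurable (hc.norm.pow 2)) ?_
    filter_upwards [hbd] with q hq
    rwa [Function.comp_apply, Real.norm_of_nonneg (by positivity)]
  · rw [transportMeasure, integral_map hc.aemeasurable (by fun_prop)]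
    refine (integral_mono_of_nonneg (ae_of_all _ fun _ => by positivity) hint hbd).trans ?_
    rw [integral_const_mul]
    refine mul_le_mul_of_nonneg_left ?_ (by positivity)
    rw [integral_fun_snd (fun z : F => ‖z‖ ^ 2)]
    simp
  · rw [transportMeasure, ae_map_iff hc.aemeasurable (measurableSet_le (by fun_prop) (by fun_prop))]
    filter_upwards [hb] with q hq
    exact hq.1.trans (by gcongr; exact hq.2)

/-- The time-integrated exponent is thereby itself the exponent of one measure with bounded jumps,
to which `exists_schwartz_density` applies. -/
theorem compExponent_transportMeasure (hL : Continuous L) (hσ : Integrable (fun z => ‖z‖ ^ 2) σ)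
    (q : E) : compExponent (transportMeasure L σ) q =
      ∫ s in (0 : ℝ)..1, compExponent σ ((L s).adjoint q) := by
  have hc := continuous_uncurry_clm hL
  have hk : Continuous (compKernel q) :=
    continuous_compKernel.comp (by fun_prop : Continuous fun z : E => (q, z))
  obtain ⟨K, hK⟩ := isCompact_Icc.exists_bound_of_continuousOn (s := Set.Icc (0 : ℝ) 1)
    hL.continuousOn
  have hK0 : 0 ≤ K := (norm_nonneg _).trans (hK 0 (by simp))
  have hint : Integrable (fun p : ℝ × F => compKernel q (L p.1 p.2))
      ((volume.restrict (Set.Ioc (0 : ℝ) 1)).prod σ) := by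
    refine ((hσ.comp_snd _).const_mul (2 * ‖q‖ ^ 2 * K ^ 2)).mono'
      (hk.comp hc).aestronglyMeasurable ?_
    filter_upwards [ae_prod_Ioc (p := fun _ => True) (ae_of_all _ fun _ => trivial)] with p hp
    refine (norm_compKernel_le _ _).trans ?_
    rw [mul_assoc _ (K ^ 2), ← mul_pow]
    gcongr
    exact (L p.1).le_of_opNorm_le (hK _ (Set.Ioc_subset_Icc_self hp.1)) _
  rw [compExponent, transportMeasure, integral_map hc.aemeasurable hk.aestronglyMeasurable,
    integral_prod _ hint, intervalIntegral.integral_of_le zero_le_one]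
  simp_rw [compExponent, compKernel, ContinuousLinearMap.adjoint_inner_left]

theorem re_compExponent_transportMeasure_ge {α c c' C : ℝ} (hα : 0 < α) (hc : 0 ≤ c)
    (hL : Continuous L) (hσ : Integrable (fun z => ‖z‖ ^ 2) σ)
    (h : ∀ p, c * ‖p‖ ^ α - C ≤ (compExponent σ p).re) {q : E}
    (hq : c' * ‖q‖ ^ α ≤ ∫ s in (0 : ℝ)..1, ‖(L s).adjoint q‖ ^ α) :
    c * c' * ‖q‖ ^ α - C ≤ (compExponent (transportMeasure L σ) q).re := by
  have h1 : Continuous fun s => compExponent σ ((L s).adjoint q) :=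
    continuous_comp_adjoint (continuous_compExponent hσ) hL q
  have h2 : Continuous fun s => ‖(L s).adjoint q‖ ^ α :=
    continuous_comp_adjoint (Φ := fun p : F => ‖p‖ ^ α)
      (continuous_norm.rpow_const fun _ => Or.inr hα.le) hL q
  rw [compExponent_transportMeasure hL hσ]
  have h3 : (∫ s in (0 : ℝ)..1, compExponent σ ((L s).adjoint q)).re =
      ∫ s in (0 : ℝ)..1, (compExponent σ ((L s).adjoint q)).re :=
    (Complex.reCLM.intervalIntegral_comp_comm (h1.intervalIntegrable 0 1)).symm
  rw [h3]
  calc c * c' * ‖q‖ ^ α - C ≤ c * (∫ s in (0 : ℝ)..1, ‖(L s).adjoint q‖ ^ α) - C := by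
        rw [mul_assoc]
        gcongr
    _ = ∫ s in (0 : ℝ)..1, (c * ‖(L s).adjoint q‖ ^ α - C) := by
        rw [intervalIntegral.integral_sub ((h2.const_mul c).intervalIntegrable 0 1)
          (intervalIntegrable_const), intervalIntegral.integral_const_mul]
        simp
    _ ≤ _ := intervalIntegral.integral_mono zero_le_one
        (Continuous.intervalIntegrable (by fun_prop) 0 1)
        (Continuous.intervalIntegrable (Complex.continuous_re.comp h1) 0 1) fun s => h _

end Transport

/-! ### Measures whose characteristic function has a factor with a signed density -/

section SignedDensity

open scoped SchwartzMap

variable {E : Type*} [NormedAddCommGroup E] [InnerProductSpace ℝ E] [FiniteDimensional ℝ E]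
  [MeasurableSpace E] [BorelSpace E]

theorem isFiniteMeasure_withDensity_coe {r : E → ℝ≥0} (hr : Integrable fun y => (r y : ℝ)) :
    IsFiniteMeasure ((volume : Measure E).withDensity fun y => (r y : ℝ≥0∞)) := by
  refine isFiniteMeasure_withDensity ?_
  have := hr.2
  rw [hasFiniteIntegral_iff_enorm] at this
  simpa using this.ne

theorem integral_map_withDensity {G : Type*} [NormedAddCommGroup G] [NormedSpace ℝ G]
    {r : E → ℝ≥0} (hr : Measurable r) (hri : Integrable (fun y => (r y : ℝ))) (m : Measure E)
    [IsProbabilityMeasure m] (T : E →L[ℝ] E) (a : E) {f : E → G} (hf : StronglyMeasurable f)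
    {M : ℝ} (hM : ∀ x, ‖f x‖ ≤ M) :
    ∫ x, f x ∂(((volume.withDensity fun y => (r y : ℝ≥0∞)).prod m).map
      fun q => a + T q.1 + q.2) = ∫ y, (r y : ℝ) • ∫ w, f (a + T y + w) ∂m := by
  have := isFiniteMeasure_withDensity_coe hri
  have hc : Continuous fun q : E × E => a + T q.1 + q.2 := by fun_prop
  rw [integral_map hc.aemeasurable hf.aestronglyMeasurable, integral_prod _ ?_,
    integral_withDensity_eq_integral_smul hr]
  · rfl
  · exact (integrable_const M).mono' (hf.comp_measurable hc.measurable).aestronglyMeasurable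
      (ae_of_all _ fun q => hM _)

/-- Nonnegativity of ρ is not known, so its positive and negative parts are handled as finite
measures k₁ and k₂. The factorization says that k₁ and m + k₂ have the same characteristic function,
so they coincide. -/
theorem integral_eq_of_charFun_eq {m m' : Measure E} [IsProbabilityMeasure m]
    [IsProbabilityMeasure m'] {ρ : 𝓢(E, ℝ)} {T : E →L[ℝ] E} {a : E}
    (h : ∀ p, charFun m p = Complex.exp ((inner ℝ a p : ℝ) * Complex.I) *
      (∫ y, Complex.exp ((inner ℝ y (T.adjoint p) : ℝ) * Complex.I) * (ρ y : ℂ)) * charFun m' p)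
    {φ : E → ℝ} (hφ : Measurable φ) {M : ℝ} (hM : ∀ x, |φ x| ≤ M) :
    ∫ x, φ x ∂m = ∫ y, (∫ w, φ (a + T y + w) ∂m') • ρ y := by
  let r₁ : E → ℝ≥0 := fun y => (ρ y).toNNReal
  let r₂ : E → ℝ≥0 := fun y => (-ρ y).toNNReal
  have hr₁ : Measurable r₁ := by fun_prop
  have hr₂ : Measurable r₂ := by fun_prop
  have hρ₁ : ∀ y, ‖(r₁ y : ℝ)‖ ≤ ‖ρ y‖ := fun y => by
    simp only [r₁, Real.coe_toNNReal', Real.norm_eq_abs]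
    rw [abs_of_nonneg (by positivity)]
    exact max_le (le_abs_self _) (abs_nonneg _)
  have hρ₂ : ∀ y, ‖(r₂ y : ℝ)‖ ≤ ‖ρ y‖ := fun y => by
    simp only [r₂, Real.coe_toNNReal', Real.norm_eq_abs]
    rw [abs_of_nonneg (by positivity)]
    exact max_le (neg_le_abs _) (abs_nonneg _)
  have hi₁ : Integrable (fun y => (r₁ y : ℝ)) :=
    ρ.integrable.mono (by fun_prop) (ae_of_all _ hρ₁)
  have hi₂ : Integrable (fun y => (r₂ y : ℝ)) :=
    ρ.integrable.mono (by fun_prop) (ae_of_all _ hρ₂)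
  have hdiff : ∀ y, ρ y = r₁ y - r₂ y := fun y => by
    simp only [r₁, r₂, Real.coe_toNNReal']
    rw [max_zero_sub_eq_self]
  let k₁ := ((volume.withDensity fun y => (r₁ y : ℝ≥0∞)).prod m').map fun q => a + T q.1 + q.2
  let k₂ := ((volume.withDensity fun y => (r₂ y : ℝ≥0∞)).prod m').map fun q => a + T q.1 + q.2
  have := isFiniteMeasure_withDensity_coe hi₁
  have := isFiniteMeasure_withDensity_coe hi₂
  have hk₁ : IsFiniteMeasure k₁ := by infer_instance
  have hk₂ : IsFiniteMeasure k₂ := by infer_instance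
  -- Used twice: with complex exponentials to identify the measures, then with φ.
  have key : ∀ {G : Type} [NormedAddCommGroup G] [NormedSpace ℝ G] {f : E → G} {M : ℝ},
      StronglyMeasurable f → (∀ x, ‖f x‖ ≤ M) →
      ∫ x, f x ∂k₁ = (∫ y, ρ y • ∫ w, f (a + T y + w) ∂m') + ∫ x, f x ∂k₂ := by
    intro G _ _ f M hf hfM
    have hm : StronglyMeasurable fun y => ∫ w, f (a + T y + w) ∂m' :=
      StronglyMeasurable.integral_prod_right' (ν := m')
        (f := fun q : E × E => f (a + T q.1 + q.2))
        (hf.comp_measurable (by fun_prop : Continuous fun q : E × E =>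
          a + T q.1 + q.2).measurable)
    have hb : ∀ y, ‖∫ w, f (a + T y + w) ∂m'‖ ≤ M := fun y => by
      simpa using norm_integral_le_of_norm_le_const (μ := m')
        (ae_of_all _ fun w => hfM (a + T y + w))
    rw [integral_map_withDensity hr₁ hi₁ m' T a hf hfM,
      integral_map_withDensity hr₂ hi₂ m' T a hf hfM, ← sub_eq_iff_eq_add, ← integral_sub]
    · simp_rw [hdiff, sub_smul]
    · exact hi₁.smul_bdd M hm.aestronglyMeasurable (ae_of_all _ hb)
    · exact hi₂.smul_bdd M hm.aestronglyMeasurable (ae_of_all _ hb)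
  have hmeas : k₁ = m + k₂ := by
    refine Measure.ext_of_charFun (funext fun p => ?_)
    have hexp : ∀ x : E, ‖Complex.exp ((inner ℝ x p : ℝ) * Complex.I)‖ ≤ 1 := fun x => by
      rw [Complex.norm_exp_ofReal_mul_I]
    have hsm : StronglyMeasurable fun x : E => Complex.exp ((inner ℝ x p : ℝ) * Complex.I) :=
      Continuous.stronglyMeasurable (by fun_prop)
    have hadd : charFun (m + k₂) p = charFun m p + charFun k₂ p := by
      simp_rw [charFun_apply]
      exact integral_add_measure
        ((integrable_const (1 : ℝ)).mono' hsm.aestronglyMeasurable (ae_of_all _ hexp))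
        ((integrable_const (1 : ℝ)).mono' hsm.aestronglyMeasurable (ae_of_all _ hexp))
    rw [hadd, h, charFun_apply, charFun_apply (μ := k₂), key hsm hexp]
    congr 1
    rw [← integral_const_mul, ← integral_mul_const]
    congr 1 with y
    have h1 : ∀ w, Complex.exp ((inner ℝ (a + T y + w) p : ℝ) * Complex.I) =
        Complex.exp ((inner ℝ a p : ℝ) * Complex.I) *
          Complex.exp ((inner ℝ y (T.adjoint p) : ℝ) * Complex.I) *
          Complex.exp ((inner ℝ w p : ℝ) * Complex.I) := fun w => by
      rw [← Complex.exp_add, ← Complex.exp_add, inner_add_left, inner_add_left,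
        ContinuousLinearMap.adjoint_inner_right]
      congr 1
      push_cast
      ring
    simp_rw [h1]
    rw [integral_const_mul, ← charFun_apply, Complex.real_smul]
    ring
  have hint : ∀ (k : Measure E) [IsFiniteMeasure k], Integrable φ k := fun k _ =>
    (integrable_const M).mono' hφ.aestronglyMeasurable (ae_of_all _ hM)
  have h1 := key hφ.stronglyMeasurable hM
  rw [hmeas, integral_add_measure (hint m) (hint k₂)] at h1
  rw [add_right_cancel h1]
  simp_rw [smul_eq_mul, mul_comm]

end SignedDensity

/-! ### Factorization of the law of the Ornstein–Uhlenbeck process -/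

section Factorization

open scoped SchwartzMap

variable {N d : ℕ} {A : Matrix (Fin N) (Fin N) ℝ} {B : Matrix (Fin N) (Fin d) ℝ}
  {r₀ α : ℝ} {μ : Measure (Metric.sphere (0 : EuclideanSpace ℝ (Fin d)) 1)}
  {ν : Measure (EuclideanSpace ℝ (Fin d))}

variable (A B) in
/-- The rescaled drift of the pair `(A, B)`. -/
noncomputable def kalmanDrift (τ : ℝ) :
    EuclideanSpace ℝ (Fin N) →L[ℝ] EuclideanSpace ℝ (Fin N) :=
  rescaledDrift (matrixCLM A) (flag A B) (kalmanIndex A B) τ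

variable (A B) in
/-- The intrinsic dilation of the pair `(A, B)`. -/
noncomputable def kalmanDilation (τ : ℝ) :
    EuclideanSpace ℝ (Fin N) →L[ℝ] EuclideanSpace ℝ (Fin N) :=
  dilation (flag A B) (kalmanIndex A B) τ

/-- C precedes τ: the flow bound, and thus the jump bounds, as well as the growth constant c c' are
uniform over τ in [0, 1]. -/
theorem exists_rescaled_density (hK : KalmanCondition A B) (hND : ConditionND ν r₀ α μ) :
    ∃ C : ℕ → ℝ, ∀ τ ∈ Set.Icc (0 : ℝ) 1, ∃ ρ : 𝓢(EuclideanSpace ℝ (Fin N), ℝ),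
      (∀ p, ∫ x, Complex.exp ((inner ℝ x p : ℝ) * Complex.I) * (ρ x : ℂ) =
        Complex.exp (-∫ s in (0 : ℝ)..1, compExponent (polarMeasure α r₀ μ)
          (((flow (kalmanDrift A B τ) s).comp (matrixCLM B)).adjoint p))) ∧
      ∀ k, ∫ x, ‖iteratedFDeriv ℝ k ρ x‖ ≤ C k := by
  have := hND.isFiniteMeasure
  have hr := hND.radius_pos
  have hα := hND.exponent_pos
  have hσ := integrable_sq_polarMeasure (μ := μ) hND.exponent_lt_two hr.le
  obtain ⟨K, hK0, hKb⟩ := exists_norm_flow_rescaledDrift_le (matrixCLM A) (flag A B)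
    (kalmanIndex A B)
  obtain ⟨c, C₀, hc, -, hlow⟩ := exists_re_compExponent_polarMeasure_lower_bound hα
    hND.exponent_lt_two hr hND.nonDegenerate
  obtain ⟨c', hc', hlow'⟩ := exists_lower_bound_rescaled (isDriftFlag_flag hK) flag_succ hα
  have hKB : 0 ≤ K * ‖matrixCLM B‖ := by positivity
  obtain ⟨C, hC⟩ := exists_schwartz_density (E := EuclideanSpace ℝ (Fin N)) (C₀ := C₀)
    (K := (K * ‖matrixCLM B‖) ^ 2 * ∫ z, ‖z‖ ^ 2 ∂(polarMeasure α r₀ μ))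
    (R := K * ‖matrixCLM B‖ * r₀) (c := c * c') (α := α)
    (mul_nonneg (by positivity) (integral_nonneg fun z => by positivity)) (by positivity)
    (by positivity) hα
  refine ⟨C, fun τ hτ => ?_⟩
  have hL : Continuous fun s => (flow (kalmanDrift A B τ) s).comp (matrixCLM B) :=
    (continuous_flow _).clm_comp continuous_const
  obtain ⟨ρ, hρ, hρC⟩ := hC (transportMeasure (fun s => (flow (kalmanDrift A B τ) s).comp
      (matrixCLM B)) (polarMeasure α r₀ μ))
    (hasBoundedJumps_transportMeasure hL hKB hr.le (fun s hs =>
      (ContinuousLinearMap.opNorm_comp_le _ _).trans (by gcongr; exact hKb τ hτ s hs)) hσ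
      ae_norm_le_polarMeasure)
    fun p => re_compExponent_transportMeasure_ge hα hc.le hL hσ hlow (hlow' τ hτ p)
  refine ⟨ρ, fun p => ?_, hρC⟩
  rw [hρ, compExponent_transportMeasure hL hσ]

theorem kalmanDilation_comp (hK : KalmanCondition A B) (τ : ℝ) :
    (kalmanDilation A B τ).comp (matrixCLM B) = matrixCLM B := by
  have hV := isDriftFlag_flag hK
  ext1 z
  -- If the index is 0 the dilation is an empty sum, but then ⊥ = ⊤ and the space is trivial.
  -- Otherwise Im B lies in V_1, which the dilation fixes.
  rcases Nat.eq_zero_or_pos (kalmanIndex A B) with h0 | h0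
  · have h1 := hV.top
    rw [h0, hV.zero] at h1
    have h2 : ∀ x : EuclideanSpace ℝ (Fin N), x = 0 := fun x => by
      have : x ∈ (⊥ : Submodule ℝ (EuclideanSpace ℝ (Fin N))) := h1 ▸ Submodule.mem_top
      simpa using this
    rw [h2 (matrixCLM B z)]
    exact h2 _
  · refine dilation_apply_of_mem_one hV h0 τ ?_
    rw [flag_succ]
    exact Submodule.mem_sup_right ⟨z, by simp⟩

theorem flow_smul {E : Type*} [NormedAddCommGroup E] [NormedSpace ℝ E] (X : E →L[ℝ] E) (τ s : ℝ) :
    flow (τ • X) s = flow X (τ * s) := by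
  rw [flow, flow, smul_smul, mul_comm]

variable (A B α) in
/-- The linear map by which the rescaled density is transported at time `t`. -/
noncomputable def scalingMap (τ t : ℝ) : EuclideanSpace ℝ (Fin N) →L[ℝ] EuclideanSpace ℝ (Fin N) :=
  τ ^ (1 / α) • (flow (matrixCLM A) (t - τ) * kalmanDilation A B τ)

variable (A B α) in
/-- The initial condition in rescaled coordinates. -/
noncomputable def scaledFlow (τ : ℝ) : EuclideanSpace ℝ (Fin N) →L[ℝ] EuclideanSpace ℝ (Fin N) :=
  (τ ^ (1 / α))⁻¹ • (flow (kalmanDrift A B τ) 1 * kalmanDilation A B τ⁻¹)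

theorem flow_mul_kalmanDilation_mul_flow (hK : KalmanCondition A B) (τ t s : ℝ) :
    flow (matrixCLM A) (t - τ) * kalmanDilation A B τ * flow (kalmanDrift A B τ) s =
      flow (matrixCLM A) (t - τ + τ * s) * kalmanDilation A B τ := by
  rw [flow_add, ← flow_smul, mul_assoc, mul_assoc]
  congr 1
  exact flow_semiconj (dilation_mul_rescaledDrift (isDriftFlag_flag hK) τ) s

theorem scalingMap_comp (hK : KalmanCondition A B) (τ t s : ℝ) :
    (scalingMap A B α τ t).comp ((flow (kalmanDrift A B τ) s).comp (matrixCLM B)) =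
      τ ^ (1 / α) • flowMap A B (t - τ + τ * s) := by
  ext1 z
  have h1 := DFunLike.congr_fun (flow_mul_kalmanDilation_mul_flow hK τ t s) (matrixCLM B z)
  have h2 := DFunLike.congr_fun (kalmanDilation_comp hK τ) z
  simp only [mul_apply_eq_comp, ContinuousLinearMap.comp_apply] at h1 h2
  simp only [scalingMap, flowMap, smul_apply, mul_apply_eq_comp, ContinuousLinearMap.comp_apply]
  rw [h1, h2]

/-- The starting point e^{tA}x is absorbed into the rescaled coordinates, so that dependence on x
becomes a translation by Λx. -/
theorem scalingMap_scaledFlow (hK : KalmanCondition A B) {τ : ℝ} (hτ : 0 < τ) (t : ℝ)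
    (x : EuclideanSpace ℝ (Fin N)) :
    scalingMap A B α τ t (scaledFlow A B α τ x) = flow (matrixCLM A) t x := by
  have h0 : τ ^ (1 / α) ≠ 0 := (Real.rpow_pos_of_pos hτ _).ne'
  have h1 := DFunLike.congr_fun (flow_mul_kalmanDilation_mul_flow hK τ t 1)
    (kalmanDilation A B τ⁻¹ x)
  have h2 := DFunLike.congr_fun (dilation_mul_dilation_inv (isDriftFlag_flag hK) hτ.ne') x
  simp only [mul_apply_eq_comp, mul_one, sub_add_cancel, one_apply_eq_self] at h1 h2
  simp only [scalingMap, scaledFlow, smul_apply, mul_apply_eq_comp, map_smul]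
  rw [inv_smul_smul₀ h0, h1, kalmanDilation, kalmanDilation, h2]

/-- Scaling the argument by τ^{1/α} produces the factor (τ^{1/α})^α = τ, exactly the Jacobian of u =
t - τ + τs. -/
theorem integral_compExponent_scalingMap (hK : KalmanCondition A B) (hND : ConditionND ν r₀ α μ)
    {τ : ℝ} (hτ : 0 < τ) (t : ℝ) (p : EuclideanSpace ℝ (Fin N)) :
    ∫ s in (0 : ℝ)..1, compExponent (polarMeasure α r₀ μ)
        (((flow (kalmanDrift A B τ) s).comp (matrixCLM B)).adjoint
          ((scalingMap A B α τ t).adjoint p)) =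
      ∫ u in (t - τ)..t, compExponent (polarMeasure α (τ ^ (1 / α) * r₀) μ)
        ((flowMap A B u).adjoint p) := by
  have := hND.isFiniteMeasure
  have h1 : ∀ s, compExponent (polarMeasure α r₀ μ)
      (((flow (kalmanDrift A B τ) s).comp (matrixCLM B)).adjoint
        ((scalingMap A B α τ t).adjoint p)) =
      (τ : ℝ) • compExponent (polarMeasure α (τ ^ (1 / α) * r₀) μ)
        ((flowMap A B (t - τ + τ * s)).adjoint p) := fun s => by
    rw [← ContinuousLinearMap.comp_apply, ← ContinuousLinearMap.adjoint_comp, scalingMap_comp hK,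
      map_smulₛₗ, smul_apply, starRingEnd_apply, star_trivial,
      compExponent_polarMeasure_smul hND.exponent_lt_two hND.radius_pos.le
        (Real.rpow_pos_of_pos hτ _), ← Real.rpow_mul hτ.le,
      one_div_mul_cancel hND.exponent_pos.ne', Real.rpow_one, Complex.real_smul]
  simp_rw [h1]
  rw [intervalIntegral.integral_smul, intervalIntegral.smul_integral_comp_add_mul (fun u =>
    compExponent (polarMeasure α (τ ^ (1 / α) * r₀) μ) ((flowMap A B u).adjoint p))]
  simp

/-- The part of the law that remains after the small stable jumps just before `t` are removed. -/
theorem exists_remainder (hν : IsLevyMeasure ν) (hND : ConditionND ν r₀ α μ)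
    (b : EuclideanSpace ℝ (Fin d)) {Q : Matrix (Fin d) (Fin d) ℝ} (hQ : Q.PosSemidef)
    {τ t : ℝ} (hτ : 0 < τ) (hτ1 : τ ≤ 1) (hτt : τ ≤ t) :
    ∃ m : Measure (EuclideanSpace ℝ (Fin N)), IsProbabilityMeasure m ∧ ∀ p,
      Complex.exp (-∫ u in (0 : ℝ)..t, levySymbol b Q ν ((flowMap A B u).adjoint p)) =
        Complex.exp (-∫ u in (t - τ)..t, compExponent (polarMeasure α (τ ^ (1 / α) * r₀) μ)
          ((flowMap A B u).adjoint p)) * charFun m p := by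
  have := hND.isFiniteMeasure
  have hα := hND.exponent_pos
  have hr := hND.radius_pos
  have hs : τ ^ (1 / α) ≤ 1 := Real.rpow_le_one hτ.le hτ1 (by positivity)
  have hs0 : 0 < τ ^ (1 / α) := Real.rpow_pos_of_pos hτ _
  set σ := polarMeasure α (τ ^ (1 / α) * r₀) μ with hσdef
  have hσ : Integrable (fun z => ‖z‖ ^ 2) σ :=
    integrable_sq_polarMeasure hND.exponent_lt_two (by positivity)
  have hcσ := continuous_compExponent hσ
  have hcΦ := hν.continuous_levySymbol b Q
  -- Removing σ = 0 shows that the full symbol is an exponent.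
  have hE1 : IsExponent (levySymbol b Q ν) := by
    simpa [compExponent] using hν.isExponent_sub b hQ (σ := 0) (by simp) (by simp)
  have hE2 : IsExponent fun p => levySymbol b Q ν p - compExponent σ p :=
    hν.isExponent_sub b hQ hσ (hND.polarMeasure_le (by nlinarith))
  have hL := continuous_flowMap A B
  -- The remainder keeps all of Φ on [0, t - τ] and Φ minus the stable part on [t - τ, t].
  have hR := (hE1.intervalIntegral_comp_adjoint hcΦ hL (sub_nonneg.2 hτt)).add
    (hE2.intervalIntegral_comp_adjoint (hcΦ.sub hcσ) hL (by linarith : t - τ ≤ t))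
  obtain ⟨m, hm, hmR⟩ := hR 1 zero_le_one
  refine ⟨m, hm, fun p => ?_⟩
  have hi1 := fun x y : ℝ => (continuous_comp_adjoint hcΦ hL p).intervalIntegrable
    (μ := volume) x y
  have hi2 := fun x y : ℝ => (continuous_comp_adjoint hcσ hL p).intervalIntegrable
    (μ := volume) x y
  have hmp := hmR p
  beta_reduce at hmp
  rw [hmp, ← Complex.exp_add, intervalIntegral.integral_sub (hi1 _ _) (hi2 _ _),
    ← intervalIntegral.integral_add_adjacent_intervals (hi1 0 (t - τ)) (hi1 (t - τ) t)]
  congr 1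
  push_cast
  ring

theorem norm_scaledFlow_le {K τ : ℝ} (hτ : 0 < τ)
    (hKb : ‖flow (kalmanDrift A B τ) 1‖ ≤ K) {h : ℕ} (hh : h ∈ Finset.Icc 1 (kalmanIndex A B))
    {v : EuclideanSpace ℝ (Fin N)} (hv : v ∈ block A B h) :
    ‖scaledFlow A B α τ v‖ ≤ K * τ ^ (-(1 / α + ((h : ℝ) - 1))) * ‖v‖ := by
  obtain ⟨h1, h2⟩ := Finset.mem_Icc.1 hh
  obtain ⟨k, rfl⟩ : ∃ k, h = k + 1 := ⟨h - 1, by lia⟩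
  have h3 : kalmanDilation A B τ⁻¹ v = τ⁻¹ ^ k • v :=
    dilation_apply_of_mem_block monotone_flag (by lia) _ hv
  have h4 : 0 < τ ^ (1 / α) := Real.rpow_pos_of_pos hτ _
  rw [scaledFlow, smul_apply, mul_apply_eq_comp, h3, map_smul, norm_smul, norm_smul, norm_inv,
    Real.norm_of_nonneg h4.le, norm_pow, norm_inv, Real.norm_of_nonneg hτ.le]
  have h5 : τ ^ (-(1 / α + (((k + 1 : ℕ) : ℝ) - 1))) = (τ ^ (1 / α))⁻¹ * τ⁻¹ ^ k := by
    push_cast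
    rw [add_sub_cancel_right, neg_add, Real.rpow_add hτ, Real.rpow_neg hτ.le, Real.rpow_neg hτ.le,
      Real.rpow_natCast, inv_pow]
  rw [h5]
  calc _ ≤ (τ ^ (1 / α))⁻¹ * (τ⁻¹ ^ k * (K * ‖v‖)) := by
        gcongr
        exact (flow (kalmanDrift A B τ) 1).le_of_opNorm_le hKb v
    _ = _ := by ring

theorem abs_le_supNorm {E : Type*} {φ : E → ℝ} (h : BddAbove (Set.range fun x => |φ x|)) (x : E) :
    |φ x| ≤ supNorm φ :=
  le_ciSup h x

/-- The semigroup is, in rescaled coordinates, an average against a Schwartz function whose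
derivatives are controlled uniformly in time. -/
theorem exists_semigroup_eq_average (hK : KalmanCondition A B) (hν : IsLevyMeasure ν)
    (hND : ConditionND ν r₀ α μ) :
    ∃ (C : ℕ → ℝ) (K : ℝ), 0 < K ∧
      ∀ (b : EuclideanSpace ℝ (Fin d)) (Q : Matrix (Fin d) (Fin d) ℝ), Q.PosSemidef →
      ∀ (Ω : Type*) [MeasurableSpace Ω] (P : Measure Ω) [IsProbabilityMeasure P]
        (Z : ℝ≥0 → Ω → EuclideanSpace ℝ (Fin d)), IsLevyProcess P Z (levySymbol b Q ν) →
      ∀ X : EuclideanSpace ℝ (Fin N) → ℝ≥0 → Ω → EuclideanSpace ℝ (Fin N),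
        (∀ x, IsOUProcess A B P Z x (X x)) →
      ∀ φ : EuclideanSpace ℝ (Fin N) → ℝ, Measurable φ → BddAbove (Set.range fun x => |φ x|) →
      ∀ t : ℝ≥0, 0 < t →
        ∃ (Λ : EuclideanSpace ℝ (Fin N) →L[ℝ] EuclideanSpace ℝ (Fin N))
          (ψ : EuclideanSpace ℝ (Fin N) → ℝ) (ρ : 𝓢(EuclideanSpace ℝ (Fin N), ℝ)),
          Measurable ψ ∧ (∀ y, |ψ y| ≤ supNorm φ) ∧
          (∀ k, ∫ x, ‖iteratedFDeriv ℝ k ρ x‖ ≤ C k) ∧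
          semigroup P X t φ = average ψ ρ ∘ Λ ∧
          ∀ h ∈ Finset.Icc 1 (kalmanIndex A B), ∀ v ∈ block A B h,
            ‖Λ v‖ ≤ K * (min (t : ℝ) 1) ^ (-(1 / α + ((h : ℝ) - 1))) * ‖v‖ := by
  obtain ⟨C, hC⟩ := exists_rescaled_density hK hND
  obtain ⟨K, hK0, hKb⟩ := exists_norm_flow_rescaledDrift_le (matrixCLM A) (flag A B)
    (kalmanIndex A B)
  refine ⟨C, K, hK0, fun b Q hQ Ω _ P _ Z hZ X hX φ hφ hφb t ht => ?_⟩
  have ht' : (0 : ℝ) < t := ht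
  -- τ ≤ t keeps the window inside [0, t]; τ ≤ 1 keeps the truncation radius below r₀ and τ in the
  -- compact range of the uniform bounds.
  set τ := min (t : ℝ) 1 with hτdef
  have hτ : 0 < τ := lt_min ht' one_pos
  have hτ1 : τ ≤ 1 := min_le_right _ _
  obtain ⟨ρ, hρ, hρC⟩ := hC τ ⟨hτ.le, hτ1⟩
  obtain ⟨m, hm, hmeq⟩ := exists_remainder (A := A) (B := B) hν hND b hQ hτ hτ1 (min_le_left _ _)
  have hmeas : StronglyMeasurable fun y => ∫ w, φ (scalingMap A B α τ t y + w) ∂m :=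
    StronglyMeasurable.integral_prod_right' (ν := m)
      (f := fun q : EuclideanSpace ℝ (Fin N) × EuclideanSpace ℝ (Fin N) =>
        φ (scalingMap A B α τ t q.1 + q.2))
      (hφ.comp (by fun_prop)).stronglyMeasurable
  refine ⟨scaledFlow A B α τ, fun y => ∫ w, φ (scalingMap A B α τ t y + w) ∂m, ρ,
    hmeas.measurable, fun y => ?_, hρC, ?_, fun h hh v hv =>
      norm_scaledFlow_le hτ (hKb τ ⟨hτ.le, hτ1⟩ 1 (by simp)) hh hv⟩
  · have := norm_integral_le_of_norm_le_const (μ := m)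
      (f := fun w => φ (scalingMap A B α τ t y + w)) (ae_of_all _ fun w => abs_le_supNorm hφb (scalingMap A B α τ t y + w))
    simpa using this
  · ext1 x
    have := Measure.isProbabilityMeasure_map (μ := P) ((hX x).measurable t).aemeasurable
    rw [semigroup, ← integral_map ((hX x).measurable t).aemeasurable hφ.aestronglyMeasurable,
      integral_eq_of_charFun_eq (m' := m) (ρ := ρ) (T := scalingMap A B α τ t)
        (a := flow (matrixCLM A) t x) (fun p => ?_) hφ (abs_le_supNorm hφb)]
    · rw [Function.comp_apply, average]
      simp_rw [map_add, scalingMap_scaledFlow hK hτ]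
    · rw [(hX x).charFun_map hZ (hν.continuous_levySymbol b Q) ht, hmeq p, hρ,
        integral_compExponent_scalingMap hK hND hτ, mul_assoc]

theorem min_one_rpow_neg_le {t a : ℝ} (ht : 0 < t) : (min t 1) ^ (-a) ≤ 1 + t ^ (-a) := by
  rcases le_total t 1 with h | h
  · rw [min_eq_left h]
    linarith
  · rw [min_eq_right h, Real.one_rpow]
    linarith [Real.rpow_pos_of_pos ht (-a)]

end Factorization

end LevyOU

/-! ### The derivative estimates -/

theorem mainTheorem5 {N d : ℕ}
    (A : Matrix (Fin N) (Fin N) ℝ) (B : Matrix (Fin N) (Fin d) ℝ)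
    (hB : B.rank = d) (hK : LevyOU.KalmanCondition A B)
    (ν : Measure (EuclideanSpace ℝ (Fin d))) (hν : LevyOU.IsLevyMeasure ν)
    (r₀ α : ℝ) (μ : Measure (Metric.sphere (0 : EuclideanSpace ℝ (Fin d)) 1))
    (hND : LevyOU.ConditionND ν r₀ α μ) :
    ∃ C : ℝ, 0 < C ∧
      ∀ (b : EuclideanSpace ℝ (Fin d)) (Q : Matrix (Fin d) (Fin d) ℝ), Q.PosSemidef →
      ∀ (Ω : Type*) [MeasurableSpace Ω] (P : Measure Ω) [IsProbabilityMeasure P]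
        (Z : ℝ≥0 → Ω → EuclideanSpace ℝ (Fin d)),
        LevyOU.IsLevyProcess P Z (LevyOU.levySymbol b Q ν) →
      ∀ X : EuclideanSpace ℝ (Fin N) → ℝ≥0 → Ω → EuclideanSpace ℝ (Fin N),
        (∀ x, LevyOU.IsOUProcess A B P Z x (X x)) →
      ∀ e : OrthonormalBasis (Fin N) ℝ (EuclideanSpace ℝ (Fin N)),
        LevyOU.IsAdaptedBasis A B e →
      ∀ φ : EuclideanSpace ℝ (Fin N) → ℝ, Measurable φ → BddAbove (Set.range fun x => |φ x|) →
      ∀ t : ℝ≥0, 0 < t →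
        ContDiff ℝ 3 (LevyOU.semigroup P X t φ) ∧
        ∀ h ∈ Finset.Icc 1 (LevyOU.kalmanIndex A B),
        ∀ h' ∈ Finset.Icc 1 (LevyOU.kalmanIndex A B),
        ∀ h'' ∈ Finset.Icc 1 (LevyOU.kalmanIndex A B),
        ∀ i ∈ LevyOU.blockIndices A B e h,
        ∀ j ∈ LevyOU.blockIndices A B e h',
        ∀ k ∈ LevyOU.blockIndices A B e h'',
        ∀ x : EuclideanSpace ℝ (Fin N),
          |fderiv ℝ (LevyOU.semigroup P X t φ) x (e i)| ≤
            C * LevyOU.supNorm φ *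
              (1 + (t : ℝ) ^ (-((1 + α * ((h : ℝ) - 1)) / α))) ∧
          |iteratedFDeriv ℝ 2 (LevyOU.semigroup P X t φ) x ![e i, e j]| ≤
            C * LevyOU.supNorm φ *
              (1 + (t : ℝ) ^ (-((2 + α * ((h : ℝ) + h' - 2)) / α))) ∧
          |iteratedFDeriv ℝ 3 (LevyOU.semigroup P X t φ) x ![e i, e j, e k]| ≤
            C * LevyOU.supNorm φ *
              (1 + (t : ℝ) ^ (-((3 + α * ((h : ℝ) + h' + h'' - 3)) / α))) := by
  obtain ⟨D, K, hK0, hfact⟩ := LevyOU.exists_semigroup_eq_average hK hν hND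
  have hα := hND.exponent_pos
  -- One constant for all three orders; the 1 makes it positive, and the absolute values are there
  -- because no sign is known for D.
  refine ⟨1 + |D 1| * K ^ 1 + |D 2| * K ^ 2 + |D 3| * K ^ 3, by positivity,
    fun b Q hQ Ω _ P _ Z hZ X hX e he φ hφ hφb t ht => ?_⟩
  obtain ⟨Λ, ψ, ρ, hψ, hψM, hρ, heq, hΛ⟩ := hfact b Q hQ Ω P Z hZ X hX φ hφ hφb t ht
  have ht' : (0 : ℝ) < t := ht
  have hτ : 0 < min (t : ℝ) 1 := lt_min ht' one_pos
  have hS : 0 ≤ LevyOU.supNorm φ := (abs_nonneg _).trans (hψM 0)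
  have hcd : ∀ n : ℕ, ContDiff ℝ n (LevyOU.average ψ ρ) := fun n =>
    LevyOU.contDiff_average hψ hψM n ρ
  have hdir : ∀ h ∈ Finset.Icc 1 (LevyOU.kalmanIndex A B), ∀ i ∈ LevyOU.blockIndices A B e h,
      ‖Λ (e i)‖ ≤ K * (min (t : ℝ) 1) ^ (-(1 / α + ((h : ℝ) - 1))) := fun h hh i hi => by
    simpa using hΛ h hh (e i) hi
  -- All orders at once: by the chain rule the n-th derivative of the average is evaluated at the
  -- vectors Λ(v l), each slot contributes its own power of min(t, 1), and the exponents g l add up.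
  have hder : ∀ (n : ℕ) (x : EuclideanSpace ℝ (Fin N)) (v : Fin n → EuclideanSpace ℝ (Fin N))
      (g : Fin n → ℝ), (∀ l, ‖Λ (v l)‖ ≤ K * (min (t : ℝ) 1) ^ (-(g l))) →
      |iteratedFDeriv ℝ n (LevyOU.semigroup P X t φ) x v| ≤
        |D n| * K ^ n * LevyOU.supNorm φ * (1 + (t : ℝ) ^ (-∑ l, g l)) := fun n x v g hv => by
    rw [heq, ContinuousLinearMap.iteratedFDeriv_comp_right Λ (hcd n) x le_rfl,
      ContinuousMultilinearMap.compContinuousLinearMap_apply, ← Real.norm_eq_abs]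
    calc _ ≤ (LevyOU.supNorm φ * |D n|) * ∏ l, (K * (min (t : ℝ) 1) ^ (-(g l))) := by
          refine (ContinuousMultilinearMap.le_opNorm _ _).trans ?_
          gcongr with l
          · refine (LevyOU.norm_iteratedFDeriv_average_le hψ hψM n ρ _).trans ?_
            gcongr
            exact (hρ n).trans (le_abs_self _)
          · exact hv l
      _ = |D n| * K ^ n * LevyOU.supNorm φ * (min (t : ℝ) 1) ^ (-∑ l, g l) := by
          rw [Finset.prod_mul_distrib, Finset.prod_const, Finset.card_univ, Fintype.card_fin,
            ← Finset.sum_neg_distrib, Real.rpow_sum_of_pos hτ]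
          ring
      _ ≤ _ := by
          gcongr
          exact LevyOU.min_one_rpow_neg_le ht'
  refine ⟨?_, fun h hh h' hh' h'' hh'' i hi j hj k hk x => ⟨?_, ?_, ?_⟩⟩
  · rw [heq]
    exact (hcd 3).comp Λ.contDiff
  · have h1 := hder 1 x ![e i] ![1 / α + ((h : ℝ) - 1)]
      (Fin.forall_fin_one.2 (hdir h hh i hi))
    rw [iteratedFDeriv_one_apply] at h1
    refine h1.trans ?_
    have h2 : ∑ l, (![1 / α + ((h : ℝ) - 1)] : Fin 1 → ℝ) l = (1 + α * ((h : ℝ) - 1)) / α := by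
      simp only [Fin.sum_univ_one, Matrix.cons_val_zero]
      field_simp
    rw [h2]
    gcongr
    have : 0 ≤ |D 2| * K ^ 2 := by positivity
    have : 0 ≤ |D 3| * K ^ 3 := by positivity
    linarith
  · have h1 := hder 2 x ![e i, e j] ![1 / α + ((h : ℝ) - 1), 1 / α + ((h' : ℝ) - 1)]
      (Fin.forall_fin_two.2 ⟨hdir h hh i hi, hdir h' hh' j hj⟩)
    refine h1.trans ?_
    have h2 : ∑ l, (![1 / α + ((h : ℝ) - 1), 1 / α + ((h' : ℝ) - 1)] : Fin 2 → ℝ) l =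
        (2 + α * ((h : ℝ) + h' - 2)) / α := by
      simp only [Fin.sum_univ_two, Matrix.cons_val_zero, Matrix.cons_val_one]
      field_simp
      ring
    rw [h2]
    gcongr
    have : 0 ≤ |D 1| * K ^ 1 := by positivity
    have : 0 ≤ |D 3| * K ^ 3 := by positivity
    linarith
  · have h1 := hder 3 x ![e i, e j, e k]
      ![1 / α + ((h : ℝ) - 1), 1 / α + ((h' : ℝ) - 1), 1 / α + ((h'' : ℝ) - 1)]
      (by
        intro l
        fin_cases l
        exacts [hdir h hh i hi, hdir h' hh' j hj, hdir h'' hh'' k hk])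
    refine h1.trans ?_
    have h2 : ∑ l, (![1 / α + ((h : ℝ) - 1), 1 / α + ((h' : ℝ) - 1), 1 / α + ((h'' : ℝ) - 1)] :
        Fin 3 → ℝ) l = (3 + α * ((h : ℝ) + h' + h'' - 3)) / α := by
      simp only [Fin.sum_univ_three, Matrix.cons_val_zero, Matrix.cons_val_one, Matrix.cons_val]
      field_simp
      ring
    rw [h2]
    gcongr
    have : 0 ≤ |D 1| * K ^ 1 := by positivity
    have : 0 ≤ |D 2| * K ^ 2 := by positivity
    linarith
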